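/- Conventions. A commutative superalgebra is a $\mathbb Z_2$-graded unital real algebra with $ab=(-1)^{|a||b|}ba$ for homogeneous $a,b$; morphisms are unital and preserve parity. A super Weil algebra is a finite-dimensional commutative superalgebra $A=\mathbb R\oplus\mathring A$, where $A\neq 0$ and $\mathring A$ is a graded nilpotent ideal; $\mathrm{pr}_A:A\to\mathbb R$ is the projection. A smooth supermanifold $M$ of dimension $p|q$ is a Hausdorff second countable space $|M|$ with a sheaf $\mathcal O_M$ of commutative superalgebras that is locally isomorphic to $\mathbb R^{p|q}=(\mathbb R^p,\ C^\infty\otimes\Lambda(\theta_1,\dots,\theta_q))$; $\mathcal O(M)$ denotes the global sections and $\mathrm{ev}_x:\mathcal O(M)\to\mathbb R$ the evaluation at $x\in|M|$ of the reduced function. An $A$-point of $M$ is a superalgebra morphism $x_A:\mathcal O(M)\to A$. For a morphism $\varphi:R\to S$ of commutative superalgebras, a homogeneous $\varphi$-derivation of parity $k$ is a linear map $X:R\to S$ that shifts parity by $k$ and satisfies $X(st)=X(s)\varphi(t)+(-1)^{k|s|}\varphi(s)X(t)$ for $s$ homogeneous and all $t$. A $\varphi$-derivation is a sum of an even and an odd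 one; they form a left $S$-module $\mathrm{Der}_\varphi(R,S)$. Let $T_x(M)$ be the super vector space of linear $v:\mathcal O(M)\to\mathbb R$ with $v(fg)=v(f)\,\mathrm{ev}_x(g)+\mathrm{ev}_x(f)\,v(g)$, where $v$ has parity $k$ if it vanishes on sections of parity $k+1$. Let $\mathcal O_{M,x}$ be the stalk at $x$, and let $\mathcal T_{M,x}$ be the left $\mathcal O_{M,x}$-module of germs at $x$ of sections of the sheaf $\mathcal T_M=\mathrm{Der}(\mathcal O_M)$ of vector fields. For an algebra morphism $\rho:B\to A$ and a left $B$-module $L$, $A\otimes_\rho L$ is the quotient of $A\otimes_{\mathbb R}L$ by the relations $a\otimes b\,l\sim a\rho(b)\otimes l$, a left $A$-module. Proposition. Let $A$ be a super Weil algebra. (1) Let $M$ be a smooth supermanifold and $x_A:\mathcal O(M)\to A$ an $A$-point. There is a unique point $x=\tilde x_A\in|M|$ (the base point) with $\mathrm{pr}_A\circ x_A=\mathrm{ev}_x$, and $x_A$ factors uniquely through an algebra morphism $\mathcal O_{M,x}\to A$, again denoted $x_A$. There are isomorphisms of left $A$-modules $$A\otimes_{\mathbb R}T_{x}(M)\ \cong\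 \mathrm{Der}_{x_A}(\mathcal O(M),A)\ \cong\ A\otimes_{x_A}\mathcal T_{M,x}.$$ The first isomorphism $\Phi$ can be chosen to preserve parity and to satisfy $\Phi(a\otimes v)(s)\equiv a\,v(s)$ modulo $\mathring A$ for all $a\in A$, $v\in T_x(M)$, $s\in\mathcal O(M)$. The second is the canonical map: the class of $a\otimes[D]$, with $D$ a vector field near $x$, corresponds to the derivation $s\mapsto a\,x_A([D s]_x)$, where $[Ds]_x$ is the germ at $x$ of $D$ applied to the restriction of $s$. (2) Let $U\subseteq\mathbb R^p$ be open, regarded as a superdomain of dimension $p|q$ with $\mathcal O(U)=C^\infty(U)\otimes\Lambda(\theta_1,\dots,\theta_q)$ and coordinates $x_i,\theta_j$, and let $x_A:\mathcal O(U)\to A$ be an $A$-point. For all $f_1,\dots,f_p,F_1,\dots,F_q\in A$ the formula $$X_{\boldsymbol f}(s)=\sum_{i}f_i\,x_A\!\left(\frac{\partial s}{\partial x_i}\right)+\sum_jF_j\,x_A\!\left(\frac{\partial s}{\partial\theta_j}\right)$$ defines an $x_A$-derivation. It is even (resp. odd) if and only if all $f_i$ are even (resp. odd) and all $F_j$ are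 odd (resp. even). Every $x_A$-derivation is of the form $X_{\boldsymbol f}$ for a unique $\boldsymbol f=(f_1,\dots,f_p,F_1,\dots,F_q)$. -/

import Mathlib

open scoped TensorProduct ContDiff
open TopologicalSpace

noncomputable section

namespace SuperGeom

universe u v

/-! ### Commutative superalgebras and super Weil algebras -/

/-- The Koszul sign `(-1)^(i j)`. -/
def koszulSign (i j : ZMod 2) : ℝ := if i = 1 ∧ j = 1 then -1 else 1

/-- A superalgebra (a `ZMod 2`-graded real algebra) is commutative if
`a b = (-1)^(|a||b|) b a` for homogeneous `a`, `b`. -/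
class IsSuperCommutative {R : Type*} [Ring R] [Algebra ℝ R] (𝒜 : ZMod 2 → Submodule ℝ R) :
    Prop where
  comm : ∀ (i j : ZMod 2) (a b : R), a ∈ 𝒜 i → b ∈ 𝒜 j → a * b = koszulSign i j • (b * a)

/-- A super Weil algebra: a finite dimensional commutative unital real superalgebra
`A = ℝ ⊕ nil` with `nil` a graded nilpotent ideal. (`nil` is declared as a left ideal; being
graded in a commutative superalgebra it is two-sided.) -/
class SuperWeilAlgebra {A : Type*} [Ring A] [Algebra ℝ A] (𝒜 : ZMod 2 → Submodule ℝ A)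
    [GradedAlgebra 𝒜] extends IsSuperCommutative 𝒜 where
  nontrivial : Nontrivial A
  finiteDimensional : FiniteDimensional ℝ A
  nil : Ideal A
  nil_homogeneous : nil.IsHomogeneous 𝒜
  nil_nilpotent : IsNilpotent nil
  isCompl : IsCompl (1 : Submodule ℝ A) (nil.restrictScalars ℝ)

/-! ### Derivations along a superalgebra morphism -/

section Derivations

variable {R S : Type*} [Ring R] [Algebra ℝ R] [Ring S] [Algebra ℝ S]
  {𝒜 : ZMod 2 → Submodule ℝ R} {ℬ : ZMod 2 → Submodule ℝ S} [GradedAlgebra 𝒜] [GradedAlgebra ℬ]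

/-- `X` is a homogeneous `φ`-derivation of parity `k`: it is linear, shifts parity by `k`, and
`X(st) = X(s) φ(t) + (-1)^(|X||s|) φ(s) X(t)`. -/
def IsHomogeneousDerivation (φ : 𝒜 →ₐᵍ[ℝ] ℬ) (k : ZMod 2) (X : R →ₗ[ℝ] S) : Prop :=
  (∀ j, ∀ s ∈ 𝒜 j, X s ∈ ℬ (k + j)) ∧
    ∀ j, ∀ s ∈ 𝒜 j, ∀ t, X (s * t) = X s * φ t + koszulSign k j • (φ s * X t)

theorem IsHomogeneousDerivation.zero (φ : 𝒜 →ₐᵍ[ℝ] ℬ) (k : ZMod 2) :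
    IsHomogeneousDerivation φ k (0 : R →ₗ[ℝ] S) :=
  ⟨fun _ _ _ => Submodule.zero_mem _, fun _ _ _ _ => by simp⟩

theorem IsHomogeneousDerivation.add {φ : 𝒜 →ₐᵍ[ℝ] ℬ} {k : ZMod 2} {X Y : R →ₗ[ℝ] S}
    (hX : IsHomogeneousDerivation φ k X) (hY : IsHomogeneousDerivation φ k Y) :
    IsHomogeneousDerivation φ k (X + Y) :=
  ⟨fun j s hs => Submodule.add_mem _ (hX.1 j s hs) (hY.1 j s hs), fun j s hs t => by
    simp only [LinearMap.add_apply, hX.2 j s hs t, hY.2 j s hs t, mul_add, add_mul, smul_add]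
    abel⟩

theorem koszulSign_add (a k j : ZMod 2) :
    koszulSign (a + k) j = koszulSign k j * koszulSign a j := by
  have h : ∀ z : ZMod 2, z = 0 ∨ z = 1 := by decide
  have h2 : (1 + 1 : ZMod 2) = 0 := by decide
  rcases h a with rfl | rfl <;> rcases h k with rfl | rfl <;> rcases h j with rfl | rfl <;>
    simp [koszulSign, h2]

theorem IsHomogeneousDerivation.smul [IsSuperCommutative ℬ] {φ : 𝒜 →ₐᵍ[ℝ] ℬ} {a k : ZMod 2}
    {c : S} (hc : c ∈ ℬ a) {X : R →ₗ[ℝ] S} (hX : IsHomogeneousDerivation φ k X) :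
    IsHomogeneousDerivation φ (a + k) (c • X) := by
  refine ⟨fun j s hs => ?_, fun j s hs t => ?_⟩
  · rw [add_assoc]
    exact SetLike.mul_mem_graded hc (hX.1 j s hs)
  · have h := IsSuperCommutative.comm (𝒜 := ℬ) a j c (φ s) hc (Graded.map_mem φ hs)
    simp only [LinearMap.smul_apply, smul_eq_mul, hX.2 j s hs t, mul_add, mul_smul_comm,
      ← mul_assoc, h, koszulSign_add, smul_mul_assoc, mul_smul]

/-- The `S`-module `Der_φ(R, S)` of all `φ`-derivations: the linear maps whose even and odd
components are homogeneous `φ`-derivations. -/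
def Der (φ : 𝒜 →ₐᵍ[ℝ] ℬ) [IsSuperCommutative ℬ] : Submodule S (R →ₗ[ℝ] S) where
  carrier := {X | ∃ X₀ X₁ : R →ₗ[ℝ] S, IsHomogeneousDerivation φ 0 X₀ ∧
    IsHomogeneousDerivation φ 1 X₁ ∧ X = X₀ + X₁}
  zero_mem' := ⟨0, 0, .zero φ 0, .zero φ 1, by simp⟩
  add_mem' := by
    rintro _ _ ⟨X₀, X₁, h₀, h₁, rfl⟩ ⟨Y₀, Y₁, k₀, k₁, rfl⟩
    exact ⟨X₀ + Y₀, X₁ + Y₁, h₀.add k₀, h₁.add k₁, by abel⟩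
  smul_mem' := by
    rintro c _ ⟨X₀, X₁, h₀, h₁, rfl⟩
    induction c using DirectSum.Decomposition.inductionOn ℬ with
    | zero => exact ⟨0, 0, .zero φ 0, .zero φ 1, by simp⟩
    | @homogeneous i m =>
      have g₀ := h₀.smul m.2
      have g₁ := h₁.smul m.2
      obtain rfl | rfl := (by decide : ∀ i : ZMod 2, i = 0 ∨ i = 1) i
      · exact ⟨_, _, by simpa using g₀, by simpa using g₁, smul_add _ _ _⟩
      · refine ⟨(m : S) • X₁, (m : S) • X₀, g₁, by simpa using g₀, ?_⟩
        rw [smul_add, add_comm]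
    | add m n hm hn =>
      obtain ⟨A₀, A₁, a₀, a₁, ha⟩ := hm
      obtain ⟨B₀, B₁, b₀, b₁, hb⟩ := hn
      exact ⟨A₀ + B₀, A₁ + B₁, a₀.add b₀, a₁.add b₁, by rw [add_smul, ha, hb]; abel⟩

end Derivations

/-! ### Sheaves of commutative superalgebras -/

/-- A sheaf of commutative superalgebras on a topological space. -/
structure SuperSheaf (X : Type u) [TopologicalSpace X] where
  obj : Opens X → Type v
  [ring : ∀ U, Ring (obj U)]
  [algebra : ∀ U, Algebra ℝ (obj U)]
  gr : ∀ U, ZMod 2 → Submodule ℝ (obj U)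
  [graded : ∀ U, GradedAlgebra (gr U)]
  [superComm : ∀ U, IsSuperCommutative (gr U)]
  res : ∀ {U V : Opens X}, V ≤ U → (gr U →ₐᵍ[ℝ] gr V)
  res_self : ∀ {U : Opens X} (s : obj U), res (le_refl U) s = s
  res_res : ∀ {U V W : Opens X} (h : V ≤ U) (k : W ≤ V) (s : obj U),
    res k (res h s) = res (k.trans h) s
  glue : ∀ {ι : Type u} (U : ι → Opens X) (s : ∀ i, obj (U i)),
    (∀ i j, res (inf_le_left : U i ⊓ U j ≤ U i) (s i) =
      res (inf_le_right : U i ⊓ U j ≤ U j) (s j)) →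
    ∃! t : obj (iSup U), ∀ i, res (le_iSup U i) t = s i

attribute [instance] SuperSheaf.ring SuperSheaf.algebra SuperSheaf.graded SuperSheaf.superComm

/-- Open neighbourhoods of `x`, ordered by reverse inclusion. -/
abbrev Nhd {X : Type u} [TopologicalSpace X] (x : X) : Type u := {U : Opens X // x ∈ U}ᵒᵈ

instance {X : Type u} [TopologicalSpace X] (x : X) : Nonempty (Nhd x) :=
  ⟨OrderDual.toDual ⟨⊤, trivial⟩⟩

instance {X : Type u} [TopologicalSpace X] (x : X) : IsDirectedOrder (Nhd x) where
  directed a b := ⟨OrderDual.toDual ⟨a.ofDual.1 ⊓ b.ofDual.1, a.ofDual.2, b.ofDual.2⟩,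
    (inf_le_left : a.ofDual.1 ⊓ b.ofDual.1 ≤ a.ofDual.1),
    (inf_le_right : a.ofDual.1 ⊓ b.ofDual.1 ≤ b.ofDual.1)⟩

namespace SuperSheaf

variable {X : Type u} [TopologicalSpace X] (M : SuperSheaf.{u, v} X)

/-- Restriction of sections to smaller neighbourhoods of `x`. -/
def nhdRes (x : X) (i j : Nhd x) (h : i ≤ j) :
    M.gr i.ofDual.1 →ₐᵍ[ℝ] M.gr j.ofDual.1 := M.res h

instance (x : X) : DirectedSystem (fun i : Nhd x => M.obj i.ofDual.1) (M.nhdRes x · · ·) where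
  map_self _ s := M.res_self s
  map_map _ _ _ h k s := M.res_res h k s

/-- The stalk of the sheaf at `x`. -/
def Stalk (x : X) : Type (max u v) :=
  DirectLimit (fun i : Nhd x => M.obj i.ofDual.1) (M.nhdRes x)

instance (x : X) : Ring (M.Stalk x) :=
  inferInstanceAs (Ring (DirectLimit (fun i : Nhd x => M.obj i.ofDual.1) (M.nhdRes x)))

instance (x : X) : Algebra ℝ (M.Stalk x) :=
  inferInstanceAs (Algebra ℝ (DirectLimit (fun i : Nhd x => M.obj i.ofDual.1) (M.nhdRes x)))

/-- The germ at `x` of a section over a neighbourhood of `x`. -/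
def germ {x : X} (U : Opens X) (hx : x ∈ U) (s : M.obj U) : M.Stalk x :=
  (⟦⟨OrderDual.toDual ⟨U, hx⟩, s⟩⟧ : DirectLimit _ (M.nhdRes x))

/-- Sections over `U` of the sheaf of derivations of the structure sheaf: families of
superderivations `D_V : 𝒪(V) → 𝒪(V)`, `V ⊆ U` open, commuting with restrictions. -/
def VectorField (U : Opens X) :
    Submodule ℝ (∀ V : {V : Opens X // V ≤ U}, M.obj V.1 →ₗ[ℝ] M.obj V.1) where
  carrier := {D | (∀ V, D V ∈ Der (M.res (le_refl V.1))) ∧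
    ∀ (V W : {V : Opens X // V ≤ U}) (h : W.1 ≤ V.1) (s : M.obj V.1),
      M.res h (D V s) = D W (M.res h s)}
  zero_mem' := ⟨fun _ => Submodule.zero_mem _, fun _ _ _ _ => by simp⟩
  add_mem' h k := ⟨fun V => Submodule.add_mem _ (h.1 V) (k.1 V), fun V W l s => by
    simp [h.2 V W l s, k.2 V W l s]⟩
  smul_mem' c D h := ⟨fun V => Submodule.smul_of_tower_mem _ c (h.1 V), fun V W l s => by
    simp [← h.2 V W l s]⟩

variable {M}

/-- The product `f D` of a vector field with a function: `(f D)(s) = f · D(s)`. -/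
def VectorField.smul {U : Opens X} (f : M.obj U) (D : M.VectorField U) : M.VectorField U :=
  ⟨fun V => M.res V.2 f • D.1 V, fun V => Submodule.smul_mem _ _ (D.2.1 V), fun V W l s => by
    simp [← D.2.2 V W l s, M.res_res]⟩

variable (M)

/-- Restriction of vector fields to smaller neighbourhoods of `x`. -/
def vfRes (x : X) (i j : Nhd x) (h : i ≤ j) :
    M.VectorField i.ofDual.1 →ₗ[ℝ] M.VectorField j.ofDual.1 where
  toFun D := ⟨fun V => D.1 ⟨V.1, V.2.trans h⟩, fun V => D.2.1 ⟨V.1, V.2.trans h⟩,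
    fun V W => D.2.2 ⟨V.1, V.2.trans h⟩ ⟨W.1, W.2.trans h⟩⟩
  map_add' _ _ := rfl
  map_smul' _ _ := rfl

instance (x : X) :
    DirectedSystem (fun i : Nhd x => M.VectorField i.ofDual.1) (M.vfRes x · · ·) where
  map_self _ _ := rfl
  map_map _ _ _ _ _ _ := rfl

/-- Germs at `x` of vector fields. -/
def VectorGerm (x : X) : Type (max u v) :=
  DirectLimit (fun i : Nhd x => M.VectorField i.ofDual.1) (M.vfRes x)

instance (x : X) : AddCommGroup (M.VectorGerm x) :=
  inferInstanceAs
    (AddCommGroup (DirectLimit (fun i : Nhd x => M.VectorField i.ofDual.1) (M.vfRes x)))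

instance (x : X) : Module ℝ (M.VectorGerm x) :=
  inferInstanceAs
    (Module ℝ (DirectLimit (fun i : Nhd x => M.VectorField i.ofDual.1) (M.vfRes x)))

/-- The germ at `x` of a vector field on a neighbourhood of `x`. -/
def vectorGerm {x : X} (U : Opens X) (hx : x ∈ U) (D : M.VectorField U) : M.VectorGerm x :=
  (⟦⟨OrderDual.toDual ⟨U, hx⟩, D⟩⟧ : DirectLimit _ (M.vfRes x))

/-- `[f] • [D] = [f D]`. -/
instance (x : X) : SMul (M.Stalk x) (M.VectorGerm x) where
  smul := DirectLimit.map₂ (M.nhdRes x) (M.vfRes x) (M.vfRes x)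
    (fun _ f D => VectorField.smul f D) (fun i j h f D => by
      apply Subtype.ext
      funext V
      exact congrArg (· • D.1 ⟨V.1, V.2.trans h⟩) (M.res_res h V.2 f).symm)

section Germs

variable {x : X} {U : Opens X} (hx : x ∈ U)

theorem exists_rep (f g : M.Stalk x) (D E : M.VectorGerm x) :
    ∃ (U : Opens X) (hx : x ∈ U) (f' g' : M.obj U) (D' E' : M.VectorField U),
      f = M.germ U hx f' ∧ g = M.germ U hx g' ∧ D = M.vectorGerm U hx D' ∧
        E = M.vectorGerm U hx E' := by
  obtain ⟨i, f', g', rfl, rfl⟩ := DirectLimit.exists_eq_mk₂ (M.nhdRes x) f g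
  obtain ⟨j, D', E', rfl, rfl⟩ := DirectLimit.exists_eq_mk₂ (M.vfRes x) D E
  obtain ⟨k, hi, hj⟩ := exists_ge_ge i j
  exact ⟨k.ofDual.1, k.ofDual.2, _, _, _, _, DirectLimit.eq_of_le _ k hi,
    DirectLimit.eq_of_le _ k hi, DirectLimit.eq_of_le _ k hj, DirectLimit.eq_of_le _ k hj⟩

theorem germ_one : M.germ U hx 1 = 1 :=
  (DirectLimit.one_def (f := M.nhdRes x) (OrderDual.toDual ⟨U, hx⟩)).symm

theorem germ_zero : M.germ U hx 0 = 0 :=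
  (DirectLimit.zero_def (f := M.nhdRes x) (OrderDual.toDual ⟨U, hx⟩)).symm

theorem germ_add (f g : M.obj U) : M.germ U hx (f + g) = M.germ U hx f + M.germ U hx g :=
  (DirectLimit.add_def (G := fun i : Nhd x => M.obj i.ofDual.1) (f := M.nhdRes x)
    (OrderDual.toDual ⟨U, hx⟩) f g).symm

theorem germ_mul (f g : M.obj U) : M.germ U hx (f * g) = M.germ U hx f * M.germ U hx g :=
  (DirectLimit.mul_def (G := fun i : Nhd x => M.obj i.ofDual.1) (f := M.nhdRes x)
    (OrderDual.toDual ⟨U, hx⟩) f g).symm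

theorem vectorGerm_zero : M.vectorGerm U hx 0 = 0 :=
  (DirectLimit.zero_def (f := M.vfRes x) (OrderDual.toDual ⟨U, hx⟩)).symm

theorem vectorGerm_add (D E : M.VectorField U) :
    M.vectorGerm U hx (D + E) = M.vectorGerm U hx D + M.vectorGerm U hx E :=
  (DirectLimit.add_def (G := fun i : Nhd x => M.VectorField i.ofDual.1) (f := M.vfRes x)
    (OrderDual.toDual ⟨U, hx⟩) D E).symm

theorem germ_smul_vectorGerm (f : M.obj U) (D : M.VectorField U) :
    M.germ U hx f • M.vectorGerm U hx D = M.vectorGerm U hx (VectorField.smul f D) :=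
  DirectLimit.map₂_def ..

end Germs

theorem VectorField.smul_apply {U : Opens X} (f : M.obj U) (D : M.VectorField U)
    (V : {V : Opens X // V ≤ U}) : (VectorField.smul f D).1 V = M.res V.2 f • D.1 V := rfl

theorem VectorField.ext {U : Opens X} {D E : M.VectorField U} (h : ∀ V, D.1 V = E.1 V) : D = E :=
  Subtype.ext (funext h)

theorem VectorField.one_smul {U : Opens X} (D : M.VectorField U) :
    VectorField.smul 1 D = D :=
  VectorField.ext M fun V => by rw [smul_apply, map_one, _root_.one_smul]

theorem VectorField.mul_smul {U : Opens X} (f g : M.obj U) (D : M.VectorField U) :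
    VectorField.smul (f * g) D = VectorField.smul f (VectorField.smul g D) :=
  VectorField.ext M fun V => by
    rw [smul_apply, map_mul, SemigroupAction.mul_smul, smul_apply, smul_apply]

theorem VectorField.smul_zero {U : Opens X} (f : M.obj U) :
    VectorField.smul f (0 : M.VectorField U) = 0 :=
  VectorField.ext M fun V => (smul_apply M f 0 V).trans (_root_.smul_zero (M.res V.2 f))

theorem VectorField.smul_add {U : Opens X} (f : M.obj U) (D E : M.VectorField U) :
    VectorField.smul f (D + E) = VectorField.smul f D + VectorField.smul f E :=
  VectorField.ext M fun V =>
    (smul_apply M f (D + E) V).trans (_root_.smul_add (M.res V.2 f) (D.1 V) (E.1 V))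

theorem VectorField.add_smul {U : Opens X} (f g : M.obj U) (D : M.VectorField U) :
    VectorField.smul (f + g) D = VectorField.smul f D + VectorField.smul g D :=
  VectorField.ext M fun V => by
    rw [smul_apply, map_add, _root_.add_smul]
    rfl

theorem VectorField.zero_smul {U : Opens X} (D : M.VectorField U) :
    VectorField.smul (0 : M.obj U) D = 0 :=
  VectorField.ext M fun V => by
    rw [smul_apply, map_zero, _root_.zero_smul]
    rfl

/-- Germs of vector fields form a left module over the stalk. -/
instance (x : X) : Module (M.Stalk x) (M.VectorGerm x) where
  one_smul D := by
    obtain ⟨U, hx, -, -, D, -, -, -, rfl, -⟩ := M.exists_rep 0 0 D 0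
    rw [← germ_one M hx, germ_smul_vectorGerm, VectorField.one_smul]
  mul_smul f g D := by
    obtain ⟨U, hx, f, g, D, -, rfl, rfl, rfl, -⟩ := M.exists_rep f g D 0
    rw [← germ_mul, germ_smul_vectorGerm, germ_smul_vectorGerm, germ_smul_vectorGerm,
      VectorField.mul_smul]
  smul_zero f := by
    obtain ⟨U, hx, f, -, -, -, rfl, -, -, -⟩ := M.exists_rep f 0 (0 : M.VectorGerm x) 0
    rw [← vectorGerm_zero M hx, germ_smul_vectorGerm, VectorField.smul_zero]
  smul_add f D E := by
    obtain ⟨U, hx, f, -, D, E, rfl, -, rfl, rfl⟩ := M.exists_rep f 0 D E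
    rw [← vectorGerm_add, germ_smul_vectorGerm, germ_smul_vectorGerm, germ_smul_vectorGerm,
      VectorField.smul_add, vectorGerm_add]
  add_smul f g D := by
    obtain ⟨U, hx, f, g, D, -, rfl, rfl, rfl, -⟩ := M.exists_rep f g D 0
    rw [← germ_add, germ_smul_vectorGerm, germ_smul_vectorGerm, germ_smul_vectorGerm,
      VectorField.add_smul, vectorGerm_add]
  zero_smul D := by
    obtain ⟨U, hx, -, -, D, -, -, -, rfl, -⟩ := M.exists_rep 0 0 D 0
    rw [← germ_zero M hx, germ_smul_vectorGerm, VectorField.zero_smul, vectorGerm_zero]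

end SuperSheaf

/-! ### The local model -/

/-- The algebra of smooth real functions on an open subset of `ℝ^p`. -/
def smoothFun {p : ℕ} (U : Opens (EuclideanSpace ℝ (Fin p))) : Subalgebra ℝ (U → ℝ) where
  carrier := {f | ContDiffOn ℝ ∞ (Function.extend Subtype.val f 0) U}
  mul_mem' {f g} hf hg := (ContDiffOn.mul hf hg).congr fun x hx => by
    lift x to U using hx
    simp
  add_mem' {f g} hf hg := (ContDiffOn.add hf hg).congr fun x hx => by
    lift x to U using hx
    simp
  algebraMap_mem' c := (contDiffOn_const (c := c)).congr fun x hx => by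
    lift x to U using hx
    simp

/-- Restriction of smooth functions. -/
def smoothRes {p : ℕ} {U V : Opens (EuclideanSpace ℝ (Fin p))} (h : V ≤ U) :
    smoothFun U →ₐ[ℝ] smoothFun V where
  toFun f := ⟨fun x => f.1 ⟨x.1, h x.2⟩, (ContDiffOn.mono f.2 h).congr fun x hx =>
    (Subtype.val_injective.extend_apply _ _ (⟨x, hx⟩ : V)).trans
      (Subtype.val_injective.extend_apply f.1 0 (⟨x, h hx⟩ : U)).symm⟩
  map_one' := rfl
  map_mul' _ _ := rfl
  map_zero' := rfl
  map_add' _ _ := rfl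
  commutes' _ := rfl

/-- The `i`-th partial derivative of a smooth function. -/
def partialDeriv {p : ℕ} {U : Opens (EuclideanSpace ℝ (Fin p))} (i : Fin p) :
    smoothFun U →ₗ[ℝ] smoothFun U where
  toFun f := ⟨fun x => fderiv ℝ (Function.extend Subtype.val f.1 0) x.1
      (EuclideanSpace.single i 1),
    ((ContDiffOn.fderiv_of_isOpen f.2 U.isOpen (by simp)).clm_apply
      (contDiffOn_const (c := EuclideanSpace.single i (1 : ℝ)))).congr fun x hx => by
        lift x to U using hx
        rw [Subtype.val_injective.extend_apply]⟩
  map_add' f g := by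
    apply Subtype.ext
    funext x
    have hf := (ContDiffOn.contDiffAt f.2 (U.isOpen.mem_nhds x.2)).differentiableAt (by simp)
    have hg := (ContDiffOn.contDiffAt g.2 (U.isOpen.mem_nhds x.2)).differentiableAt (by simp)
    have h : Function.extend Subtype.val (f + g).1 0 =
        Function.extend Subtype.val f.1 0 + Function.extend Subtype.val g.1 0 := by
      rw [← Function.extend_add]; simp
    simp only [h, fderiv_add hf hg]
    simp
  map_smul' c f := by
    apply Subtype.ext
    funext x
    have hf := (ContDiffOn.contDiffAt f.2 (U.isOpen.mem_nhds x.2)).differentiableAt (by simp)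
    have h : Function.extend Subtype.val (c • f).1 0 =
        c • Function.extend Subtype.val f.1 0 := by
      rw [← Function.extend_smul]; simp
    simp only [h, fderiv_const_smul hf c]
    simp

/-- The Grassmann algebra on `θ_1, …, θ_q`. -/
abbrev Grassmann (q : ℕ) : Type := ExteriorAlgebra ℝ (Fin q → ℝ)

/-- The parity grading of the Grassmann algebra. -/
abbrev grassmannGr (q : ℕ) : ZMod 2 → Submodule ℝ (Grassmann q) :=
  CliffordAlgebra.evenOdd (0 : QuadraticForm ℝ (Fin q → ℝ))

/-- The sections `C^∞(U) ⊗ Λ(θ_1, …, θ_q)` over `U` of the structure sheaf of `ℝ^{p|q}`, i.e. the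
superalgebra `𝒪(U)` of the superdomain `U` of dimension `p|q`. -/
def DomainFun {p : ℕ} (q : ℕ) (U : Opens (EuclideanSpace ℝ (Fin p))) : Type :=
  smoothFun U ⊗[ℝ] Grassmann q

instance {p : ℕ} (q : ℕ) (U : Opens (EuclideanSpace ℝ (Fin p))) : Ring (DomainFun q U) :=
  inferInstanceAs (Ring (smoothFun U ⊗[ℝ] Grassmann q))

instance {p : ℕ} (q : ℕ) (U : Opens (EuclideanSpace ℝ (Fin p))) : Algebra ℝ (DomainFun q U) :=
  inferInstanceAs (Algebra ℝ (smoothFun U ⊗[ℝ] Grassmann q))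

/-- The grading of `C^∞(U) ⊗ Λ`, with components `C^∞(U) ⊗ Λ_0` and `C^∞(U) ⊗ Λ_1`. -/
def domainGr {p : ℕ} (q : ℕ) (U : Opens (EuclideanSpace ℝ (Fin p))) (k : ZMod 2) :
    Submodule ℝ (DomainFun q U) :=
  ((grassmannGr q k).baseChange (smoothFun U)).restrictScalars ℝ

instance {p : ℕ} (q : ℕ) (U : Opens (EuclideanSpace ℝ (Fin p))) :
    GradedAlgebra (domainGr q U) :=
  let I := GradedAlgebra.baseChange (S := smoothFun U) (grassmannGr q)
  { one_mem := I.one_mem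
    mul_mem := I.mul_mem
    decompose' := I.decompose'
    left_inv := I.left_inv
    right_inv := I.right_inv }

/-- Restriction of sections of the structure sheaf of `ℝ^{p|q}`. -/
def domainRes {p : ℕ} (q : ℕ) {U V : Opens (EuclideanSpace ℝ (Fin p))} (h : V ≤ U) :
    DomainFun q U →ₐ[ℝ] DomainFun q V :=
  Algebra.TensorProduct.map (smoothRes h) (AlgHom.id ℝ (Grassmann q))

/-- The reduced value at `y ∈ U` of a section: `f ⊗ w ↦ f(y) w_0`, where `w_0` is the scalar part
of `w`. -/
def domainEval {p q : ℕ} {U : Opens (EuclideanSpace ℝ (Fin p))} (y : U) :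
    DomainFun q U →ₐ[ℝ] ℝ :=
  Algebra.TensorProduct.productMap ((Pi.evalAlgHom ℝ (fun _ : U => ℝ) y).comp (smoothFun U).val)
    ExteriorAlgebra.algebraMapInv

/-- The vector field `∂/∂x_i` on a superdomain. -/
def dX {p q : ℕ} {U : Opens (EuclideanSpace ℝ (Fin p))} (i : Fin p) :
    DomainFun q U →ₗ[ℝ] DomainFun q U :=
  LinearMap.rTensor (Grassmann q) (partialDeriv i)

/-- The vector field `∂/∂θ_j` on a superdomain: the contraction of the Grassmann algebra with
the `j`-th coordinate functional, i.e. the odd left derivation with `θ_k ↦ δ_{jk}`. -/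
def dTheta {p q : ℕ} {U : Opens (EuclideanSpace ℝ (Fin p))} (j : Fin q) :
    DomainFun q U →ₗ[ℝ] DomainFun q U :=
  LinearMap.lTensor (smoothFun U) (CliffordAlgebra.contractLeft
    (Q := (0 : QuadraticForm ℝ (Fin q → ℝ))) (LinearMap.proj j : Module.Dual ℝ (Fin q → ℝ)))

/-! ### Supermanifolds -/

/-- The open subset of the source of `e` corresponding to `W` in the target. -/
def chartPreimage {X Y : Type*} [TopologicalSpace X] [TopologicalSpace Y]
    (e : OpenPartialHomeomorph X Y) (W : Opens Y) : Opens X :=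
  ⟨e.source ∩ e ⁻¹' W, e.isOpen_inter_preimage W.isOpen⟩

theorem chartPreimage_mono {X Y : Type*} [TopologicalSpace X] [TopologicalSpace Y]
    (e : OpenPartialHomeomorph X Y) {V W : Opens Y} (h : V ≤ W) :
    chartPreimage e V ≤ chartPreimage e W :=
  fun _ hx => ⟨hx.1, h hx.2⟩

/-- A chart of dimension `p|q`: a homeomorphism from an open subset of `X` onto an open subset of
`ℝ^p`, with an isomorphism of the corresponding restricted sheaves of superalgebras. -/
structure SuperChart {X : Type u} [TopologicalSpace X] (M : SuperSheaf.{u, v} X) (p q : ℕ) where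
  toHomeo : OpenPartialHomeomorph X (EuclideanSpace ℝ (Fin p))
  iso : ∀ W : Opens (EuclideanSpace ℝ (Fin p)), (W : Set _) ⊆ toHomeo.target →
    (M.obj (chartPreimage toHomeo W) ≃ₐ[ℝ] DomainFun q W)
  iso_mem : ∀ W hW (k : ZMod 2) (s : M.obj (chartPreimage toHomeo W)),
    iso W hW s ∈ domainGr q W k ↔ s ∈ M.gr (chartPreimage toHomeo W) k
  iso_res : ∀ W hW V hV (h : V ≤ W) (s : M.obj (chartPreimage toHomeo W)),
    iso V hV (M.res (chartPreimage_mono toHomeo h) s) = domainRes q h (iso W hW s)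

/-- A smooth supermanifold structure of dimension `p|q` on the space `X`. (Locality of the stalks
is automatic, since it holds for the local model. The classical requirements that `X` be Hausdorff
and second countable are imposed separately.) -/
structure Supermanifold (X : Type u) [TopologicalSpace X] (p q : ℕ) extends
    SuperSheaf.{u, v} X where
  exists_chart : ∀ x : X, ∃ c : SuperChart toSuperSheaf p q, x ∈ c.toHomeo.source

/-- The value at `x` of a global section, computed in a chart around `x`. -/
def SuperChart.eval {X : Type u} [TopologicalSpace X] {M : SuperSheaf.{u, v} X} {p q : ℕ}
    (c : SuperChart M p q) {x : X} (hx : x ∈ c.toHomeo.source) : M.obj ⊤ →ₐ[ℝ] ℝ :=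
  (domainEval (U := ⟨c.toHomeo.target, c.toHomeo.open_target⟩)
    ⟨c.toHomeo x, c.toHomeo.map_source hx⟩).comp
    ((c.iso ⟨c.toHomeo.target, c.toHomeo.open_target⟩ subset_rfl).toAlgHom.comp
      (M.res (le_top : chartPreimage c.toHomeo _ ≤ ⊤)).toAlgHom)

namespace Supermanifold

variable {X : Type u} [TopologicalSpace X] {p q : ℕ} (M : Supermanifold.{u, v} X p q)

/-- The superalgebra `𝒪(M)` of global sections. -/
abbrev Fun : Type v := M.obj ⊤

/-- Its grading. -/
abbrev funGr : ZMod 2 → Submodule ℝ M.Fun := M.gr ⊤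

/-- The evaluation `ev_x : s ↦ s̃(x)`, computed in some chart around `x`
(the value does not depend on the chart). -/
def ev (x : X) : M.Fun →ₐ[ℝ] ℝ := (M.exists_chart x).choose.eval (M.exists_chart x).choose_spec

/-- The tangent superspace at `x`: all `ev_x`-derivations `𝒪(M) → ℝ`. -/
def TangentSpace (x : X) : Submodule ℝ (M.Fun →ₗ[ℝ] ℝ) where
  carrier := {v | ∀ f g, v (f * g) = v f * M.ev x g + M.ev x f * v g}
  zero_mem' _ _ := by simp
  add_mem' hv hw f g := by
    simp only [LinearMap.add_apply, hv f g, hw f g]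
    ring
  smul_mem' c v hv f g := by
    simp only [LinearMap.smul_apply, hv f g, smul_eq_mul]
    ring

/-- A tangent vector is homogeneous of parity `k` if it vanishes on sections of the opposite
parity. -/
def IsHomogeneousTangent {x : X} (k : ZMod 2) (v : M.TangentSpace x) : Prop :=
  ∀ s ∈ M.funGr (k + 1), v.1 s = 0

variable {A : Type*} [Ring A] [Algebra ℝ A] (𝒜 : ZMod 2 → Submodule ℝ A) [GradedAlgebra 𝒜]

/-- The set `M_A` of `A`-points of `M`: superalgebra morphisms `𝒪(M) → A`. -/
abbrev Point : Type _ := M.funGr →ₐᵍ[ℝ] 𝒜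

variable {M 𝒜}

/-- `x` is the base point of the `A`-point `x_A`: the composite of `x_A` with the projection
`A = ℝ ⊕ nil → ℝ` is `ev_x`. -/
def IsBasePoint [SuperWeilAlgebra 𝒜] (xA : M.Point 𝒜) (x : X) : Prop :=
  ∀ s : M.Fun, xA s - algebraMap ℝ A (M.ev x s) ∈ SuperWeilAlgebra.nil 𝒜

end Supermanifold

/-! ### The tensor product along an algebra morphism -/

/-- The tensor product `A ⊗_ρ L` for `ρ : B → A` and a left `B`-module `L`: the quotient of
`A ⊗ L` by `a ⊗ b l ∼ a ρ(b) ⊗ l`, as a left `A`-module. -/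
abbrev RhoTensor {A B : Type*} [Ring A] [Algebra ℝ A] [Ring B] [Algebra ℝ B] (ρ : B →ₐ[ℝ] A)
    (L : Type*) [AddCommGroup L] [Module ℝ L] [Module B L] : Type _ :=
  (A ⊗[ℝ] L) ⧸ Submodule.span A
    {z : A ⊗[ℝ] L | ∃ (a : A) (b : B) (l : L), z = a ⊗ₜ[ℝ] (b • l) - (a * ρ b) ⊗ₜ[ℝ] l}

/-- The class of `a ⊗ l` in `A ⊗_ρ L`. -/
def RhoTensor.mk {A B : Type*} [Ring A] [Algebra ℝ A] [Ring B] [Algebra ℝ B] (ρ : B →ₐ[ℝ] A)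
    {L : Type*} [AddCommGroup L] [Module ℝ L] [Module B L] (a : A) (l : L) : RhoTensor ρ L :=
  Submodule.Quotient.mk (a ⊗ₜ[ℝ] l)

/-- The map `X_f(s) = ∑ f_i x_A(∂s/∂x_i) + ∑ F_j x_A(∂s/∂θ_j)` on a superdomain. -/
def coordDerivation {p q : ℕ} {U : Opens (EuclideanSpace ℝ (Fin p))} {A : Type*} [Ring A]
    [Algebra ℝ A] {𝒜 : ZMod 2 → Submodule ℝ A} [GradedAlgebra 𝒜] (xA : domainGr q U →ₐᵍ[ℝ] 𝒜)
    (f : Fin p → A) (F : Fin q → A) : DomainFun q U →ₗ[ℝ] A :=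
  ∑ i, f i • (xA.toAlgHom.toLinearMap ∘ₗ dX i) + ∑ j, F j • (xA.toAlgHom.toLinearMap ∘ₗ dTheta j)

end SuperGeom

end

open SuperGeom

noncomputable section

namespace SuperGeom

universe u v

/-! ### Homogeneous derivations -/

/-! Everything rests on a first order Taylor expansion combined with nilpotency. Suppose homogeneous
sections `t i` have images under `φ = x_A` in the nilpotent ideal, and every section can be written
`s = c + ∑ t i * g i + z`, where `z` is annihilated by an even element with invertible image. A
homogeneous derivation `X` kills `c` and `z`, so if it also kills all `t i`, then `X s` is a signed
sum of the `φ (t i) * X (g i)`. Hence range `X` ⊆ `J` · range `X`, and iterating gives `X = 0`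
(`IsCoordinateSystem.eq_zero_of_homogeneous`). Given derivations `E i` dual to the `t i`
(`IsDualFrame`), the module of derivations is therefore free over `A` on the `E i`, with
coefficients `X (t i)`. Reduced modulo the nilpotent ideal, the same expansion shows that the
tangent space is free over ℝ on the reductions of the `E i`. Matching the two bases gives Φ; this
isomorphism depends on the coordinates.

On a superdomain the expansion is Hadamard's lemma (`exists_hadamard`) together with the expansion
of the Grassmann algebra in its generators, and the frame is `x_A ∘ ∂/∂x_i`, `x_A ∘ ∂/∂θ_j`; this
settles part (2). On a supermanifold, bump functions carry chart coordinates over to global sections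
(`exists_coordinateSystem`).

The base point exists because every character of `𝒪(M)` is an evaluation (`exists_eq_ev`): otherwise
a section with proper reduction and finitely many further sections combine into a sum of squares
that is invertible, yet lies in the kernel of the character. Locality at that point also comes from
bump functions: a section vanishing near `x` is annihilated by an even section equal to 1 near `x`,
whose image is a unit. Since `𝒪(M)` maps onto the stalk, the factorization exists and is unique.

For the canonical map, germs of vector fields are generated over the stalk by the coordinate fields,
so the classes of `1 ⊗ [∂_i]` span the tensor product. They go to the basis `E i`, and a spanning
family sent to a basis makes the map bijective. That the coordinate fields generate requires vector
fields killing the coordinates to vanish. This is the nilpotency argument again, applied along the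
Grassmann points `grassmannEval`, which jointly detect sections. -/

theorem zmod_two_eq (i : ZMod 2) : i = 0 ∨ i = 1 := by revert i; decide

theorem zmod_two_add_self (i : ZMod 2) : i + i = 0 := by revert i; decide

@[simp] theorem koszulSign_zero_left (j : ZMod 2) : koszulSign 0 j = 1 := by simp [koszulSign]

@[simp] theorem koszulSign_zero_right (j : ZMod 2) : koszulSign j 0 = 1 := by simp [koszulSign]

@[simp] theorem koszulSign_one_one : koszulSign 1 1 = -1 := by simp [koszulSign]

/-- Odd elements of a commutative superalgebra have square zero. -/
theorem IsSuperCommutative.mul_self_of_odd {R : Type*} [Ring R] [Algebra ℝ R]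
    {𝒜 : ZMod 2 → Submodule ℝ R} [IsSuperCommutative 𝒜] {a : R} (ha : a ∈ 𝒜 1) :
    a * a = 0 := by
  have h := IsSuperCommutative.comm (𝒜 := 𝒜) 1 1 a a ha ha
  rw [koszulSign_one_one, neg_one_smul] at h
  have h2 : (2 : ℝ) • (a * a) = 0 := by
    rw [two_smul]
    nth_rewrite 1 [h]
    exact neg_add_cancel _
  exact (smul_eq_zero.mp h2).resolve_left two_ne_zero

section Derivations

variable {R S : Type*} [Ring R] [Algebra ℝ R] [Ring S] [Algebra ℝ S]
  {𝒜 : ZMod 2 → Submodule ℝ R} {ℬ : ZMod 2 → Submodule ℝ S} [GradedAlgebra 𝒜] [GradedAlgebra ℬ]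

/-- An even element of a commutative superalgebra is central. -/
theorem IsSuperCommutative.commute_of_even [IsSuperCommutative 𝒜] {a : R} (ha : a ∈ 𝒜 0) (b : R) :
    Commute a b := by
  induction b using DirectSum.Decomposition.inductionOn 𝒜 with
  | zero => exact Commute.zero_right a
  | @homogeneous i m =>
    have h := IsSuperCommutative.comm (𝒜 := 𝒜) 0 i a m ha m.2
    rwa [koszulSign_zero_left, one_smul] at h
  | add m n hm hn => exact hm.add_right hn

theorem decompose_zero_add_one (s : R) :
    s = (DirectSum.decompose 𝒜 s 0 : R) + (DirectSum.decompose 𝒜 s 1 : R) := by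
  classical
  have h := DirectSum.sum_support_decompose 𝒜 s
  have h2 : ∑ i : ZMod 2, (DirectSum.decompose 𝒜 s i : R) = s := by
    conv_rhs => rw [← h]
    symm
    refine Finset.sum_subset (Finset.subset_univ _) fun i _ hi => ?_
    simpa using hi
  conv_lhs => rw [← h2]
  exact Fin.sum_univ_two (fun i : ZMod 2 => (DirectSum.decompose 𝒜 s i : R))

theorem eq_zero_of_homogeneous_add {a b : R} {i j : ZMod 2} (hij : i ≠ j) (ha : a ∈ 𝒜 i)
    (hb : b ∈ 𝒜 j) (h : a + b = 0) : a = 0 ∧ b = 0 := by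
  have hba : b = -a := eq_neg_of_add_eq_zero_right h
  have h1 : (DirectSum.decompose 𝒜 a i : R) = 0 := by
    have : a = -b := by rw [hba, neg_neg]
    rw [this]
    exact DirectSum.decompose_of_mem_ne 𝒜 (neg_mem hb) hij.symm
  rw [DirectSum.decompose_of_mem_same 𝒜 ha] at h1
  exact ⟨h1, by rw [hba, h1, neg_zero]⟩

/-- A graded morphism commutes with the homogeneous components. -/
theorem map_decompose_apply (φ : 𝒜 →ₐᵍ[ℝ] ℬ) (s : R) (k : ZMod 2) :
    φ (DirectSum.decompose 𝒜 s k : R) = (DirectSum.decompose ℬ (φ s) k : S) := by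
  induction s using DirectSum.Decomposition.inductionOn 𝒜 with
  | zero => simp
  | @homogeneous i m =>
    by_cases h : i = k
    · subst h
      rw [DirectSum.decompose_of_mem_same 𝒜 m.2,
        DirectSum.decompose_of_mem_same ℬ (Graded.map_mem φ m.2)]
    · rw [DirectSum.decompose_of_mem_ne 𝒜 m.2 h,
        DirectSum.decompose_of_mem_ne ℬ (Graded.map_mem φ m.2) h, map_zero]
  | add m n hm hn => simp [DirectSum.decompose_add, hm, hn]

namespace IsHomogeneousDerivation

variable {φ : 𝒜 →ₐᵍ[ℝ] ℬ} {k : ZMod 2} {X : R →ₗ[ℝ] S}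

theorem map_one (hX : IsHomogeneousDerivation φ k X) : X 1 = 0 := by
  have h := hX.2 0 1 (SetLike.one_mem_graded 𝒜) 1
  simpa using h

theorem map_algebraMap (hX : IsHomogeneousDerivation φ k X) (c : ℝ) :
    X (algebraMap ℝ R c) = 0 := by
  rw [Algebra.algebraMap_eq_smul_one, map_smul, hX.map_one, smul_zero]

theorem sum {ι : Type*} {s : Finset ι} {Y : ι → R →ₗ[ℝ] S}
    (hY : ∀ i ∈ s, IsHomogeneousDerivation φ k (Y i)) :
    IsHomogeneousDerivation φ k (∑ i ∈ s, Y i) := by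
  classical
  induction s using Finset.induction_on with
  | empty => simpa using IsHomogeneousDerivation.zero φ k
  | insert a s ha ih =>
    rw [Finset.sum_insert ha]
    exact (hY a (Finset.mem_insert_self a s)).add
      (ih fun i hi => hY i (Finset.mem_insert_of_mem hi))

theorem mem_der [IsSuperCommutative ℬ] (hX : IsHomogeneousDerivation φ k X) : X ∈ Der φ := by
  obtain rfl | rfl := zmod_two_eq k
  · exact ⟨X, 0, hX, .zero φ 1, (add_zero X).symm⟩
  · exact ⟨0, X, .zero φ 0, hX, (zero_add X).symm⟩

/-- A derivation kills every element annihilated by a "bump element". -/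
theorem map_eq_zero_of_mul_eq_zero (hX : IsHomogeneousDerivation φ k X) {ρ z : R}
    (hρ : ρ ∈ 𝒜 0) (hz : ρ * z = 0) (hu : IsUnit (φ ρ)) : X z = 0 := by
  have h1 : φ z = 0 := by
    have := congrArg φ hz
    rw [map_mul, map_zero] at this
    exact hu.mul_right_eq_zero.mp this
  -- Since `ρ` is even there is no sign, and `φ z = 0` removes the other term: the Leibniz rule for
  -- `ρ * z = 0` leaves `φ ρ * X z = 0`.
  have h2 := hX.2 0 ρ hρ z
  rw [hz, map_zero, h1, mul_zero, zero_add, koszulSign_zero_right, one_smul] at h2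
  exact hu.mul_right_eq_zero.mp h2.symm

/-- Composition of a derivation with a morphism on the left. -/
theorem comp_left {T : Type*} [Ring T] [Algebra ℝ T] {𝒞 : ZMod 2 → Submodule ℝ T}
    [GradedAlgebra 𝒞] (hX : IsHomogeneousDerivation φ k X) (ψ : ℬ →ₐᵍ[ℝ] 𝒞)
    {χ : 𝒜 →ₐᵍ[ℝ] 𝒞} (hχ : ∀ s, χ s = ψ (φ s)) {Y : R →ₗ[ℝ] T} (hY : ∀ s, Y s = ψ (X s)) :
    IsHomogeneousDerivation χ k Y :=
  ⟨fun j s hs => by rw [hY]; exact Graded.map_mem ψ (hX.1 j s hs), fun j s hs t => by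
    simp only [hY, hχ, hX.2 j s hs t, map_add, map_mul, map_smul]⟩

/-- Composition of a derivation with a morphism on the right. -/
theorem comp_right {T : Type*} [Ring T] [Algebra ℝ T] {𝒞 : ZMod 2 → Submodule ℝ T}
    [GradedAlgebra 𝒞] (hX : IsHomogeneousDerivation φ k X) (ψ : 𝒞 →ₐᵍ[ℝ] 𝒜)
    {χ : 𝒞 →ₐᵍ[ℝ] ℬ} (hχ : ∀ s, χ s = φ (ψ s)) {Y : T →ₗ[ℝ] S} (hY : ∀ s, Y s = X (ψ s)) :
    IsHomogeneousDerivation χ k Y :=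
  ⟨fun j s hs => by rw [hY]; exact hX.1 j _ (Graded.map_mem ψ hs), fun j s hs t => by
    simp only [hY, hχ, map_mul, hX.2 j _ (Graded.map_mem ψ hs)]⟩

end IsHomogeneousDerivation

/-! ### Coordinates along a morphism -/

/-- Homogeneous elements `t i` of parity `d i` that serve as coordinates for the morphism `φ`: their
images lie in `J`, and every element has a first order expansion in the `t i`, up to elements
annihilated by an even element with invertible image. -/
structure IsCoordinateSystem {ι : Type*} [Fintype ι] (φ : 𝒜 →ₐᵍ[ℝ] ℬ) (J : Submodule ℝ S)
    (d : ι → ZMod 2) (t : ι → R) : Prop where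
  mem : ∀ i, t i ∈ 𝒜 (d i)
  map_mem : ∀ i, φ (t i) ∈ J
  exists_expansion : ∀ s : R, ∃ (c : ℝ) (g : ι → R) (z : R),
    s = algebraMap ℝ R c + ∑ i, t i * g i + z ∧ ∃ ρ ∈ 𝒜 0, ρ * z = 0 ∧ IsUnit (φ ρ)

namespace IsCoordinateSystem

variable {ι : Type*} [Fintype ι] {φ : 𝒜 →ₐᵍ[ℝ] ℬ} {J : Submodule ℝ S} {d : ι → ZMod 2} {t : ι → R}

/-- A homogeneous derivation that kills the coordinates is zero. -/
theorem eq_zero_of_homogeneous (ht : IsCoordinateSystem φ J d t) (hJ : IsNilpotent J) {k : ZMod 2}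
    {X : R →ₗ[ℝ] S} (hX : IsHomogeneousDerivation φ k X) (h0 : ∀ i, X (t i) = 0) : X = 0 := by
  -- A Nakayama-type step: only the terms `t i * g i` of the expansion survive, and each contributes
  -- `± φ (t i) * X (g i)`. Iteration then reaches a vanishing power of `J`.
  have h1 : LinearMap.range X ≤ J * LinearMap.range X := by
    rintro _ ⟨s, rfl⟩
    obtain ⟨c, g, z, rfl, ρ, hρ, hz, hu⟩ := ht.exists_expansion s
    rw [map_add, map_add, hX.map_algebraMap, hX.map_eq_zero_of_mul_eq_zero hρ hz hu, zero_add,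
      add_zero, map_sum]
    refine Submodule.sum_mem _ fun i _ => ?_
    rw [hX.2 _ _ (ht.mem i), h0, zero_mul, zero_add]
    exact Submodule.smul_mem _ _ (Submodule.mul_mem_mul (ht.map_mem i) ⟨_, rfl⟩)
  have h2 : ∀ n : ℕ, LinearMap.range X ≤ J ^ n * LinearMap.range X := by
    intro n
    induction n with
    | zero => simp
    | succ n ih =>
      rw [pow_succ, mul_assoc]
      exact ih.trans (mul_le_mul_right h1 _)
  obtain ⟨n, hn⟩ := hJ
  have h3 := h2 n
  rw [hn, zero_mul, Submodule.zero_eq_bot, le_bot_iff, LinearMap.range_eq_bot] at h3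
  exact h3

/-- The even and odd parts of `X` take values of opposite parity on a homogeneous coordinate, so
their sum vanishes there only if both do. -/
theorem eq_zero_of_mem_der [IsSuperCommutative ℬ] (ht : IsCoordinateSystem φ J d t)
    (hJ : IsNilpotent J) {X : R →ₗ[ℝ] S} (hX : X ∈ Der φ) (h0 : ∀ i, X (t i) = 0) : X = 0 := by
  obtain ⟨X₀, X₁, h₀, h₁, rfl⟩ := hX
  have h : ∀ i, X₀ (t i) = 0 ∧ X₁ (t i) = 0 := fun i =>
    eq_zero_of_homogeneous_add (𝒜 := ℬ) (by simp) (h₀.1 _ _ (ht.mem i)) (h₁.1 _ _ (ht.mem i))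
      (h0 i)
  rw [ht.eq_zero_of_homogeneous hJ h₀ fun i => (h i).1,
    ht.eq_zero_of_homogeneous hJ h₁ fun i => (h i).2, add_zero]

end IsCoordinateSystem

/-- Derivations dual to the coordinates `t`. -/
structure IsDualFrame {ι : Type*} [DecidableEq ι] (φ : 𝒜 →ₐᵍ[ℝ] ℬ) (d : ι → ZMod 2) (t : ι → R)
    (E : ι → R →ₗ[ℝ] S) : Prop where
  homogeneous : ∀ i, IsHomogeneousDerivation φ (d i) (E i)
  apply_coord : ∀ i j, E i (t j) = if i = j then 1 else 0

namespace IsDualFrame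

variable {ι : Type*} [Fintype ι] [DecidableEq ι] {φ : 𝒜 →ₐᵍ[ℝ] ℬ} {J : Submodule ℝ S}
  {d : ι → ZMod 2} {t : ι → R} {E : ι → R →ₗ[ℝ] S}

theorem sum_smul_apply (hE : IsDualFrame φ d t E) (f : ι → S) (j : ι) :
    (∑ i, f i • E i) (t j) = f j := by
  simp [LinearMap.sum_apply, hE.apply_coord]

theorem homogeneous_sum_smul [IsSuperCommutative ℬ] (hE : IsDualFrame φ d t E) {k : ZMod 2}
    {f : ι → S} (hf : ∀ i, f i ∈ ℬ (k + d i)) :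
    IsHomogeneousDerivation φ k (∑ i, f i • E i) := by
  refine .sum fun i _ => ?_
  have := (hE.homogeneous i).smul (hf i)
  rwa [add_assoc, zmod_two_add_self, add_zero] at this

/-- Evaluation at `t i`, of parity `d i`, reads off the coefficient `f i`, so its parity is forced.
-/
theorem homogeneous_sum_smul_iff [IsSuperCommutative ℬ] (hE : IsDualFrame φ d t E)
    (ht : IsCoordinateSystem φ J d t) {k : ZMod 2} {f : ι → S} :
    IsHomogeneousDerivation φ k (∑ i, f i • E i) ↔ ∀ i, f i ∈ ℬ (k + d i) := by
  refine ⟨fun h i => ?_, hE.homogeneous_sum_smul⟩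
  have := h.1 _ _ (ht.mem i)
  rwa [hE.sum_smul_apply] at this

theorem sum_smul_mem_der [IsSuperCommutative ℬ] (hE : IsDualFrame φ d t E) (f : ι → S) :
    ∑ i, f i • E i ∈ Der φ :=
  Submodule.sum_mem _ fun i _ => Submodule.smul_mem _ _ (hE.homogeneous i).mem_der

/-- Every derivation is determined by its values on the coordinates. -/
theorem eq_sum_smul [IsSuperCommutative ℬ] (hE : IsDualFrame φ d t E)
    (ht : IsCoordinateSystem φ J d t) (hJ : IsNilpotent J) {X : R →ₗ[ℝ] S} (hX : X ∈ Der φ) :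
    X = ∑ i, X (t i) • E i := by
  refine sub_eq_zero.mp (ht.eq_zero_of_mem_der hJ
    (Submodule.sub_mem _ hX (hE.sum_smul_mem_der fun i => X (t i))) fun j => ?_)
  rw [LinearMap.sub_apply, hE.sum_smul_apply, sub_self]

/-- The module of derivations is free on the dual frame. -/
def coordEquiv [IsSuperCommutative ℬ] (hE : IsDualFrame φ d t E)
    (ht : IsCoordinateSystem φ J d t) (hJ : IsNilpotent J) : Der φ ≃ₗ[S] (ι → S) where
  toFun X i := X.1 (t i)
  map_add' _ _ := rfl
  map_smul' _ _ := rfl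
  invFun f := ⟨∑ i, f i • E i, hE.sum_smul_mem_der f⟩
  left_inv X := Subtype.ext (hE.eq_sum_smul ht hJ X.2).symm
  right_inv f := funext fun j => hE.sum_smul_apply f j

end IsDualFrame

/-! ### Derivations along an evaluation -/

/-- The space of linear maps `v` with `v(fg) = v(f) ev(g) + ev(f) v(g)`. -/
def pointDer (ev : R →ₐ[ℝ] ℝ) : Submodule ℝ (R →ₗ[ℝ] ℝ) where
  carrier := {v | ∀ f g, v (f * g) = v f * ev g + ev f * v g}
  zero_mem' _ _ := by simp
  add_mem' hv hw f g := by
    simp only [LinearMap.add_apply, hv f g, hw f g]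
    ring
  smul_mem' c v hv f g := by
    simp only [LinearMap.smul_apply, hv f g, smul_eq_mul]
    ring

end Derivations

/-! ### The augmentation of a super Weil algebra -/

section Weil

variable {R A : Type*} [Ring R] [Algebra ℝ R] [Ring A] [Algebra ℝ A]
  {𝒢 : ZMod 2 → Submodule ℝ R} [GradedAlgebra 𝒢]
  (𝒜 : ZMod 2 → Submodule ℝ A) [GradedAlgebra 𝒜] [SuperWeilAlgebra 𝒜]

/-- The nilpotent ideal of a super Weil algebra as a real subspace. -/
def nilSubmodule : Submodule ℝ A := (SuperWeilAlgebra.nil 𝒜).restrictScalars ℝ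

theorem nilSubmodule_isNilpotent : IsNilpotent (nilSubmodule 𝒜) := by
  obtain ⟨n, hn⟩ := SuperWeilAlgebra.nil_nilpotent (𝒜 := 𝒜)
  -- Only an inclusion is available: the zeroth power is `ℝ · 1` on the left and all of `A` on the
  -- right.
  have key : ∀ m : ℕ, nilSubmodule 𝒜 ^ m ≤
      ((SuperWeilAlgebra.nil 𝒜) ^ m).restrictScalars ℝ := by
    intro m
    induction m with
    | zero =>
      rw [pow_zero, Submodule.pow_zero]
      intro x _
      rw [Submodule.restrictScalars_mem, Ideal.one_eq_top]
      trivial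
    | succ m ih =>
      rw [pow_succ, Submodule.pow_succ (SuperWeilAlgebra.nil 𝒜)]
      exact Submodule.mul_le.mpr fun a ha b hb => Ideal.mul_mem_mul (ih ha) hb
  refine ⟨n, ?_⟩
  have := key n
  rw [hn] at this
  rw [Submodule.zero_eq_bot, eq_bot_iff]
  exact this

theorem isNilpotent_of_mem_nil {a : A} (ha : a ∈ SuperWeilAlgebra.nil 𝒜) : IsNilpotent a := by
  obtain ⟨n, hn⟩ := nilSubmodule_isNilpotent 𝒜
  refine ⟨n, ?_⟩
  have h := Submodule.pow_mem_pow (nilSubmodule 𝒜) (x := a) ha n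
  rw [hn] at h
  exact h

theorem exists_algebraMap_sub_mem_nil (a : A) :
    ∃ c : ℝ, a - algebraMap ℝ A c ∈ SuperWeilAlgebra.nil 𝒜 := by
  have h : a ∈ (1 : Submodule ℝ A) ⊔ (SuperWeilAlgebra.nil 𝒜).restrictScalars ℝ := by
    rw [(SuperWeilAlgebra.isCompl (𝒜 := 𝒜)).sup_eq_top]
    trivial
  obtain ⟨y, hy, z, hz, rfl⟩ := Submodule.mem_sup.mp h
  obtain ⟨c, rfl⟩ := Submodule.mem_one.mp hy
  exact ⟨c, by simpa using hz⟩

theorem eq_of_algebraMap_sub_mem_nil {a : A} {c c' : ℝ}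
    (h : a - algebraMap ℝ A c ∈ SuperWeilAlgebra.nil 𝒜)
    (h' : a - algebraMap ℝ A c' ∈ SuperWeilAlgebra.nil 𝒜) : c = c' := by
  have := SuperWeilAlgebra.nontrivial (𝒜 := 𝒜)
  have h1 : algebraMap ℝ A (c - c') ∈ SuperWeilAlgebra.nil 𝒜 := by
    have := sub_mem h' h
    rwa [sub_sub_sub_cancel_left, ← map_sub] at this
  have h2 := (Submodule.disjoint_def.mp (SuperWeilAlgebra.isCompl (𝒜 := 𝒜)).disjoint) _
    (Submodule.mem_one.mpr ⟨_, rfl⟩) h1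
  rw [map_eq_zero_iff _ (algebraMap ℝ A).injective] at h2
  exact sub_eq_zero.mp h2

/-- The projection `A = ℝ ⊕ nil → ℝ`. -/
def augmentation : A →ₐ[ℝ] ℝ :=
  have spec := fun a => (exists_algebraMap_sub_mem_nil 𝒜 a).choose_spec
  have uniq : ∀ {a : A} {c : ℝ}, a - algebraMap ℝ A c ∈ SuperWeilAlgebra.nil 𝒜 →
      (exists_algebraMap_sub_mem_nil 𝒜 a).choose = c :=
    fun h => eq_of_algebraMap_sub_mem_nil 𝒜 (spec _) h
  { toFun := fun a => (exists_algebraMap_sub_mem_nil 𝒜 a).choose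
    map_one' := uniq (by simp)
    map_zero' := uniq (by simp)
    map_add' := fun a b => uniq (by
      have := add_mem (spec a) (spec b)
      rwa [← add_sub_add_comm, ← map_add] at this)
    map_mul' := fun a b => uniq (by
      set r := (exists_algebraMap_sub_mem_nil 𝒜 a).choose with hr
      set s := (exists_algebraMap_sub_mem_nil 𝒜 b).choose with hs
      -- The splitting multiplies elements of `nil` from the left only, as befits a left ideal;
      -- scalars are central.
      have h : a * b - algebraMap ℝ A (r * s) =
          a * (b - algebraMap ℝ A s) + algebraMap ℝ A s * (a - algebraMap ℝ A r) := by
        rw [mul_sub, mul_sub, map_mul, ← Algebra.commutes s a, ← Algebra.commutes s]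
        abel
      rw [h]
      exact add_mem (Ideal.mul_mem_left _ _ (spec b)) (Ideal.mul_mem_left _ _ (spec a)))
    commutes' := fun c => uniq (by simp) }

theorem sub_augmentation_mem_nil (a : A) :
    a - algebraMap ℝ A (augmentation 𝒜 a) ∈ SuperWeilAlgebra.nil 𝒜 :=
  (exists_algebraMap_sub_mem_nil 𝒜 a).choose_spec

variable {𝒜}

theorem augmentation_eq_iff {a : A} {c : ℝ} :
    augmentation 𝒜 a = c ↔ a - algebraMap ℝ A c ∈ SuperWeilAlgebra.nil 𝒜 :=
  ⟨fun h => h ▸ sub_augmentation_mem_nil 𝒜 a,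
    eq_of_algebraMap_sub_mem_nil 𝒜 (sub_augmentation_mem_nil 𝒜 a)⟩

theorem augmentation_eq_zero_iff {a : A} :
    augmentation 𝒜 a = 0 ↔ a ∈ SuperWeilAlgebra.nil 𝒜 := by
  rw [augmentation_eq_iff, map_zero, sub_zero]

/-- Such an element is an invertible scalar plus a nilpotent, and the two commute. -/
theorem isUnit_of_augmentation_ne_zero {a : A} (ha : augmentation 𝒜 a ≠ 0) : IsUnit a := by
  have h1 : IsNilpotent (a - algebraMap ℝ A (augmentation 𝒜 a)) :=
    isNilpotent_of_mem_nil 𝒜 (sub_augmentation_mem_nil 𝒜 a)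
  have h2 : IsUnit (algebraMap ℝ A (augmentation 𝒜 a)) := (IsUnit.mk0 _ ha).map _
  have := h1.isUnit_add_left_of_commute h2 (Algebra.commutes _ _).symm
  rwa [add_sub_cancel] at this

/-- Odd elements square to zero, and ℝ is reduced. This is why Koszul signs disappear after
reduction. -/
theorem augmentation_eq_zero_of_odd {a : A} (ha : a ∈ 𝒜 1) : augmentation 𝒜 a = 0 := by
  have h := congrArg (augmentation 𝒜) (IsSuperCommutative.mul_self_of_odd ha)
  rw [map_mul, map_zero] at h
  exact mul_self_eq_zero.mp h

/-! ### Tangent vectors as reductions of derivations -/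

section PointDer

variable {ι : Type*} [Fintype ι] {φ : 𝒢 →ₐᵍ[ℝ] 𝒜} {d : ι → ZMod 2} {t : ι → R}
  {E : ι → R →ₗ[ℝ] A} {ev : R →ₐ[ℝ] ℝ}

/-- The reduction of a derivation into a super Weil algebra is a tangent vector. -/
theorem augmentation_comp_mem_pointDer (hev : ∀ s, augmentation 𝒜 (φ s) = ev s) {k : ZMod 2}
    {X : R →ₗ[ℝ] A} (hX : IsHomogeneousDerivation φ k X) :
    (augmentation 𝒜).toLinearMap ∘ₗ X ∈ pointDer ev := by
  intro f g
  simp only [LinearMap.comp_apply, AlgHom.toLinearMap_apply]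
  induction f using DirectSum.Decomposition.inductionOn 𝒢 with
  | zero => simp
  | @homogeneous j m =>
    rw [hX.2 j m m.2 g, map_add, map_smul, map_mul, map_mul, hev, hev]
    congr 1
    -- The sign can be nontrivial only for odd `m`, and then the term carrying it has the factor `ev
    -- m = 0`.
    obtain rfl | rfl := zmod_two_eq j
    · simp
    · rw [← hev m, augmentation_eq_zero_of_odd (Graded.map_mem φ m.2), zero_mul, smul_zero]
  | add m n hm hn =>
    rw [add_mul, map_add, map_add, hm, hn, map_add, map_add, map_add]
    ring

/-- In the expansion of `s`, a tangent vector kills the constant and `z`, and `ev (t i) = 0` removes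
half of each product. The same `g` serves all `v`, so tangent vectors are determined by their values
on the coordinates. -/
theorem IsCoordinateSystem.pointDer_apply
    (ht : IsCoordinateSystem φ (nilSubmodule 𝒜) d t) (hev : ∀ s, augmentation 𝒜 (φ s) = ev s)
    (s : R) : ∃ g : ι → R, ∀ v ∈ pointDer ev, v s = ∑ i, v (t i) * ev (g i) := by
  obtain ⟨c, g, z, rfl, ρ, hρ, hz, hu⟩ := ht.exists_expansion s
  refine ⟨g, fun v hv => ?_⟩
  have h1 : v 1 = 0 := by simpa using hv 1 1
  have hρ0 : ev ρ ≠ 0 := by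
    rw [← hev]
    exact (hu.map (augmentation 𝒜)).ne_zero
  have hz0 : ev z = 0 := by
    have := congrArg ev hz
    rw [map_mul, map_zero] at this
    exact (mul_eq_zero.mp this).resolve_left hρ0
  have h2 : v z = 0 := by
    have := hv ρ z
    rw [hz, map_zero, hz0, mul_zero, zero_add] at this
    exact (mul_eq_zero.mp this.symm).resolve_left hρ0
  have h3 : ∀ i, ev (t i) = 0 := fun i => by
    rw [← hev]
    exact augmentation_eq_zero_iff.mpr (ht.map_mem i)
  rw [map_add, map_add, h2, Algebra.algebraMap_eq_smul_one, map_smul, h1, smul_zero, zero_add,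
    add_zero, map_sum]
  exact Finset.sum_congr rfl fun i _ => by rw [hv, h3, zero_mul, add_zero]

variable [DecidableEq ι]

/-- The tangent space is free on the reductions of a dual frame. -/
def IsDualFrame.pointEquiv (hE : IsDualFrame φ d t E)
    (ht : IsCoordinateSystem φ (nilSubmodule 𝒜) d t) (hev : ∀ s, augmentation 𝒜 (φ s) = ev s) :
    pointDer ev ≃ₗ[ℝ] (ι → ℝ) where
  toFun v i := v.1 (t i)
  map_add' _ _ := rfl
  map_smul' _ _ := rfl
  invFun c := ⟨∑ i, c i • ((augmentation 𝒜).toLinearMap ∘ₗ E i), Submodule.sum_mem _ fun i _ =>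
    Submodule.smul_mem _ _ (augmentation_comp_mem_pointDer hev (hE.homogeneous i))⟩
  left_inv v := by
    apply Subtype.ext
    ext s
    obtain ⟨g, hg⟩ := ht.pointDer_apply hev s
    rw [hg v.1 v.2, hg _ (Submodule.sum_mem _ fun i _ =>
      Submodule.smul_mem _ _ (augmentation_comp_mem_pointDer hev (hE.homogeneous i)))]
    refine Finset.sum_congr rfl fun j _ => ?_
    simp [LinearMap.sum_apply, hE.apply_coord, apply_ite]
  right_inv c := by
    funext j
    simp [LinearMap.sum_apply, hE.apply_coord, apply_ite]

/-- `A ⊗ T ≃ Der_φ`, `a ⊗ v ↦ ∑ a v(t_i) E_i`. -/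
def IsDualFrame.tensorEquiv (hE : IsDualFrame φ d t E)
    (ht : IsCoordinateSystem φ (nilSubmodule 𝒜) d t) (hev : ∀ s, augmentation 𝒜 (φ s) = ev s) :
    A ⊗[ℝ] pointDer ev ≃ₗ[A] Der φ :=
  (Algebra.TensorProduct.basis A (Module.Basis.ofEquivFun (hE.pointEquiv ht hev))).equiv
    (Module.Basis.ofEquivFun (hE.coordEquiv ht (nilSubmodule_isNilpotent 𝒜))) (Equiv.refl ι)

theorem IsDualFrame.tensorEquiv_tmul (hE : IsDualFrame φ d t E)
    (ht : IsCoordinateSystem φ (nilSubmodule 𝒜) d t) (hev : ∀ s, augmentation 𝒜 (φ s) = ev s)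
    (a : A) (v : pointDer ev) :
    (hE.tensorEquiv ht hev (a ⊗ₜ v)).1 = ∑ i, (v.1 (t i) • a) • E i := by
  set b := Module.Basis.ofEquivFun (hE.pointEquiv ht hev) with hb
  set b' := Module.Basis.ofEquivFun (hE.coordEquiv ht (nilSubmodule_isNilpotent 𝒜)) with hb'
  have h1 : ∀ i, ((b' i : Der φ) : R →ₗ[ℝ] A) = E i := by
    intro i
    rw [hb', Module.Basis.coe_ofEquivFun]
    change ∑ j, (Pi.single i (1 : A) : ι → A) j • E j = E i
    rw [Finset.sum_eq_single i]
    · simp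
    · intro j _ hj; simp [hj]
    · simp
  have hv : v = ∑ i, v.1 (t i) • b i := by
    conv_lhs => rw [← b.sum_repr v]
    rfl
  conv_lhs => rw [hv]
  rw [TensorProduct.tmul_sum, map_sum, AddSubmonoidClass.coe_finsetSum]
  refine Finset.sum_congr rfl fun i _ => ?_
  have h2 : a ⊗ₜ[ℝ] (v.1 (t i) • b i) =
      (v.1 (t i) • a) • (Algebra.TensorProduct.basis A b i) := by
    rw [Algebra.TensorProduct.basis_apply, TensorProduct.smul_tmul', smul_eq_mul, mul_one,
      TensorProduct.tmul_smul, TensorProduct.smul_tmul']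
  rw [h2, map_smul, IsDualFrame.tensorEquiv, Module.Basis.equiv_apply, Equiv.refl_apply]
  rw [Submodule.coe_smul, h1]

/-- Modulo `nil`, the formula `∑ (v (t i) • a) • E i` becomes `a` times the expansion of `v` in the
reduced frame. -/
theorem IsDualFrame.tensorEquiv_tmul_sub_mem (hE : IsDualFrame φ d t E)
    (ht : IsCoordinateSystem φ (nilSubmodule 𝒜) d t) (hev : ∀ s, augmentation 𝒜 (φ s) = ev s)
    (a : A) (v : pointDer ev) (s : R) :
    (hE.tensorEquiv ht hev (a ⊗ₜ v)).1 s - a * algebraMap ℝ A (v.1 s) ∈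
      SuperWeilAlgebra.nil 𝒜 := by
  rw [← augmentation_eq_zero_iff, map_sub, map_mul, AlgHom.commutes, hE.tensorEquiv_tmul]
  have h : v.1 s = ∑ i, v.1 (t i) * augmentation 𝒜 (E i s) := by
    have := congrArg (fun w : pointDer ev => w.1 s) ((hE.pointEquiv ht hev).symm_apply_apply v)
    refine this.symm.trans ?_
    change (∑ i, v.1 (t i) • ((augmentation 𝒜).toLinearMap ∘ₗ E i)) s = _
    simp [LinearMap.sum_apply]
  rw [h, LinearMap.sum_apply, map_sum, sub_eq_zero, Algebra.algebraMap_self, RingHom.id_apply,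
    Finset.mul_sum]
  refine Finset.sum_congr rfl fun i _ => ?_
  rw [LinearMap.smul_apply, smul_eq_mul, map_mul, map_smul, smul_eq_mul]
  ring

/-- A tangent vector of parity `j` vanishes on coordinates of the other parity. The remaining
coefficients are multiples of `a` in front of frame elements of parity `j`. -/
theorem IsDualFrame.tensorEquiv_homogeneous (hE : IsDualFrame φ d t E)
    (ht : IsCoordinateSystem φ (nilSubmodule 𝒜) d t) (hev : ∀ s, augmentation 𝒜 (φ s) = ev s)
    {i j : ZMod 2} {a : A} (ha : a ∈ 𝒜 i) {v : pointDer ev} (hv : ∀ s ∈ 𝒢 (j + 1), v.1 s = 0) :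
    IsHomogeneousDerivation φ (i + j) (hE.tensorEquiv ht hev (a ⊗ₜ v)).1 := by
  rw [hE.tensorEquiv_tmul]
  refine hE.homogeneous_sum_smul fun l => ?_
  by_cases h : d l = j + 1
  · rw [hv _ (h ▸ ht.mem l), zero_smul]
    exact zero_mem _
  · have h' : d l = j := by
      revert h
      generalize d l = m
      clear hv
      revert m j
      decide
    rw [h', add_assoc, zmod_two_add_self, add_zero]
    exact Submodule.smul_mem _ _ ha

end PointDer

end Weil

/-! ### Hadamard's lemma -/

/-- Differentiation under the integral sign. The dominating constant is the maximum of the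
continuous partial derivative on the compact set closed unit ball × [0,1]. -/
theorem hasFDerivAt_intervalIntegral {E G : Type*} [NormedAddCommGroup E] [NormedSpace ℝ E]
    [FiniteDimensional ℝ E] [NormedAddCommGroup G] [NormedSpace ℝ G] {F : E × ℝ → G}
    (hF : ContDiff ℝ 1 F) (y : E) :
    HasFDerivAt (fun y => ∫ t in (0 : ℝ)..1, F (y, t))
      (∫ t in (0 : ℝ)..1, (fderiv ℝ F (y, t)).comp (ContinuousLinearMap.inl ℝ E ℝ)) y := by
  have : ProperSpace E := FiniteDimensional.proper ℝ E
  have hc : Continuous fun z : E × ℝ => (fderiv ℝ F z).comp (ContinuousLinearMap.inl ℝ E ℝ) :=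
    (hF.continuous_fderiv one_ne_zero).clm_comp continuous_const
  have hK : IsCompact (Metric.closedBall y 1 ×ˢ Set.Icc (0 : ℝ) 1) :=
    (isCompact_closedBall y 1).prod isCompact_Icc
  obtain ⟨C, hC⟩ := hK.exists_bound_of_continuousOn hc.continuousOn
  have hF' : ∀ x, Continuous fun t => F (x, t) := fun x =>
    hF.continuous.comp (Continuous.prodMk_right x)
  refine intervalIntegral.hasFDerivAt_integral_of_dominated_of_fderiv_le (bound := fun _ => C)
    (F := fun x t => F (x, t))
    (F' := fun x t => (fderiv ℝ F (x, t)).comp (ContinuousLinearMap.inl ℝ E ℝ))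
    (Metric.closedBall_mem_nhds y one_pos) (.of_forall fun x => (hF' x).aestronglyMeasurable)
    ((hF' y).intervalIntegrable _ _)
    (hc.comp (Continuous.prodMk_right y)).aestronglyMeasurable ?_
    intervalIntegrable_const ?_
  · refine .of_forall fun t ht x hx => hC (x, t) ⟨hx, ?_⟩
    rw [Set.uIoc_of_le zero_le_one] at ht
    exact ⟨ht.1.le, ht.2⟩
  · refine .of_forall fun t _ x _ => ?_
    have h1 := (hF.differentiable one_ne_zero (x, t)).hasFDerivAt
    have h2 : HasFDerivAt (fun x : E => (x, t)) (ContinuousLinearMap.inl ℝ E ℝ) x :=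
      hasFDerivAt_prodMk_left x t
    exact h1.comp x h2

/-- Integrals of smooth functions over the unit interval depend smoothly on parameters. -/
theorem contDiff_intervalIntegral {E G : Type} [NormedAddCommGroup E] [NormedSpace ℝ E]
    [FiniteDimensional ℝ E] [NormedAddCommGroup G] [NormedSpace ℝ G] {F : E × ℝ → G}
    (hF : ContDiff ℝ ∞ F) : ContDiff ℝ ∞ fun y => ∫ t in (0 : ℝ)..1, F (y, t) := by
  rw [contDiff_infty]
  intro n
  -- The derivative takes values in `E →L[ℝ] G`, so the target changes at each step. Keeping both
  -- spaces in one universe allows the induction.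
  induction n generalizing G with
  | zero =>
    exact contDiff_zero.mpr (continuous_iff_continuousAt.mpr fun y =>
      (hasFDerivAt_intervalIntegral (hF.of_le (by simp)) y).continuousAt)
  | succ n ih =>
    refine contDiff_succ_iff_hasFDerivAt.mpr
      ⟨_, ih (F := fun z => (fderiv ℝ F z).comp (ContinuousLinearMap.inl ℝ E ℝ)) ?_,
        hasFDerivAt_intervalIntegral (hF.of_le (by simp))⟩
    exact (hF.fderiv_right (m := ∞) (by simp)).clm_comp contDiff_const

/-- Integrate the derivative of `h` along the segment from `a` to `y` and expand `y - a` in the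
standard basis: `g i` is the integral of the `i`-th partial derivative. -/
theorem exists_hadamard_global {p : ℕ} {h : EuclideanSpace ℝ (Fin p) → ℝ} (hh : ContDiff ℝ ∞ h)
    (a : EuclideanSpace ℝ (Fin p)) :
    ∃ g : Fin p → EuclideanSpace ℝ (Fin p) → ℝ, (∀ i, ContDiff ℝ ∞ (g i)) ∧
      ∀ y, h y = h a + ∑ i, (y i - a i) * g i y := by
  have hsm : ∀ i, ContDiff ℝ ∞ fun z : EuclideanSpace ℝ (Fin p) × ℝ =>
      fderiv ℝ h (a + z.2 • (z.1 - a)) (EuclideanSpace.single i (1 : ℝ)) := fun i =>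
    (((hh.fderiv_right (m := ∞) (by simp)).comp (contDiff_const.add
      (contDiff_snd.smul (contDiff_fst.sub contDiff_const)))).clm_apply contDiff_const)
  refine ⟨fun i y => ∫ t in (0 : ℝ)..1, fderiv ℝ h (a + t • (y - a)) (EuclideanSpace.single i 1),
    fun i => contDiff_intervalIntegral (hsm i), fun y => ?_⟩
  have hd : ∀ t : ℝ, HasDerivAt (fun t : ℝ => h (a + t • (y - a)))
      (fderiv ℝ h (a + t • (y - a)) (y - a)) t := fun t => by
    have h1 : HasDerivAt (fun t : ℝ => a + t • (y - a)) (y - a) t := by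
      simpa using ((hasDerivAt_id t).smul_const (y - a)).const_add a
    exact ((hh.differentiable (by simp) _).hasFDerivAt).comp_hasDerivAt t h1
  have hc : ∀ i, Continuous fun t : ℝ =>
      fderiv ℝ h (a + t • (y - a)) (EuclideanSpace.single i (1 : ℝ)) := fun i =>
    (hsm i).continuous.comp (Continuous.prodMk_right y)
  have hsum : ∀ t : ℝ, fderiv ℝ h (a + t • (y - a)) (y - a) =
      ∑ i, (y i - a i) * fderiv ℝ h (a + t • (y - a)) (EuclideanSpace.single i 1) := fun t => by
    have hy : y - a = ∑ i, (y i - a i) • EuclideanSpace.single i (1 : ℝ) := by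
      ext j
      simp [Pi.single_apply]
    conv_lhs => rw [hy, map_sum]
    simp only [map_smul, smul_eq_mul, ← hy]
  have hint : Continuous fun t : ℝ => fderiv ℝ h (a + t • (y - a)) (y - a) := by
    simp only [hsum]
    exact continuous_finsetSum _ fun i _ => continuous_const.mul (hc i)
  have key := intervalIntegral.integral_eq_sub_of_hasDerivAt (fun t _ => hd t)
    (hint.intervalIntegrable 0 1)
  simp only [one_smul, zero_smul, add_zero, add_sub_cancel] at key
  rw [← sub_eq_iff_eq_add', ← key]
  simp only [hsum]
  have hi : ∀ i ∈ Finset.univ, IntervalIntegrable (fun t : ℝ => (y i - a i) *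
      fderiv ℝ h (a + t • (y - a)) (EuclideanSpace.single i (1 : ℝ))) MeasureTheory.volume 0 1 :=
    fun i _ => (continuous_const.mul (hc i)).intervalIntegrable 0 1
  rw [intervalIntegral.integral_finsetSum hi]
  simp only [intervalIntegral.integral_const_mul]

/-! ### Smooth functions on open sets -/

section Smooth

variable {p : ℕ} {U V : Opens (EuclideanSpace ℝ (Fin p))}

/-- The smooth function on `U` given by a function that is smooth on `U`. -/
def smoothMk (U : Opens (EuclideanSpace ℝ (Fin p))) (g : EuclideanSpace ℝ (Fin p) → ℝ)
    (hg : ContDiffOn ℝ ∞ g U) : smoothFun U :=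
  ⟨fun x => g x, hg.congr fun x hx => Subtype.val_injective.extend_apply _ _ (⟨x, hx⟩ : U)⟩

theorem smoothFun_ext {f g : smoothFun U} (h : ∀ x, f.1 x = g.1 x) : f = g :=
  Subtype.ext (funext h)

/-- The extension by zero of a function on `U`. -/
abbrev extendZero (f : smoothFun U) : EuclideanSpace ℝ (Fin p) → ℝ :=
  Function.extend Subtype.val f.1 0

theorem extendZero_apply (f : smoothFun U) {x : EuclideanSpace ℝ (Fin p)} (hx : x ∈ U) :
    extendZero f x = f.1 ⟨x, hx⟩ := Subtype.val_injective.extend_apply f.1 0 (⟨x, hx⟩ : U)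

theorem contDiffOn_extendZero (f : smoothFun U) : ContDiffOn ℝ ∞ (extendZero f) U := f.2

theorem contDiffAt_extendZero (f : smoothFun U) {x : EuclideanSpace ℝ (Fin p)} (hx : x ∈ U) :
    ContDiffAt ℝ ∞ (extendZero f) x := (contDiffOn_extendZero f).contDiffAt (U.isOpen.mem_nhds hx)

theorem smoothFun_continuous (f : smoothFun U) : Continuous f.1 := by
  rw [continuous_iff_continuousAt]
  intro x
  have h1 : ContinuousAt (fun y : U => extendZero f y) x :=
    (contDiffAt_extendZero f x.2).continuousAt.comp continuous_subtype_val.continuousAt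
  refine h1.congr (.of_forall fun y => extendZero_apply f y.2)

theorem partialDeriv_apply (i : Fin p) (f : smoothFun U) (x : U) :
    (partialDeriv i f).1 x = fderiv ℝ (extendZero f) x.1 (EuclideanSpace.single i 1) := rfl

/-- Derivatives depend only on germs, so they may be computed from any formula valid on `U`,
whatever the extension does outside. -/
theorem extendZero_eventuallyEq {f : smoothFun U} {g : EuclideanSpace ℝ (Fin p) → ℝ}
    {x : EuclideanSpace ℝ (Fin p)} (hx : x ∈ U) (h : ∀ y : U, f.1 y = g y) :
    extendZero f =ᶠ[nhds x] g := by
  filter_upwards [U.isOpen.mem_nhds hx] with y hy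
  rw [extendZero_apply f hy, h ⟨y, hy⟩]

theorem partialDeriv_mul (i : Fin p) (f g : smoothFun U) :
    partialDeriv i (f * g) = partialDeriv i f * g + f * partialDeriv i g := by
  refine smoothFun_ext fun x => ?_
  have h : extendZero (f * g) =ᶠ[nhds x.1] fun y => extendZero f y * extendZero g y :=
    extendZero_eventuallyEq x.2 fun y => by
      rw [extendZero_apply f y.2, extendZero_apply g y.2]
      rfl
  have hf := (contDiffAt_extendZero f x.2).differentiableAt (by simp)
  have hg := (contDiffAt_extendZero g x.2).differentiableAt (by simp)
  rw [partialDeriv_apply, h.fderiv_eq, fderiv_fun_mul hf hg]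
  change _ = (partialDeriv i f).1 x * g.1 x + f.1 x * (partialDeriv i g).1 x
  rw [partialDeriv_apply, partialDeriv_apply, extendZero_apply f x.2, extendZero_apply g x.2]
  simp only [add_apply, smul_apply, smul_eq_mul]
  ring

theorem partialDeriv_one (i : Fin p) : partialDeriv i (1 : smoothFun U) = 0 := by
  have := partialDeriv_mul i (1 : smoothFun U) 1
  simpa using this

theorem partialDeriv_smoothRes (i : Fin p) (h : V ≤ U) (f : smoothFun U) :
    partialDeriv i (smoothRes h f) = smoothRes h (partialDeriv i f) := by
  refine smoothFun_ext fun x => ?_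
  change _ = (partialDeriv i f).1 ⟨x.1, h x.2⟩
  rw [partialDeriv_apply, partialDeriv_apply]
  have : extendZero (smoothRes h f) =ᶠ[nhds x.1] extendZero f :=
    extendZero_eventuallyEq x.2 fun y => (extendZero_apply f (h y.2)).symm
  rw [this.fderiv_eq]

theorem contDiff_coord (i : Fin p) : ContDiff ℝ ∞ fun y : EuclideanSpace ℝ (Fin p) => y i :=
  (EuclideanSpace.proj (𝕜 := ℝ) i : EuclideanSpace ℝ (Fin p) →L[ℝ] ℝ).contDiff

/-- The coordinate function `x_i` on `U`. -/
def coordFun (U : Opens (EuclideanSpace ℝ (Fin p))) (i : Fin p) : smoothFun U :=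
  smoothMk U (fun y => y i) (contDiff_coord i).contDiffOn

theorem partialDeriv_coordFun (i j : Fin p) :
    partialDeriv i (coordFun U j) = if i = j then 1 else 0 := by
  refine smoothFun_ext fun x => ?_
  rw [partialDeriv_apply, (extendZero_eventuallyEq x.2 fun _ => rfl :
    extendZero (coordFun U j) =ᶠ[nhds x.1] fun y => y j).fderiv_eq]
  have : fderiv ℝ (fun y : EuclideanSpace ℝ (Fin p) => y j) x.1 =
      (EuclideanSpace.proj (𝕜 := ℝ) j : EuclideanSpace ℝ (Fin p) →L[ℝ] ℝ) :=
    (EuclideanSpace.proj (𝕜 := ℝ) j : EuclideanSpace ℝ (Fin p) →L[ℝ] ℝ).fderiv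
  rw [this]
  by_cases h : i = j
  · subst h; simp
  · simp [h, Ne.symm h]

theorem sum_sq_sub_ne_zero {y a : EuclideanSpace ℝ (Fin p)} (h : y ≠ a) :
    ∑ i, (y i - a i) * (y i - a i) ≠ 0 := by
  intro h0
  refine h (PiLp.ext fun i => ?_)
  have := (Finset.sum_eq_zero_iff_of_nonneg fun i _ => mul_self_nonneg (y i - a i)).mp h0 i
    (Finset.mem_univ i)
  exact sub_eq_zero.mp (mul_self_eq_zero.mp this)

theorem contDiff_sum_sq_sub (a : EuclideanSpace ℝ (Fin p)) :
    ContDiff ℝ ∞ fun y : EuclideanSpace ℝ (Fin p) => ∑ i, (y i - a i) * (y i - a i) :=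
  ContDiff.sum fun i _ => ((contDiff_coord i).sub contDiff_const).mul
    ((contDiff_coord i).sub contDiff_const)

/-- Outside `U` the product vanishes near each point, because the supporting closed ball is closed
and contained in `U`. -/
theorem contDiff_bump_mul_extendZero {a : EuclideanSpace ℝ (Fin p)} (b : ContDiffBump a)
    (hb : Metric.closedBall a b.rOut ⊆ U) (f : smoothFun U) :
    ContDiff ℝ ∞ fun y => b y * extendZero f y := by
  rw [contDiff_iff_contDiffAt]
  intro y
  by_cases hy : y ∈ U
  · exact b.contDiffAt.mul (contDiffAt_extendZero f hy)
  · have h1 : (fun y => b y * extendZero f y) =ᶠ[nhds y] fun _ => 0 := by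
      have : (Metric.closedBall a b.rOut)ᶜ ∈ nhds y :=
        Metric.isClosed_closedBall.isOpen_compl.mem_nhds fun h => hy (hb h)
      filter_upwards [this] with z hz
      rw [b.zero_of_le_dist (not_le.mp fun h => hz h).le, zero_mul]
    exact contDiffAt_const.congr_of_eventuallyEq h1

theorem exists_contDiffBump {a : EuclideanSpace ℝ (Fin p)} (ha : a ∈ U) :
    ∃ b : ContDiffBump a, Metric.closedBall a b.rOut ⊆ U := by
  obtain ⟨r, hr, h⟩ := Metric.nhds_basis_closedBall.mem_iff.mp (U.isOpen.mem_nhds ha)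
  exact ⟨⟨r / 2, r, half_pos hr, half_lt_self hr⟩, h⟩

/-- **Hadamard's lemma** on an arbitrary open set. -/
theorem exists_hadamard (a : U) (f : smoothFun U) :
    ∃ g : Fin p → smoothFun U, f = algebraMap ℝ (smoothFun U) (f.1 a) +
      ∑ i, (coordFun U i - algebraMap ℝ (smoothFun U) (a.1 i)) * g i := by
  obtain ⟨b, hb⟩ := exists_contDiffBump a.2
  -- `U` need not be star-shaped, so the segment argument is applied to a globally smooth cut-off of
  -- `f`.
  set h : EuclideanSpace ℝ (Fin p) → ℝ := fun y => b y * extendZero f y with hh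
  have hsm : ContDiff ℝ ∞ h := contDiff_bump_mul_extendZero b hb f
  obtain ⟨g, hg, hgh⟩ := exists_hadamard_global hsm a.1
  have hclose : ∀ᶠ y in nhds a.1, extendZero f y - h y = 0 := by
    filter_upwards [Metric.closedBall_mem_nhds a.1 b.rIn_pos] with y hy
    rw [hh]
    simp only
    rw [b.one_of_mem_closedBall hy, one_mul, sub_self]
  -- The remainder `f - h` vanishes near `a`, so it may be divided by `|y - a|²`. Writing it as `∑
  -- (y i - a i) * ((f - h) * (y i - a i) / |y - a|²)` corrects the `g i`; at `a` itself the
  -- convention `0 / 0 = 0` gives the right value.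
  have hk : ∀ i, ContDiffOn ℝ ∞ (fun y => g i y +
      (extendZero f y - h y) * (y i - a.1 i) / ∑ j, (y j - a.1 j) * (y j - a.1 j)) U := by
    intro i y hy
    refine ContDiffAt.contDiffWithinAt ((hg i).contDiffAt.add ?_)
    by_cases hya : y = a.1
    · subst hya
      refine (contDiffAt_const (c := 0)).congr_of_eventuallyEq ?_
      filter_upwards [hclose] with z hz
      rw [hz, zero_mul, zero_div]
    · exact (((contDiffAt_extendZero f hy).sub hsm.contDiffAt).mul
        ((contDiff_coord i).contDiffAt.sub contDiffAt_const)).div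
        (contDiff_sum_sq_sub a.1).contDiffAt (sum_sq_sub_ne_zero hya)
  refine ⟨fun i => smoothMk U _ (hk i), smoothFun_ext fun y => ?_⟩
  have hsum : ∀ (k : Fin p → smoothFun U), (∑ i, k i).1 y = ∑ i, (k i).1 y := fun k => by
    rw [AddSubmonoidClass.coe_finsetSum, Finset.sum_apply]
  change f.1 y = f.1 a + (∑ i, _ : smoothFun U).1 y
  rw [hsum]
  change f.1 y = f.1 a + ∑ i, (y.1 i - a.1 i) * (g i y.1 + (extendZero f y.1 - h y.1) *
    (y.1 i - a.1 i) / ∑ j, (y.1 j - a.1 j) * (y.1 j - a.1 j))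
  have ha : h a.1 = f.1 a := by
    rw [← extendZero_apply f a.2]
    exact (sub_eq_zero.mp hclose.self_of_nhds).symm
  simp only [mul_add, Finset.sum_add_distrib]
  rw [← ha, ← add_assoc, ← hgh, ← extendZero_apply f y.2]
  have : ∑ i, (y.1 i - a.1 i) * ((extendZero f y.1 - h y.1) * (y.1 i - a.1 i) /
      ∑ j, (y.1 j - a.1 j) * (y.1 j - a.1 j)) = extendZero f y.1 - h y.1 := by
    by_cases hya : y.1 = a.1
    · rw [hya, hclose.self_of_nhds]
      simp
    · have hne := sum_sq_sub_ne_zero hya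
      refine Eq.trans ?_ (mul_div_cancel_right₀ (extendZero f y.1 - h y.1) hne)
      rw [Finset.mul_sum, Finset.sum_div]
      exact Finset.sum_congr rfl fun i _ => by ring
  rw [this]
  ring

end Smooth

/-! ### The Grassmann algebra -/

section Grassmann

variable {q : ℕ}

/-- The generator `θ_j` of the Grassmann algebra. -/
def theta (q : ℕ) (j : Fin q) : Grassmann q := ExteriorAlgebra.ι ℝ (Pi.single j 1)

/-- The contraction with the `j`-th coordinate functional. -/
abbrev contractTheta (j : Fin q) : Grassmann q →ₗ[ℝ] Grassmann q :=
  CliffordAlgebra.contractLeft (Q := (0 : QuadraticForm ℝ (Fin q → ℝ)))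
    (LinearMap.proj j : Module.Dual ℝ (Fin q → ℝ))

theorem theta_mem (j : Fin q) : theta q j ∈ grassmannGr q 1 :=
  CliffordAlgebra.ι_mem_evenOdd_one _ _

theorem contractTheta_theta (i j : Fin q) :
    contractTheta i (theta q j) = if i = j then 1 else 0 := by
  have h : contractTheta i (theta q j) = algebraMap ℝ (Grassmann q)
      ((LinearMap.proj i : Module.Dual ℝ (Fin q → ℝ)) (Pi.single j 1)) :=
    CliffordAlgebra.contractLeft_ι _ _ _
  rw [h, LinearMap.proj_apply, Pi.single_apply]
  split_ifs <;> simp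

/-- Prepending vectors to `x` extends the recursion for contracting a product whose left factor is a
vector to arbitrary left factors; the involution records the sign of passing over `x`. -/
theorem contractLeft_mul_eq (d : Module.Dual ℝ (Fin q → ℝ)) (x y : Grassmann q) :
    CliffordAlgebra.contractLeft (Q := (0 : QuadraticForm ℝ (Fin q → ℝ))) d (x * y) =
      CliffordAlgebra.contractLeft (Q := (0 : QuadraticForm ℝ (Fin q → ℝ))) d x * y +
        CliffordAlgebra.involute x *
          CliffordAlgebra.contractLeft (Q := (0 : QuadraticForm ℝ (Fin q → ℝ))) d y := by
  induction x using CliffordAlgebra.left_induction with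
  | algebraMap r =>
    rw [CliffordAlgebra.contractLeft_algebraMap_mul, CliffordAlgebra.contractLeft_algebraMap,
      zero_mul, zero_add, AlgHom.commutes]
  | add a b ha hb =>
    rw [add_mul, map_add, map_add, map_add, ha, hb, add_mul, add_mul]
    abel
  | ι_mul x m hx =>
    rw [mul_assoc, CliffordAlgebra.contractLeft_ι_mul, CliffordAlgebra.contractLeft_ι_mul, hx,
      map_mul, CliffordAlgebra.involute_ι, sub_mul, mul_add, smul_mul_assoc, neg_mul, neg_mul,
      mul_assoc, mul_assoc]
    abel

theorem contractTheta_mul (i : Fin q) {j : ZMod 2} {x : Grassmann q} (hx : x ∈ grassmannGr q j)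
    (y : Grassmann q) :
    contractTheta i (x * y) = contractTheta i x * y + koszulSign 1 j • (x * contractTheta i y) := by
  rw [contractTheta, contractLeft_mul_eq]
  congr 1
  obtain rfl | rfl := zmod_two_eq j
  · rw [CliffordAlgebra.involute_eq_of_mem_even hx, koszulSign_zero_right, one_smul]
  · rw [CliffordAlgebra.involute_eq_of_mem_odd hx, koszulSign_one_one, neg_one_smul, neg_mul]

/-- The induction prepends two vectors at a time, so parity stays fixed; the base cases are scalars
and single vectors. -/
theorem contractTheta_mem (i : Fin q) {j : ZMod 2} {x : Grassmann q} (hx : x ∈ grassmannGr q j) :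
    contractTheta i x ∈ grassmannGr q (1 + j) := by
  induction x, hx using CliffordAlgebra.evenOdd_induction with
  | range_ι_pow v h =>
    obtain rfl | rfl := zmod_two_eq j
    · obtain ⟨r, rfl⟩ := Submodule.mem_one.mp h
      rw [contractTheta, CliffordAlgebra.contractLeft_algebraMap]
      exact zero_mem _
    · rw [ZMod.val_one, pow_one] at h
      obtain ⟨m, rfl⟩ := h
      rw [contractTheta, CliffordAlgebra.contractLeft_ι, zmod_two_add_self]
      exact SetLike.algebraMap_mem_graded (grassmannGr q) _
  | add x y hx hy hx' hy' =>
    rw [map_add]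
    exact add_mem hx' hy'
  | ι_mul_ι_mul m₁ m₂ x hx hx' =>
    rw [contractTheta, mul_assoc, CliffordAlgebra.contractLeft_ι_mul,
      CliffordAlgebra.contractLeft_ι_mul]
    have h1 : ∀ m, CliffordAlgebra.ι (0 : QuadraticForm ℝ (Fin q → ℝ)) m ∈ grassmannGr q 1 :=
      CliffordAlgebra.ι_mem_evenOdd_one _
    refine sub_mem (Submodule.smul_mem _ _ (SetLike.mul_mem_graded (h1 m₂) hx))
      (SetLike.mul_mem_graded (h1 m₁) (sub_mem (Submodule.smul_mem _ _ ?_) ?_) :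
        _ ∈ grassmannGr q (1 + j))
    · exact hx
    · have := SetLike.mul_mem_graded (h1 m₂) hx'
      rwa [← add_assoc, zmod_two_add_self, zero_add] at this

/-- Every element of the Grassmann algebra is the sum of its scalar part and of multiples of the
generators. -/
theorem exists_grassmann_expansion (w : Grassmann q) : ∃ v : Fin q → Grassmann q,
    w = algebraMap ℝ _ (ExteriorAlgebra.algebraMapInv w) + ∑ j, theta q j * v j := by
  induction w using CliffordAlgebra.left_induction with
  | algebraMap r =>
    refine ⟨0, ?_⟩
    have : ExteriorAlgebra.algebraMapInv (algebraMap ℝ (Grassmann q) r) = r :=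
      AlgHom.commutes _ _
    simp [this]
  | add a b ha hb =>
    obtain ⟨v, hv⟩ := ha
    obtain ⟨w, hw⟩ := hb
    refine ⟨v + w, ?_⟩
    simp only [map_add, Pi.add_apply, mul_add, Finset.sum_add_distrib]
    conv_lhs => rw [hv, hw]
    abel
  | ι_mul x m hx =>
    -- A product beginning with the vector `m` has no scalar part; expanding `m` in the standard
    -- basis exhibits the generators.
    refine ⟨fun j => m j • x, ?_⟩
    have h0 : ExteriorAlgebra.algebraMapInv
        (CliffordAlgebra.ι (0 : QuadraticForm ℝ (Fin q → ℝ)) m * x : Grassmann q) = 0 := by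
      rw [map_mul]
      have : ExteriorAlgebra.algebraMapInv (ExteriorAlgebra.ι ℝ m) = (0 : ℝ) := by
        simp [ExteriorAlgebra.algebraMapInv]
      exact (congrArg (· * _) this).trans (zero_mul _)
    rw [h0, map_zero, zero_add]
    have hm : m = ∑ j, m j • (Pi.single j (1 : ℝ) : Fin q → ℝ) := by
      ext i
      simp [Finset.sum_apply, Pi.single_apply]
    conv_lhs => rw [hm]
    rw [map_sum, Finset.sum_mul]
    refine Finset.sum_congr rfl fun j _ => ?_
    rw [map_smul, smul_mul_assoc, mul_smul_comm]
    rfl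

/-- The power `q + 1` of this range is the exterior power of degree `q + 1`, whose dimension
`q.choose (q + 1)` is zero. -/
theorem isNilpotent_range_ι :
    IsNilpotent (LinearMap.range (ExteriorAlgebra.ι ℝ : (Fin q → ℝ) →ₗ[ℝ] Grassmann q)) := by
  refine ⟨q + 1, ?_⟩
  have h := exteriorPower.finrank_eq (R := ℝ) (M := Fin q → ℝ) (n := q + 1)
  rw [Module.finrank_fin_fun, Nat.choose_succ_self] at h
  exact Submodule.finrank_eq_zero.mp h

end Grassmann

/-! ### Functions on superdomains -/

section DomainFun

variable {p q : ℕ} {U V : Opens (EuclideanSpace ℝ (Fin p))}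

/-- The section `f ⊗ w`. -/
def tmk (f : smoothFun U) (w : Grassmann q) : DomainFun q U := f ⊗ₜ[ℝ] w

theorem tmk_mul (f g : smoothFun U) (v w : Grassmann q) :
    tmk f v * tmk g w = tmk (f * g) (v * w) := Algebra.TensorProduct.tmul_mul_tmul f g v w

theorem tmk_add_left (f g : smoothFun U) (w : Grassmann q) :
    tmk (f + g) w = tmk f w + tmk g w := TensorProduct.add_tmul f g w

theorem tmk_add_right (f : smoothFun U) (v w : Grassmann q) :
    tmk f (v + w) = tmk f v + tmk f w := TensorProduct.tmul_add f v w

theorem tmk_sum_left {κ : Type*} (s : Finset κ) (f : κ → smoothFun U) (w : Grassmann q) :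
    tmk (∑ i ∈ s, f i) w = ∑ i ∈ s, tmk (f i) w := TensorProduct.sum_tmul s f w

theorem tmk_sum_right {κ : Type*} (s : Finset κ) (f : smoothFun U) (w : κ → Grassmann q) :
    tmk f (∑ i ∈ s, w i) = ∑ i ∈ s, tmk f (w i) := TensorProduct.tmul_sum f s w

theorem tmk_smul_left (c : ℝ) (f : smoothFun U) (w : Grassmann q) :
    tmk (c • f) w = c • tmk f w := TensorProduct.smul_tmul' c f w

theorem tmk_smul_right (c : ℝ) (f : smoothFun U) (w : Grassmann q) :
    tmk f (c • w) = c • tmk f w := TensorProduct.tmul_smul c f w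

theorem tmk_zero_left (w : Grassmann q) : tmk (0 : smoothFun U) w = 0 :=
  TensorProduct.zero_tmul _ _

theorem tmk_zero_right (f : smoothFun U) : tmk f (0 : Grassmann q) = 0 :=
  TensorProduct.tmul_zero _ _

theorem tmk_one_one : tmk (1 : smoothFun U) (1 : Grassmann q) = 1 := rfl

theorem tmk_algebraMap_one (c : ℝ) :
    tmk (algebraMap ℝ (smoothFun U) c) (1 : Grassmann q) = algebraMap ℝ (DomainFun q U) c := rfl

theorem DomainFun.induction {P : DomainFun q U → Prop} (zero : P 0)
    (tmk : ∀ f w, P (tmk f w)) (add : ∀ s t, P s → P t → P (s + t)) (s : DomainFun q U) : P s :=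
  TensorProduct.induction_on (motive := P) s zero tmk add

theorem tmk_mem (f : smoothFun U) {w : Grassmann q} {k : ZMod 2} (hw : w ∈ grassmannGr q k) :
    tmk f w ∈ domainGr q U k := Submodule.tmul_mem_baseChange_of_mem f hw

/-- The graded piece is the image of `C^∞(U) ⊗ Λ_k`, so pure tensors with homogeneous second factor
suffice. This keeps the parity available in the Leibniz rule for `∂/∂θ_j`. -/
theorem domainGr_induction {k : ZMod 2} {P : DomainFun q U → Prop} (zero : P 0)
    (tmk : ∀ f, ∀ w ∈ grassmannGr q k, P (tmk f w)) (add : ∀ s t, P s → P t → P (s + t))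
    {s : DomainFun q U} (hs : s ∈ domainGr q U k) : P s := by
  obtain ⟨x, hx⟩ := Submodule.toBaseChange_surjective (smoothFun U) (grassmannGr q k) ⟨s, hs⟩
  have hx' : (Submodule.toBaseChange (smoothFun U) (grassmannGr q k) x).1 = s :=
    congrArg Subtype.val hx
  rw [← hx']
  exact TensorProduct.induction_on
    (motive := fun x => P (Submodule.toBaseChange (smoothFun U) (grassmannGr q k) x).1) x
    (by rw [map_zero]; exact zero) (fun f w => tmk f w.1 w.2)
    (fun x y hx hy => by rw [map_add]; exact add _ _ hx hy)

@[simp] theorem dX_tmk (i : Fin p) (f : smoothFun U) (w : Grassmann q) :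
    dX i (tmk f w) = tmk (partialDeriv i f) w := rfl

@[simp] theorem dTheta_tmk (j : Fin q) (f : smoothFun U) (w : Grassmann q) :
    dTheta j (tmk f w) = tmk f (contractTheta j w) := rfl

@[simp] theorem domainRes_tmk (h : V ≤ U) (f : smoothFun U) (w : Grassmann q) :
    domainRes q h (tmk f w) = tmk (smoothRes h f) w := rfl

@[simp] theorem domainEval_tmk (y : U) (f : smoothFun U) (w : Grassmann q) :
    domainEval y (tmk f w) = f.1 y * ExteriorAlgebra.algebraMapInv w := rfl

theorem dX_homogeneous (i : Fin p) :
    IsHomogeneousDerivation (GradedAlgHom.id ℝ (domainGr q U)) 0 (dX i) := by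
  refine ⟨fun j s hs => ?_, fun j s hs t => ?_⟩
  · rw [zero_add]
    exact domainGr_induction (P := fun s => dX i s ∈ domainGr q U j)
      (by rw [map_zero]; exact zero_mem _) (fun f w hw => tmk_mem _ hw)
      (fun s t hs ht => by rw [map_add]; exact add_mem hs ht) hs
  · rw [koszulSign_zero_left, one_smul]
    change dX i (s * t) = dX i s * t + s * dX i t
    clear hs
    induction s using DomainFun.induction with
    | zero => simp
    | add s s' hs hs' => rw [add_mul, map_add, hs, hs', map_add, add_mul, add_mul]; abel
    | tmk f v =>
      induction t using DomainFun.induction with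
      | zero => simp
      | add t t' ht ht' => rw [mul_add, map_add, ht, ht', map_add, mul_add, mul_add]; abel
      | tmk g w =>
        rw [tmk_mul, dX_tmk, partialDeriv_mul, dX_tmk, dX_tmk, tmk_mul, tmk_mul, tmk_add_left]

theorem dTheta_homogeneous (i : Fin q) :
    IsHomogeneousDerivation (GradedAlgHom.id ℝ (domainGr q U)) 1 (dTheta i) := by
  refine ⟨fun j s hs => ?_, fun j s hs t => ?_⟩
  · exact domainGr_induction (P := fun s => dTheta i s ∈ domainGr q U (1 + j))
      (by rw [map_zero]; exact zero_mem _) (fun f w hw => tmk_mem _ (contractTheta_mem i hw))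
      (fun s t hs ht => by rw [map_add]; exact add_mem hs ht) hs
  · change dTheta i (s * t) = dTheta i s * t + koszulSign 1 j • (s * dTheta i t)
    refine domainGr_induction (P := fun s =>
      dTheta i (s * t) = dTheta i s * t + koszulSign 1 j • (s * dTheta i t))
      (by simp) (fun f v hv => ?_) (fun s s' hs hs' => ?_) hs
    · induction t using DomainFun.induction with
      | zero => simp
      | add t t' ht ht' =>
        rw [mul_add, map_add, ht, ht', map_add, mul_add, mul_add, smul_add]
        abel
      | tmk g w =>
        rw [tmk_mul, dTheta_tmk, contractTheta_mul i hv, dTheta_tmk, dTheta_tmk, tmk_mul, tmk_mul,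
          tmk_add_right, tmk_smul_right]
    · rw [add_mul, map_add, hs, hs', map_add, add_mul, add_mul, smul_add]
      abel

theorem domainEval_domainRes (h : V ≤ U) (y : V) (s : DomainFun q U) :
    domainEval y (domainRes q h s) = domainEval (⟨y.1, h y.2⟩ : U) s := by
  induction s using DomainFun.induction with
  | zero => simp
  | add s t hs ht => rw [map_add, map_add, map_add, hs, ht]
  | tmk f w => rfl

theorem continuous_domainEval (s : DomainFun q U) : Continuous fun y : U => domainEval y s := by
  induction s using DomainFun.induction with
  | zero => simpa using continuous_const
  | add s t hs ht =>
    simp only [map_add]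
    exact hs.add ht
  | tmk f w => exact (smoothFun_continuous f).mul continuous_const

/-- Index set of the coordinates of a superdomain of dimension `p|q`. -/
abbrev CoordIndex (p q : ℕ) : Type := Fin p ⊕ Fin q

/-- Parity of the coordinates of a superdomain. -/
def coordParity : CoordIndex p q → ZMod 2 := Sum.elim (fun _ => 0) (fun _ => 1)

/-- The coordinates `x_i, θ_j` of a superdomain. -/
def domainCoord (q : ℕ) (U : Opens (EuclideanSpace ℝ (Fin p))) : CoordIndex p q → DomainFun q U :=
  Sum.elim (fun i => tmk (coordFun U i) 1) (fun j => tmk 1 (theta q j))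

/-- The coordinates `x_i - a_i, θ_j` of a superdomain, centred at `a`. -/
def centredCoord (q : ℕ) (U : Opens (EuclideanSpace ℝ (Fin p))) (a : EuclideanSpace ℝ (Fin p)) :
    CoordIndex p q → DomainFun q U :=
  Sum.elim (fun i => tmk (coordFun U i - algebraMap ℝ (smoothFun U) (a i)) 1)
    (fun j => tmk 1 (theta q j))

/-- The vector fields `∂/∂x_i, ∂/∂θ_j`. -/
def domainFrame (q : ℕ) (U : Opens (EuclideanSpace ℝ (Fin p))) :
    CoordIndex p q → DomainFun q U →ₗ[ℝ] DomainFun q U := Sum.elim dX dTheta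

theorem domainFrame_homogeneous (i : CoordIndex p q) :
    IsHomogeneousDerivation (GradedAlgHom.id ℝ (domainGr q U)) (coordParity i)
      (domainFrame q U i) := by
  cases i with
  | inl i => exact dX_homogeneous i
  | inr j => exact dTheta_homogeneous j

theorem domainFrame_domainRes (i : CoordIndex p q) (h : V ≤ U) (s : DomainFun q U) :
    domainFrame q V i (domainRes q h s) = domainRes q h (domainFrame q U i s) := by
  induction s using DomainFun.induction with
  | zero => simp
  | add s t hs ht => simp only [map_add, hs, ht]
  | tmk f w =>
    cases i with
    | inl i => exact congrArg (tmk · w) (partialDeriv_smoothRes i h f)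
    | inr j => rfl

/-- Derivations kill constants, so centred and uncentred coordinates have the same dual frame. -/
theorem centredCoord_eq (a : EuclideanSpace ℝ (Fin p)) (i : CoordIndex p q) :
    ∃ c : ℝ, centredCoord q U a i = domainCoord q U i - algebraMap ℝ _ c := by
  cases i with
  | inl i =>
    refine ⟨a i, ?_⟩
    rw [← tmk_algebraMap_one]
    exact TensorProduct.sub_tmul _ _ _
  | inr j => exact ⟨0, by rw [map_zero, sub_zero]; rfl⟩

theorem domainRes_domainCoord (h : V ≤ U) (i : CoordIndex p q) :
    domainRes q h (domainCoord q U i) = domainCoord q V i := by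
  cases i <;> rfl

theorem centredCoord_mem (a : EuclideanSpace ℝ (Fin p)) (i : CoordIndex p q) :
    centredCoord q U a i ∈ domainGr q U (coordParity i) := by
  cases i with
  | inl i => exact tmk_mem _ (SetLike.one_mem_graded (grassmannGr q))
  | inr j => exact tmk_mem _ (theta_mem j)

theorem domainFrame_domainCoord (i j : CoordIndex p q) :
    domainFrame q U i (domainCoord q U j) = if i = j then 1 else 0 := by
  cases i with
  | inl i =>
    cases j with
    | inl j =>
      change tmk (partialDeriv i (coordFun U j)) 1 = _
      rw [partialDeriv_coordFun]
      by_cases h : i = j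
      · simp [h, tmk_one_one]
      · simp [h, tmk_zero_left]
    | inr j =>
      change tmk (partialDeriv i 1) _ = _
      rw [partialDeriv_one, tmk_zero_left, if_neg (by simp)]
  | inr i =>
    cases j with
    | inl j =>
      change tmk _ (contractTheta i 1) = _
      rw [contractTheta, CliffordAlgebra.contractLeft_one, tmk_zero_right, if_neg (by simp)]
    | inr j =>
      change tmk 1 (contractTheta i (theta q j)) = _
      rw [contractTheta_theta]
      by_cases h : i = j
      · simp [h, tmk_one_one]
      · simp [h, tmk_zero_right]

theorem domainFrame_centredCoord (a : EuclideanSpace ℝ (Fin p)) (i j : CoordIndex p q) :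
    domainFrame q U i (centredCoord q U a j) = if i = j then 1 else 0 := by
  obtain ⟨c, hc⟩ := centredCoord_eq (U := U) a j
  rw [hc, map_sub, (domainFrame_homogeneous i).map_algebraMap, sub_zero, domainFrame_domainCoord]

theorem domainEval_centredCoord (a : U) (i : CoordIndex p q) :
    domainEval a (centredCoord q U a.1 i) = 0 := by
  cases i with
  | inl i =>
    change (a.1 i - a.1 i) * _ = _
    rw [sub_self, zero_mul]
  | inr j =>
    change (1 : ℝ) * ExteriorAlgebra.algebraMapInv (ExteriorAlgebra.ι ℝ _) = 0
    simp [ExteriorAlgebra.algebraMapInv]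

/-- First order expansion of sections on a superdomain. -/
theorem exists_domain_expansion (a : U) (s : DomainFun q U) :
    ∃ g : CoordIndex p q → DomainFun q U,
      s = algebraMap ℝ _ (domainEval a s) + ∑ i, centredCoord q U a.1 i * g i := by
  induction s using DomainFun.induction with
  | zero => exact ⟨0, by simp⟩
  | add s t hs ht =>
    obtain ⟨g, hg⟩ := hs
    obtain ⟨g', hg'⟩ := ht
    refine ⟨g + g', ?_⟩
    simp only [map_add, Pi.add_apply, mul_add, Finset.sum_add_distrib]
    conv_lhs => rw [hg, hg']
    abel
  | tmk f w =>
    obtain ⟨v, hv⟩ := exists_grassmann_expansion w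
    obtain ⟨g, hg⟩ := exists_hadamard a f
    set c : ℝ := ExteriorAlgebra.algebraMapInv w with hc
    refine ⟨Sum.elim (fun i => c • tmk (g i) 1) (fun j => tmk f (v j)), ?_⟩
    have h1 : tmk f w = c • tmk f 1 + ∑ j, tmk 1 (theta q j) * tmk f (v j) := by
      conv_lhs => rw [hv]
      rw [tmk_add_right, tmk_sum_right, Algebra.algebraMap_eq_smul_one, tmk_smul_right]
      simp only [tmk_mul, one_mul]
    have h2 : tmk f (1 : Grassmann q) = algebraMap ℝ _ (f.1 a) + ∑ i, tmk (coordFun U i -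
        algebraMap ℝ (smoothFun U) (a.1 i)) 1 * tmk (g i) 1 := by
      conv_lhs => rw [hg]
      rw [tmk_add_left, tmk_sum_left, tmk_algebraMap_one]
      simp only [tmk_mul, one_mul]
    rw [domainEval_tmk, h1, h2, Fintype.sum_sum_type, smul_add, add_assoc, Finset.smul_sum]
    congr 1
    · rw [mul_comm, map_mul, Algebra.smul_def]
    · simp only [Sum.elim_inl, Sum.elim_inr, mul_smul_comm]
      rfl

/-- The coordinates centred at `a` form a coordinate system along every morphism over `a`. -/
theorem isCoordinateSystem_domain {S : Type*} [Ring S] [Algebra ℝ S] {ℬ : ZMod 2 → Submodule ℝ S}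
    [GradedAlgebra ℬ] (φ : domainGr q U →ₐᵍ[ℝ] ℬ) {J : Submodule ℝ S} (a : U)
    (h : ∀ i, φ (centredCoord q U a.1 i) ∈ J) :
    IsCoordinateSystem φ J coordParity (centredCoord q U a.1) where
  mem := centredCoord_mem a.1
  map_mem := h
  exists_expansion s := by
    obtain ⟨g, hg⟩ := exists_domain_expansion a s
    exact ⟨_, g, 0, by rw [add_zero]; exact hg, 1, SetLike.one_mem_graded _, mul_zero _,
      by rw [map_one]; exact isUnit_one⟩

/-- Duality holds for every centre `a`; the position of `a` matters only for the images of the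
coordinates to be nilpotent. -/
theorem isDualFrame_domain {S : Type*} [Ring S] [Algebra ℝ S] {ℬ : ZMod 2 → Submodule ℝ S}
    [GradedAlgebra ℬ] (φ : domainGr q U →ₐᵍ[ℝ] ℬ) (a : EuclideanSpace ℝ (Fin p)) :
    IsDualFrame φ coordParity (centredCoord q U a)
      fun i => φ.toAlgHom.toLinearMap ∘ₗ domainFrame q U i where
  homogeneous i := (domainFrame_homogeneous i).comp_left φ (fun _ => rfl) (fun _ => rfl)
  apply_coord i j := by
    change φ (domainFrame q U i (centredCoord q U a j)) = _
    rw [domainFrame_centredCoord, apply_ite φ, map_one, map_zero]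

/-! ### Grassmann points of a superdomain -/

/-- The algebra morphism `f ⊗ w ↦ f(y) w` to the Grassmann algebra. -/
def grassmannEvalHom (q : ℕ) (y : U) : DomainFun q U →ₐ[ℝ] Grassmann q :=
  Algebra.TensorProduct.lift ((Algebra.ofId ℝ (Grassmann q)).comp
    ((Pi.evalAlgHom ℝ (fun _ : U => ℝ) y).comp (smoothFun U).val)) (AlgHom.id ℝ (Grassmann q))
    (fun f _ => Algebra.commutes (f.1 y) _)

theorem grassmannEvalHom_tmk (y : U) (f : smoothFun U) (w : Grassmann q) :
    grassmannEvalHom q y (tmk f w) = f.1 y • w := (Algebra.smul_def (f.1 y) w).symm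

/-- The morphism `f ⊗ w ↦ f(y) w` of superalgebras to the Grassmann algebra. -/
def grassmannEval (q : ℕ) (y : U) : domainGr q U →ₐᵍ[ℝ] grassmannGr q where
  __ := grassmannEvalHom q y
  map_mem {k s} hs :=
    domainGr_induction (P := fun s => grassmannEvalHom q y s ∈ grassmannGr q k)
      (by rw [map_zero]; exact zero_mem _)
      (fun f w hw => by rw [grassmannEvalHom_tmk]; exact Submodule.smul_mem _ _ hw)
      (fun s t hs ht => by rw [map_add]; exact add_mem hs ht) hs

theorem grassmannEval_tmk (y : U) (f : smoothFun U) (w : Grassmann q) :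
    grassmannEval q y (tmk f w) = f.1 y • w := grassmannEvalHom_tmk y f w

/-- The centred even coordinates go to 0 and the odd ones to generators, so a Grassmann point has
nilpotent coordinates and the expansion argument applies along it. -/
theorem grassmannEval_centredCoord_mem (y : U) (i : CoordIndex p q) :
    grassmannEval q y (centredCoord q U y.1 i) ∈
      LinearMap.range (ExteriorAlgebra.ι ℝ : (Fin q → ℝ) →ₗ[ℝ] Grassmann q) := by
  cases i with
  | inl i =>
    have : grassmannEval q y (centredCoord q U y.1 (Sum.inl i)) = 0 := by
      refine (grassmannEval_tmk y _ _).trans ?_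
      change (y.1 i - y.1 i) • _ = _
      rw [sub_self, zero_smul]
    rw [this]
    exact zero_mem _
  | inr j =>
    have : grassmannEval q y (centredCoord q U y.1 (Sum.inr j)) = theta q j :=
      (grassmannEval_tmk y _ _).trans (one_smul ℝ _)
    rw [this]
    exact ⟨_, rfl⟩

/-- A section of a superdomain is determined by its Grassmann points. -/
theorem eq_zero_of_grassmannEval {s : DomainFun q U} (h : ∀ y : U, grassmannEval q y s = 0) :
    s = 0 := by
  classical
  let b := Module.Basis.ofVectorSpace ℝ (Grassmann q)
  -- A section is a family of smooth coefficients with respect to a basis of Λ; its Grassmann point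
  -- at `y` lists their values at `y`.
  let e := TensorProduct.equivFinsuppOfBasisRight (M := smoothFun U) b
  have key : ∀ (s : DomainFun q U) (y : U) i, (e s i).1 y = b.repr (grassmannEval q y s) i := by
    intro s y i
    induction s using DomainFun.induction with
    | zero =>
      rw [map_zero, map_zero, Finsupp.zero_apply]
      exact congrArg (fun f : _ →₀ smoothFun U => (f i).1 y) (map_zero e)
    | add s t hs ht =>
      rw [map_add, map_add, Finsupp.add_apply, ← hs, ← ht]
      exact congrArg (fun f : _ →₀ smoothFun U => (f i).1 y) (map_add e s t)
    | tmk f w =>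
      rw [grassmannEval_tmk, map_smul, Finsupp.smul_apply]
      have h1 : e (tmk f w) i = b.repr w i • f :=
        TensorProduct.equivFinsuppOfBasisRight_apply_tmul_apply b f w i
      rw [h1]
      exact mul_comm _ _
  have h0 : e s = 0 := by
    ext i : 1
    exact smoothFun_ext fun y => by rw [key, h y, map_zero]; rfl
  exact (LinearEquiv.map_eq_zero_iff e).mp h0

end DomainFun

/-! ### Derivations on superdomains -/

section DomainDerivations

variable {p q : ℕ} {U : Opens (EuclideanSpace ℝ (Fin p))} {A : Type*} [Ring A] [Algebra ℝ A]
  {𝒜 : ZMod 2 → Submodule ℝ A} [GradedAlgebra 𝒜]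

theorem coordDerivation_eq_sum (xA : domainGr q U →ₐᵍ[ℝ] 𝒜) (f : Fin p → A) (F : Fin q → A) :
    coordDerivation xA f F =
      ∑ i, (Sum.elim f F i) • (xA.toAlgHom.toLinearMap ∘ₗ domainFrame q U i) := by
  rw [Fintype.sum_sum_type]
  rfl

variable [SuperWeilAlgebra 𝒜]

/-- The base point of an `A`-point of a superdomain. -/
theorem exists_domain_basePoint (xA : domainGr q U →ₐᵍ[ℝ] 𝒜) :
    ∃ a : U, ∀ i, xA (centredCoord q U a.1 i) ∈ nilSubmodule 𝒜 := by
  let χ : DomainFun q U →ₐ[ℝ] ℝ := (augmentation 𝒜).comp xA.toAlgHom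
  let χ' : smoothFun U →ₐ[ℝ] ℝ :=
    χ.comp (Algebra.TensorProduct.includeLeft : smoothFun U →ₐ[ℝ] smoothFun U ⊗[ℝ] Grassmann q)
  -- The only candidate: the character dictates the coordinates of the base point.
  let a : EuclideanSpace ℝ (Fin p) := WithLp.toLp 2 fun i => χ' (coordFun U i)
  have ha : ∀ i, χ' (coordFun U i - algebraMap ℝ (smoothFun U) (a i)) = 0 := fun i => by
    rw [map_sub, AlgHom.commutes]
    exact sub_self _
  -- If `a` lay outside `U`, then `∑ (x_i - a_i)²` would be invertible on `U`, although the
  -- character kills it.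
  have haU : a ∈ U := by
    by_contra hn
    let r : smoothFun U :=
      ∑ i, (coordFun U i - algebraMap ℝ _ (a i)) * (coordFun U i - algebraMap ℝ _ (a i))
    have hr : ∀ y : U, r.1 y = ∑ i, (y.1 i - a i) * (y.1 i - a i) := fun y => by
      simp only [r]
      rw [AddSubmonoidClass.coe_finsetSum, Finset.sum_apply]
      rfl
    have hne : ∀ y ∈ U, ∑ i, (y i - a i) * (y i - a i) ≠ 0 := fun y hy =>
      sum_sq_sub_ne_zero fun h => hn (h ▸ hy)
    let r' : smoothFun U := smoothMk U (fun y => (∑ i, (y i - a i) * (y i - a i))⁻¹)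
      ((contDiff_sum_sq_sub a).contDiffOn.inv hne)
    have h1 : r * r' = 1 := smoothFun_ext fun y => by
      change r.1 y * (∑ i, (y.1 i - a i) * (y.1 i - a i))⁻¹ = 1
      rw [hr, mul_inv_cancel₀ (hne y.1 y.2)]
    have h2 := congrArg χ' h1
    rw [map_mul, map_one] at h2
    have h3 : χ' r = 0 := by
      simp only [r]
      rw [map_sum]
      exact Finset.sum_eq_zero fun i _ => by rw [map_mul, ha, zero_mul]
    rw [h3, zero_mul] at h2
    exact zero_ne_one h2
  refine ⟨⟨a, haU⟩, fun i => ?_⟩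
  refine augmentation_eq_zero_iff.mp ?_
  cases i with
  | inl i => exact ha i
  | inr j =>
    exact augmentation_eq_zero_of_odd (Graded.map_mem xA (centredCoord_mem a (Sum.inr j)))

/-- Centring the coordinates at the base point makes their images nilpotent. The coefficients of a
derivation are then its values on the centred coordinates. -/
theorem superdomain_derivations (xA : domainGr q U →ₐᵍ[ℝ] 𝒜) :
    (∀ (f : Fin p → A) (F : Fin q → A), coordDerivation xA f F ∈ Der xA) ∧
    (∀ (f : Fin p → A) (F : Fin q → A) (k : ZMod 2),
      IsHomogeneousDerivation xA k (coordDerivation xA f F) ↔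
        (∀ i, f i ∈ 𝒜 k) ∧ (∀ j, F j ∈ 𝒜 (k + 1))) ∧
    (∀ Y ∈ Der xA, ∃! fF : (Fin p → A) × (Fin q → A),
      ∀ s : DomainFun q U, Y s =
        ∑ i, fF.1 i * xA (dX i s) + ∑ j, fF.2 j * xA (dTheta j s)) := by
  obtain ⟨a, ha⟩ := exists_domain_basePoint xA
  have ht := isCoordinateSystem_domain xA a ha
  have hE := isDualFrame_domain xA a.1
  have hJ := nilSubmodule_isNilpotent 𝒜
  have happ : ∀ (f : Fin p → A) (F : Fin q → A) (s : DomainFun q U),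
      coordDerivation xA f F s =
        ∑ i, f i * xA (dX i s) + ∑ j, F j * xA (dTheta j s) := fun f F s => by
    rw [coordDerivation, LinearMap.add_apply, LinearMap.sum_apply, LinearMap.sum_apply]
    rfl
  refine ⟨fun f F => ?_, fun f F k => ?_, fun Y hY => ?_⟩
  · rw [coordDerivation_eq_sum]
    exact hE.sum_smul_mem_der _
  · rw [coordDerivation_eq_sum, hE.homogeneous_sum_smul_iff ht, Sum.forall]
    simp [coordParity]
  · have h := hE.eq_sum_smul ht hJ hY
    refine ⟨(fun i => Y (centredCoord q U a.1 (Sum.inl i)),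
      fun j => Y (centredCoord q U a.1 (Sum.inr j))), fun s => ?_, fun fF hfF => ?_⟩
    · rw [← happ, coordDerivation_eq_sum]
      conv_lhs => rw [h]
      congr 2
      funext i
      cases i <;> rfl
    · have h1 : Y = ∑ i, (Sum.elim fF.1 fF.2 i) •
          (xA.toAlgHom.toLinearMap ∘ₗ domainFrame q U i) := by
        rw [← coordDerivation_eq_sum]
        ext s
        rw [happ, hfF]
      refine Prod.ext (funext fun i => ?_) (funext fun j => ?_)
      · simp only
        rw [h1, hE.sum_smul_apply, Sum.elim_inl]
      · simp only
        rw [h1, hE.sum_smul_apply, Sum.elim_inr]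

end DomainDerivations

/-! ### Gluing sections -/

namespace SuperSheaf

variable {X : Type u} [TopologicalSpace X] (M : SuperSheaf.{u, v} X)

/-- Both sections glue the same compatible family of local restrictions, so uniqueness of gluing
identifies them. -/
theorem eq_of_locally_eq {T : Opens X} {s t : M.obj T}
    (h : ∀ x ∈ T, ∃ (V : Opens X) (_ : x ∈ V) (hV : V ≤ T), M.res hV s = M.res hV t) : s = t := by
  choose! V hxV hVT hres using h
  let U : T → Opens X := fun x => V x.1
  have hU : iSup U ≤ T := iSup_le fun x => hVT x.1 x.2
  have hT : T ≤ iSup U := fun x hx => Opens.mem_iSup.mpr ⟨⟨x, hx⟩, hxV x hx⟩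
  have key := (M.glue U (fun x => M.res (hVT x.1 x.2) s)
    (fun i j => by rw [M.res_res, M.res_res])).unique
    (y₁ := M.res hU s) (y₂ := M.res hU t) (fun i => M.res_res _ _ _)
    (fun i => by rw [M.res_res]; exact (hres i.1 i.2).symm)
  have := congrArg (M.res hT) key
  rwa [M.res_res, M.res_res, M.res_self, M.res_self] at this

theorem exists_glue {ι : Type u} (U : ι → Opens X) {T : Opens X} (hT : T ≤ iSup U)
    (s : ∀ i, M.obj (U i)) (hs : ∀ i j, M.res (inf_le_left : U i ⊓ U j ≤ U i) (s i) =
      M.res (inf_le_right : U i ⊓ U j ≤ U j) (s j)) :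
    ∃ t : M.obj T, ∀ i (h : U i ≤ T), M.res h t = s i := by
  obtain ⟨t, ht, -⟩ := M.glue U s hs
  exact ⟨M.res hT t, fun i h => by rw [M.res_res]; exact ht i⟩

/-- Extension of a section by zero. -/
theorem exists_extend_zero {U W : Opens X} (h : ⊤ ≤ U ⊔ W) (s : M.obj U)
    (hs : M.res (inf_le_left : U ⊓ W ≤ U) s = 0) :
    ∃ t : M.obj ⊤, M.res le_top t = s ∧ M.res (le_top : W ≤ ⊤) t = 0 := by
  -- The two-element cover (`true` for `U`, `false` for `W`) is lifted because gluing is indexed by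
  -- types in the universe of `X`.
  let U' : ULift.{u} Bool → Opens X := fun b => Bool.rec W U b.down
  let s' : ∀ b, M.obj (U' b) := fun b =>
    Bool.rec (motive := fun b => M.obj (U' ⟨b⟩)) (0 : M.obj W) s b.down
  have hU' : (⊤ : Opens X) ≤ iSup U' :=
    h.trans (sup_le (le_iSup U' ⟨true⟩) (le_iSup U' ⟨false⟩))
  have hswap : M.res (inf_le_right : W ⊓ U ≤ U) s = 0 := by
    have h1 : W ⊓ U ≤ U ⊓ W := by rw [inf_comm]
    have := congrArg (M.res h1) hs
    rwa [M.res_res, map_zero] at this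
  obtain ⟨t, ht⟩ := M.exists_glue U' hU' s' (by
    rintro ⟨_ | _⟩ ⟨_ | _⟩
    · rfl
    · exact (map_zero _).trans hswap.symm
    · exact hs.trans (map_zero _).symm
    · rfl)
  exact ⟨t, ht ⟨true⟩ le_top, ht ⟨false⟩ le_top⟩

/-- Restriction between equal open sets. -/
def resEquiv {V W : Opens X} (h : V ≤ W) (h' : W ≤ V) : M.obj V ≃ₐ[ℝ] M.obj W :=
  AlgEquiv.ofAlgHom (M.res h').toAlgHom (M.res h).toAlgHom
    (AlgHom.ext fun s => (M.res_res h h' s).trans (M.res_self s))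
    (AlgHom.ext fun s => (M.res_res h' h s).trans (M.res_self s))

end SuperSheaf

/-! ### Charts -/

namespace SuperChart

variable {X : Type u} [TopologicalSpace X] {M : SuperSheaf.{u, v} X} {p q : ℕ}
  (c : SuperChart M p q)

/-- The domain of a chart. -/
def dom : Opens X := ⟨c.toHomeo.source, c.toHomeo.open_source⟩

theorem mem_source {x : X} (hx : x ∈ c.dom) : x ∈ c.toHomeo.source := hx

/-- The image of an open subset of the domain of a chart. -/
def image (V : Opens X) : Opens (EuclideanSpace ℝ (Fin p)) := chartPreimage c.toHomeo.symm V

variable {V W : Opens X}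

theorem image_subset (V : Opens X) : (c.image V : Set _) ⊆ c.toHomeo.target := fun _ h => h.1

theorem image_mono (h : V ≤ W) : c.image V ≤ c.image W := chartPreimage_mono _ h

theorem mem_image {x : X} (hx : x ∈ V) (hV : V ≤ c.dom) : c.toHomeo x ∈ c.image V := by
  refine ⟨c.toHomeo.map_source (hV hx), ?_⟩
  change c.toHomeo.symm (c.toHomeo x) ∈ V
  rwa [c.toHomeo.left_inv (hV hx)]

theorem preimage_image_le : chartPreimage c.toHomeo (c.image V) ≤ V := fun x hx => by
  have h : c.toHomeo.symm (c.toHomeo x) ∈ V := hx.2.2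
  rwa [c.toHomeo.left_inv hx.1] at h

theorem le_preimage_image (hV : V ≤ c.dom) : V ≤ chartPreimage c.toHomeo (c.image V) :=
  fun _ hx => ⟨hV hx, c.mem_image hx hV⟩

/-- The isomorphism of sections over an open subset `V` of the domain of a chart. -/
def coordIso (hV : V ≤ c.dom) : M.obj V ≃ₐ[ℝ] DomainFun q (c.image V) :=
  (M.resEquiv (c.le_preimage_image hV) c.preimage_image_le).trans
    (c.iso (c.image V) (c.image_subset V))

theorem coordIso_apply (hV : V ≤ c.dom) (s : M.obj V) : c.coordIso hV s =
    c.iso (c.image V) (c.image_subset V) (M.res c.preimage_image_le s) := rfl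

theorem coordIso_mem_iff (hV : V ≤ c.dom) {s : M.obj V} {k : ZMod 2} :
    c.coordIso hV s ∈ domainGr q (c.image V) k ↔ s ∈ M.gr V k := by
  rw [coordIso_apply, c.iso_mem]
  refine ⟨fun h => ?_, fun h => Graded.map_mem (M.res c.preimage_image_le) h⟩
  have := Graded.map_mem (M.res (c.le_preimage_image hV)) h
  rwa [M.res_res, M.res_self] at this

theorem coordIso_res (hW : W ≤ c.dom) (h : V ≤ W) (s : M.obj W) :
    c.coordIso (h.trans hW) (M.res h s) = domainRes q (c.image_mono h) (c.coordIso hW s) := by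
  rw [coordIso_apply, coordIso_apply, ← c.iso_res _ _ _ (c.image_subset V), M.res_res, M.res_res]

theorem coordIso_symm_mem (hV : V ≤ c.dom) {f : DomainFun q (c.image V)} {k : ZMod 2}
    (hf : f ∈ domainGr q (c.image V) k) : (c.coordIso hV).symm f ∈ M.gr V k := by
  rw [← c.coordIso_mem_iff hV, AlgEquiv.apply_symm_apply]
  exact hf

theorem res_coordIso_symm (hW : W ≤ c.dom) (h : V ≤ W) (f : DomainFun q (c.image W)) :
    M.res h ((c.coordIso hW).symm f) =
      (c.coordIso (h.trans hW)).symm (domainRes q (c.image_mono h) f) := by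
  rw [AlgEquiv.eq_symm_apply, c.coordIso_res hW, AlgEquiv.apply_symm_apply]

/-- The chart isomorphism as a morphism of superalgebras. -/
def toDomain (hV : V ≤ c.dom) : M.gr V →ₐᵍ[ℝ] domainGr q (c.image V) where
  __ := (c.coordIso hV).toAlgHom
  map_mem hs := (c.coordIso_mem_iff hV).mpr hs

/-- The inverse of the chart isomorphism as a morphism of superalgebras. -/
def ofDomain (hV : V ≤ c.dom) : domainGr q (c.image V) →ₐᵍ[ℝ] M.gr V where
  __ := (c.coordIso hV).symm.toAlgHom
  map_mem hs := c.coordIso_symm_mem hV hs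

/-- The reduced value at a point of the domain of a chart. -/
def value (hV : V ≤ c.dom) {x : X} (hx : x ∈ V) : M.obj V →ₐ[ℝ] ℝ :=
  (domainEval ⟨c.toHomeo x, c.mem_image hx hV⟩).comp (c.coordIso hV).toAlgHom

theorem value_apply (hV : V ≤ c.dom) {x : X} (hx : x ∈ V) (s : M.obj V) :
    c.value hV hx s = domainEval ⟨c.toHomeo x, c.mem_image hx hV⟩ (c.coordIso hV s) := rfl

theorem value_res (hW : W ≤ c.dom) (h : V ≤ W) {x : X} (hx : x ∈ V) (s : M.obj W) :
    c.value (h.trans hW) hx (M.res h s) = c.value hW (h hx) s := by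
  rw [value_apply, value_apply, c.coordIso_res, domainEval_domainRes]

theorem eval_eq_value {x : X} (hx : x ∈ c.dom) (s : M.obj ⊤) :
    c.eval (c.mem_source hx) s = c.value le_rfl hx (M.res le_top s) := by
  have h1 : c.image c.dom ≤ ⟨c.toHomeo.target, c.toHomeo.open_target⟩ := c.image_subset _
  have h2 := c.iso_res ⟨c.toHomeo.target, c.toHomeo.open_target⟩ subset_rfl _
    (c.image_subset c.dom) h1 (M.res le_top s)
  rw [M.res_res] at h2
  rw [value_apply, coordIso_apply, M.res_res, h2, domainEval_domainRes]
  rfl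

theorem eval_eq_value_of_le (hV : V ≤ c.dom) {x : X} (hx : x ∈ V) (s : M.obj ⊤) :
    c.eval (c.mem_source (hV hx)) s = c.value hV hx (M.res le_top s) := by
  rw [c.eval_eq_value (hV hx), ← c.value_res le_rfl hV hx, M.res_res]

/-- The reduced value only depends on the germ. -/
theorem eval_congr {x : X} (hx : x ∈ c.dom) {s t : M.obj ⊤} {V : Opens X} (hxV : x ∈ V)
    (h : M.res (le_top : V ≤ ⊤) s = M.res le_top t) :
    c.eval (c.mem_source hx) s = c.eval (c.mem_source hx) t := by
  have h1 : V ⊓ c.dom ≤ V := inf_le_left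
  have h2 := congrArg (M.res h1) h
  rw [M.res_res, M.res_res] at h2
  have := c.eval_eq_value_of_le (inf_le_right : V ⊓ c.dom ≤ c.dom) ⟨hxV, hx⟩
  rw [this, this, h2]

/-- Bump functions on the domain of a chart. -/
theorem exists_bump [T2Space X] {x : X} (hx : x ∈ c.dom) {U : Opens X} (hxU : x ∈ U) :
    ∃ ρ ∈ M.gr ⊤ 0, ∃ V W : Opens X, x ∈ V ∧ V ≤ U ∧ ⊤ ≤ U ⊔ W ∧
      M.res (le_top : V ≤ ⊤) ρ = 1 ∧ M.res (le_top : W ≤ ⊤) ρ = 0 := by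
  have hmem : c.toHomeo x ∈ c.image (U ⊓ c.dom) := c.mem_image ⟨hxU, hx⟩ inf_le_right
  obtain ⟨b, hb⟩ := exists_contDiffBump hmem
  -- The Hausdorff property enters here: the image of the closed ball is compact, hence closed in
  -- `X`, so its complement `W` is open and the bump extends by zero.
  have hcomp : IsCompact (c.toHomeo.symm '' Metric.closedBall (c.toHomeo x) b.rOut) :=
    (isCompact_closedBall _ _).image_of_continuousOn
      (c.toHomeo.continuousOn_symm.mono fun y hy => (hb hy).1)
  let W : Opens X := ⟨(c.toHomeo.symm '' Metric.closedBall (c.toHomeo x) b.rOut)ᶜ,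
    hcomp.isClosed.isOpen_compl⟩
  let V : Opens X := chartPreimage c.toHomeo ⟨Metric.ball (c.toHomeo x) b.rIn,
    Metric.isOpen_ball⟩ ⊓ (U ⊓ c.dom)
  have hVd : V ≤ c.dom := inf_le_right.trans inf_le_right
  have hcov : ∀ y, y ∈ U ⊓ c.dom ∨ y ∈ W := fun y => by
    by_cases h : y ∈ W
    · exact Or.inr h
    · obtain ⟨z, hz, rfl⟩ := not_not.mp h
      exact Or.inl (hb hz).2
  let f : DomainFun q (c.image c.dom) :=
    tmk (smoothMk (c.image c.dom) b b.contDiff.contDiffOn) 1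
  have hzero : M.res (inf_le_left : c.dom ⊓ W ≤ c.dom) ((c.coordIso le_rfl).symm f) = 0 := by
    rw [c.res_coordIso_symm le_rfl, EmbeddingLike.map_eq_zero_iff]
    have : smoothRes (c.image_mono (inf_le_left : c.dom ⊓ W ≤ c.dom))
        (smoothMk (c.image c.dom) b b.contDiff.contDiffOn) = 0 := smoothFun_ext fun y => by
      change b y.1 = 0
      refine b.zero_of_le_dist (not_lt.mp fun hlt => ?_)
      exact y.2.2.2 ⟨y.1, Metric.mem_closedBall.mpr hlt.le, rfl⟩
    rw [domainRes_tmk, this, tmk_zero_left]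
  obtain ⟨t, ht, htW⟩ := M.exists_extend_zero (fun y _ => (hcov y).imp_left fun h => h.2) _ hzero
  -- Restrictions preserve the grading, so the even part of `t` still restricts to 1 on `V` and to 0
  -- on `W`.
  refine ⟨(DirectSum.decompose (M.gr ⊤) t 0 : M.obj ⊤), SetLike.coe_mem _, V, W,
    ⟨⟨hx, Metric.mem_ball_self b.rIn_pos⟩, hxU, hx⟩, inf_le_right.trans inf_le_left,
    fun y _ => (hcov y).imp_left fun h => h.1, ?_, ?_⟩
  · have h1 : M.res (le_top : V ≤ ⊤) t = 1 := by
      rw [← M.res_res le_top hVd, ht, c.res_coordIso_symm le_rfl, AlgEquiv.symm_apply_eq, map_one]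
      have : smoothRes (c.image_mono hVd)
          (smoothMk (c.image c.dom) b b.contDiff.contDiffOn) = 1 := smoothFun_ext fun y => by
        change b y.1 = 1
        refine b.one_of_mem_closedBall (Metric.ball_subset_closedBall ?_)
        have h3 : c.toHomeo (c.toHomeo.symm y.1) ∈ Metric.ball (c.toHomeo x) b.rIn := y.2.2.1.2
        rwa [c.toHomeo.right_inv y.2.1] at h3
      rw [domainRes_tmk, this, tmk_one_one]
    rw [map_decompose_apply, h1, DirectSum.decompose_of_mem_same _ (SetLike.one_mem_graded _)]
  · rw [map_decompose_apply, htW, DirectSum.decompose_zero]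
    rfl

end SuperChart

/-! ### Global sections of supermanifolds -/

namespace Supermanifold

variable {X : Type u} [TopologicalSpace X] [T2Space X] {p q : ℕ} (M : Supermanifold.{u, v} X p q)

theorem exists_bump {x : X} {U : Opens X} (hxU : x ∈ U) :
    ∃ ρ ∈ M.gr ⊤ 0, ∃ V W : Opens X, x ∈ V ∧ V ≤ U ∧ ⊤ ≤ U ⊔ W ∧
      M.res (le_top : V ≤ ⊤) ρ = 1 ∧ M.res (le_top : W ≤ ⊤) ρ = 0 := by
  obtain ⟨c, hc⟩ := M.exists_chart x
  exact c.exists_bump hc hxU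

/-- Every germ is the germ of a global section. -/
theorem exists_extension {x : X} {U : Opens X} (hxU : x ∈ U) (s : M.obj U) :
    ∃ (t : M.obj ⊤) (V : Opens X) (_ : x ∈ V) (hV : V ≤ U),
      M.res le_top t = M.res hV s := by
  obtain ⟨ρ, -, V, W, hxV, hVU, hUW, hV, hW⟩ := M.exists_bump hxU
  -- The section `s` itself need not extend; `ρ * s` extends by zero and agrees with `s` where `ρ =
  -- 1`.
  obtain ⟨t, ht, -⟩ := M.exists_extend_zero hUW (M.res le_top ρ * s) (by
    have h1 : U ⊓ W ≤ W := inf_le_right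
    have := congrArg (M.res h1) hW
    rw [M.res_res, map_zero] at this
    rw [map_mul, M.res_res, this, zero_mul])
  refine ⟨t, V, hxV, hVU, ?_⟩
  rw [← M.res_res le_top hVU, ht, map_mul, M.res_res, hV, one_mul]

/-- Every germ of a homogeneous section is the germ of a homogeneous global section. -/
theorem exists_homogeneous_extension {x : X} {U : Opens X} (hxU : x ∈ U) {s : M.obj U}
    {k : ZMod 2} (hs : s ∈ M.gr U k) :
    ∃ t ∈ M.gr ⊤ k, ∃ (V : Opens X) (_ : x ∈ V) (hV : V ≤ U), M.res le_top t = M.res hV s := by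
  obtain ⟨t, V, hxV, hV, h⟩ := M.exists_extension hxU s
  refine ⟨(DirectSum.decompose (M.gr ⊤) t k : M.obj ⊤), SetLike.coe_mem _, V, hxV, hV, ?_⟩
  rw [map_decompose_apply, h, DirectSum.decompose_of_mem_same _ (Graded.map_mem (M.res hV) hs)]

/-- A section that vanishes near `x` is annihilated by a bump function at `x`. -/
theorem exists_bump_mul_eq_zero {x : X} {V : Opens X} (hxV : x ∈ V) {s : M.obj ⊤}
    (hs : M.res (le_top : V ≤ ⊤) s = 0) :
    ∃ ρ ∈ M.gr ⊤ 0, ρ * s = 0 ∧ ∃ V' : Opens X, x ∈ V' ∧ M.res (le_top : V' ≤ ⊤) ρ = 1 := by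
  obtain ⟨ρ, hρ, V', W, hxV', -, hVW, h1, h0⟩ := M.exists_bump hxV
  refine ⟨ρ, hρ, M.eq_of_locally_eq fun y _ => ?_, V', hxV', h1⟩
  rcases hVW (Opens.mem_top y) with hy | hy
  · exact ⟨V, hy, le_top, by rw [map_mul, hs, mul_zero, map_zero]⟩
  · exact ⟨W, hy, le_top, by rw [map_mul, h0, zero_mul, map_zero]⟩

end Supermanifold

/-! ### Nilpotent and invertible sections -/

/-- Split each `h j` by parity. The odd parts give even, hence central, products of square zero; the
even parts add up to one odd element, also of square zero. Sums of commuting nilpotents are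
nilpotent. -/
theorem isNilpotent_sum_odd_mul {R : Type*} [Ring R] [Algebra ℝ R] (𝒜 : ZMod 2 → Submodule ℝ R)
    [GradedAlgebra 𝒜] [IsSuperCommutative 𝒜] {κ : Type*} [Fintype κ] {o h : κ → R}
    (ho : ∀ j, o j ∈ 𝒜 1) : IsNilpotent (∑ j, o j * h j) := by
  let h0 : κ → R := fun j => DirectSum.decompose 𝒜 (h j) 0
  let h1 : κ → R := fun j => DirectSum.decompose 𝒜 (h j) 1
  have hh : ∀ j, h j = h0 j + h1 j := fun j => decompose_zero_add_one (𝒜 := 𝒜) (h j)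
  have hodd : ∑ j, o j * h0 j ∈ 𝒜 1 := Submodule.sum_mem _ fun j _ => by
    have := SetLike.mul_mem_graded (ho j) (SetLike.coe_mem (DirectSum.decompose 𝒜 (h j) 0))
    rwa [add_zero] at this
  have heven : ∀ j, o j * h1 j ∈ 𝒜 0 := fun j => by
    have := SetLike.mul_mem_graded (ho j) (SetLike.coe_mem (DirectSum.decompose 𝒜 (h j) 1))
    rwa [zmod_two_add_self] at this
  have hsq : ∀ j, IsNilpotent (o j * h1 j) := fun j => by
    refine ⟨2, ?_⟩
    have hc := IsSuperCommutative.comm (𝒜 := 𝒜) 1 1 (h1 j) (o j) (SetLike.coe_mem _) (ho j)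
    rw [pow_two, mul_assoc, ← mul_assoc (h1 j), hc, smul_mul_assoc, mul_smul_comm, ← mul_assoc,
      ← mul_assoc, IsSuperCommutative.mul_self_of_odd (ho j), zero_mul, zero_mul, smul_zero]
  have hsum : ∑ j, o j * h j = ∑ j, o j * h1 j + ∑ j, o j * h0 j := by
    rw [← Finset.sum_add_distrib]
    exact Finset.sum_congr rfl fun j _ => by rw [hh j, mul_add, add_comm]
  rw [hsum]
  refine Commute.isNilpotent_add ?_ (Commute.isNilpotent_sum (fun j _ => hsq j) fun i j _ _ =>
    IsSuperCommutative.commute_of_even (heven i) _) ⟨2, ?_⟩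
  · exact IsSuperCommutative.commute_of_even (Submodule.sum_mem _ fun j _ => heven j) _
  · rw [pow_two, IsSuperCommutative.mul_self_of_odd hodd]

/-- Every section of a superdomain is the sum of its reduction and of multiples of the `θ_j`. -/
theorem exists_domain_reduction {p q : ℕ} {U : Opens (EuclideanSpace ℝ (Fin p))}
    (s : DomainFun q U) : ∃ (f : smoothFun U) (h : Fin q → DomainFun q U),
      (∀ y, f.1 y = domainEval y s) ∧ s = tmk f 1 + ∑ j, tmk 1 (theta q j) * h j := by
  induction s using DomainFun.induction with
  | zero => exact ⟨0, 0, fun y => by rw [map_zero]; rfl, by simp [tmk_zero_left]⟩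
  | add s t hs ht =>
    obtain ⟨f, h, hf, hs⟩ := hs
    obtain ⟨f', h', hf', ht⟩ := ht
    refine ⟨f + f', h + h', fun y => ?_, ?_⟩
    · rw [map_add, ← hf, ← hf']
      rfl
    · simp only [Pi.add_apply, mul_add, Finset.sum_add_distrib, tmk_add_left]
      conv_lhs => rw [hs, ht]
      abel
  | tmk f w =>
    obtain ⟨v, hv⟩ := exists_grassmann_expansion w
    refine ⟨ExteriorAlgebra.algebraMapInv w • f, fun j => tmk f (v j), fun y => ?_, ?_⟩
    · rw [domainEval_tmk, mul_comm]
      rfl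
    · conv_lhs => rw [hv]
      rw [tmk_add_right, tmk_sum_right, Algebra.algebraMap_eq_smul_one, tmk_smul_right,
        tmk_smul_left]
      simp only [tmk_mul, one_mul]

/-- In the chart, `s` is a nowhere vanishing smooth function plus a combination of the `θ_j`. The
first is an even unit, the second is nilpotent, and they commute. -/
theorem SuperChart.isUnit_of_value_ne_zero {X : Type u} [TopologicalSpace X]
    {M : SuperSheaf.{u, v} X} {p q : ℕ} (c : SuperChart M p q) {V : Opens X} (hV : V ≤ c.dom)
    {s : M.obj V} (hs : ∀ y (hy : y ∈ V), c.value hV hy s ≠ 0) : IsUnit s := by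
  obtain ⟨f, h, hf, hsum⟩ := exists_domain_reduction (c.coordIso hV s)
  have hf0 : ∀ y : c.image V, f.1 y ≠ 0 := fun y => by
    rw [hf]
    have h1 := hs (c.toHomeo.symm y.1) y.2.2
    rw [c.value_apply] at h1
    have h2 : (⟨c.toHomeo (c.toHomeo.symm y.1), c.mem_image y.2.2 hV⟩ : c.image V) = y :=
      Subtype.ext (c.toHomeo.right_inv y.2.1)
    rwa [h2] at h1
  have hfu : IsUnit f := by
    let g : smoothFun (c.image V) := smoothMk _ (fun y => (extendZero f y)⁻¹)
      ((contDiffOn_extendZero f).inv fun y hy => by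
        rw [extendZero_apply f hy]
        exact hf0 _)
    refine IsUnit.of_mul_eq_one g (smoothFun_ext fun y => ?_)
    change f.1 y * (extendZero f y.1)⁻¹ = 1
    rw [extendZero_apply f y.2, mul_inv_cancel₀ (hf0 y)]
  have hs' : s = (c.coordIso hV).symm (tmk f 1) +
      ∑ j, (c.coordIso hV).symm (tmk 1 (theta q j)) * (c.coordIso hV).symm (h j) := by
    rw [← AlgEquiv.symm_apply_apply (c.coordIso hV) s, hsum, map_add, map_sum]
    simp only [map_mul]
  have hfu' : IsUnit (tmk f (1 : Grassmann q)) := by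
    obtain ⟨g, hg⟩ := hfu.exists_right_inv
    refine isUnit_iff_exists.mpr ⟨tmk g 1, ?_, ?_⟩
    · rw [tmk_mul, hg, one_mul, tmk_one_one]
    · rw [tmk_mul, mul_comm, hg, one_mul, tmk_one_one]
  rw [hs']
  refine IsNilpotent.isUnit_add_left_of_commute (isNilpotent_sum_odd_mul (M.gr V) fun j =>
    c.coordIso_symm_mem hV (tmk_mem _ (theta_mem j))) (hfu'.map (c.coordIso hV).symm) ?_
  exact (IsSuperCommutative.commute_of_even (𝒜 := M.gr V)
    (c.coordIso_symm_mem hV (tmk_mem _ (SetLike.one_mem_graded (grassmannGr q)))) _).symm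

theorem SuperChart.continuous_value {X : Type u} [TopologicalSpace X]
    {M : SuperSheaf.{u, v} X} {p q : ℕ} (c : SuperChart M p q) (s : M.obj c.dom) :
    Continuous fun y : c.dom => c.value le_rfl y.2 s := by
  have h : Continuous fun y : c.dom =>
      (⟨c.toHomeo y, c.mem_image y.2 le_rfl⟩ : c.image c.dom) :=
    (continuousOn_iff_continuous_domRestrict.mp c.toHomeo.continuousOn).subtype_mk _
  exact (continuous_domainEval (c.coordIso le_rfl s)).comp h

/-! ### Evaluation at points -/

namespace Supermanifold

variable {X : Type u} [TopologicalSpace X] {p q : ℕ} (M : Supermanifold.{u, v} X p q)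

theorem ev_congr {x : X} {V : Opens X} (hx : x ∈ V) {s t : M.obj ⊤}
    (h : M.res (le_top : V ≤ ⊤) s = M.res le_top t) : M.ev x s = M.ev x t :=
  (M.exists_chart x).choose.eval_congr (M.exists_chart x).choose_spec hx h

theorem ev_eq_zero {x : X} {V : Opens X} (hx : x ∈ V) {s : M.obj ⊤}
    (h : M.res (le_top : V ≤ ⊤) s = 0) : M.ev x s = 0 :=
  (M.ev_congr hx (h.trans (map_zero _).symm)).trans (map_zero _)

theorem ev_eq_one {x : X} {V : Opens X} (hx : x ∈ V) {s : M.obj ⊤}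
    (h : M.res (le_top : V ≤ ⊤) s = 1) : M.ev x s = 1 :=
  (M.ev_congr hx (h.trans (map_one _).symm)).trans (map_one _)

/-- Local compactness is inherited from `ℝ^p`; it is what provides an exhaustion by compact sets. -/
theorem locallyCompactSpace (M : Supermanifold.{u, v} X p q) : LocallyCompactSpace X := by
  choose c hc using M.exists_chart
  let _ : ChartedSpace (EuclideanSpace ℝ (Fin p)) X :=
    { atlas := Set.range fun x => (c x).toHomeo
      chartAt := fun x => (c x).toHomeo
      mem_chart_source := hc
      chart_mem_atlas := fun x => ⟨x, rfl⟩ }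
  exact ChartedSpace.locallyCompactSpace (EuclideanSpace ℝ (Fin p)) X

variable [T2Space X]

/-- A character of the algebra of global sections that is local at `x` is the evaluation at `x`. -/
theorem eq_eval_of_local {x : X} (c : SuperChart M.toSuperSheaf p q) (hx : x ∈ c.dom)
    (χ : M.obj ⊤ →ₐ[ℝ] ℝ) (hχ : ∀ (s : M.obj ⊤) (V : Opens X), x ∈ V →
      M.res (le_top : V ≤ ⊤) s = 0 → χ s = 0) (s : M.obj ⊤) :
    χ s = c.eval (c.mem_source hx) s := by
  by_contra hne
  -- `w` lies in the kernel of `χ` but has nonzero value at `x`, so it is invertible near `x`.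
  -- Extending the germ of the inverse to a global `t`, the section `w * t - 1` vanishes near `x`,
  -- and locality of `χ` forces `-1 = 0`.
  let w : M.obj ⊤ := s - algebraMap ℝ _ (χ s)
  have hχu : χ w = 0 := by
    simp only [w]
    rw [map_sub, AlgHom.commutes]
    exact sub_self _
  have hu : c.value le_rfl hx (M.res le_top w) ≠ 0 := by
    rw [← c.eval_eq_value hx]
    simp only [w]
    rw [map_sub, AlgHom.commutes]
    exact sub_ne_zero.mpr (Ne.symm hne)
  have hopen : IsOpen {y : c.dom | c.value le_rfl y.2 (M.res le_top w) ≠ 0} :=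
    isOpen_ne_fun (c.continuous_value _) continuous_const
  let V : Opens X := ⟨_, c.dom.isOpen.isOpenMap_subtype_val _ hopen⟩
  have hV : V ≤ c.dom := by rintro _ ⟨y, -, rfl⟩; exact y.2
  have hxV : x ∈ V := ⟨⟨x, hx⟩, hu, rfl⟩
  have hunit : IsUnit (M.res (le_top : V ≤ ⊤) w) := by
    refine c.isUnit_of_value_ne_zero hV fun y hy => ?_
    have h1 := c.value_res le_rfl hV hy (M.res le_top w)
    rw [M.res_res] at h1
    rw [h1]
    obtain ⟨y', hy', rfl⟩ := hy
    exact hy'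
  obtain ⟨r, hr⟩ := hunit.exists_right_inv
  obtain ⟨t, V', hxV', hV', ht⟩ := M.exists_extension hxV r
  have h0 : M.res (le_top : V' ≤ ⊤) (w * t - 1) = 0 := by
    have := congrArg (M.res hV') hr
    rw [map_mul, M.res_res, map_one] at this
    rw [map_sub, map_mul, ht, this, map_one, sub_self]
  have h1 := hχ _ V' hxV' h0
  rw [map_sub, map_mul, hχu, zero_mul, map_one, zero_sub] at h1
  exact one_ne_zero (neg_eq_zero.mp h1)

/-- The evaluation at `x` can be computed in any chart. -/
theorem ev_eq_eval {x : X} (c : SuperChart M.toSuperSheaf p q) (hx : x ∈ c.dom) (s : M.obj ⊤) :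
    M.ev x s = c.eval (c.mem_source hx) s := by
  refine M.eq_eval_of_local c hx (M.ev x) (fun s V hxV hs => ?_) s
  have := (M.exists_chart x).choose.eval_congr (M.exists_chart x).choose_spec hxV
    (hs.trans (map_zero (M.res (le_top : V ≤ ⊤))).symm)
  exact this.trans (map_zero _)

theorem ev_eq_value {x : X} (c : SuperChart M.toSuperSheaf p q) {V : Opens X} (hV : V ≤ c.dom)
    (hx : x ∈ V) (s : M.obj ⊤) : M.ev x s = c.value hV hx (M.res le_top s) := by
  rw [M.ev_eq_eval c (hV hx), c.eval_eq_value_of_le hV hx]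

theorem continuous_ev (s : M.obj ⊤) : Continuous fun x => M.ev x s := by
  rw [continuous_iff_continuousAt]
  intro x
  obtain ⟨c, hc⟩ := M.exists_chart x
  have h1 := c.continuous_value (M.res le_top s)
  have h2 : ContinuousOn (fun x => M.ev x s) c.dom := by
    rw [continuousOn_iff_continuous_domRestrict]
    refine h1.congr fun y => (M.ev_eq_value c le_rfl y.2 s).symm
  exact h2.continuousAt (c.dom.isOpen.mem_nhds hc)

/-- A global section whose reduction vanishes nowhere is invertible. -/
theorem isUnit_of_ev_ne_zero {s : M.obj ⊤} (hs : ∀ x, M.ev x s ≠ 0) : IsUnit s := by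
  have hloc : ∀ x : X, ∃ (V : Opens X) (r : M.obj V), x ∈ V ∧ M.res le_top s * r = 1 ∧
      r * M.res le_top s = 1 := fun x => by
    obtain ⟨c, hc⟩ := M.exists_chart x
    have hu : IsUnit (M.res (le_top : c.dom ≤ ⊤) s) :=
      c.isUnit_of_value_ne_zero le_rfl fun y hy => by
        rw [← M.ev_eq_value c le_rfl hy]
        exact hs y
    obtain ⟨r, h1, h2⟩ := isUnit_iff_exists.mp hu
    exact ⟨c.dom, r, hc, h1, h2⟩
  choose V r hxV h1 h2 using hloc
  -- The local inverses agree on overlaps because a left inverse equals a right inverse.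
  obtain ⟨t, ht⟩ := M.exists_glue V (T := ⊤) (fun x _ => Opens.mem_iSup.mpr ⟨x, hxV x⟩) r (by
    intro i j
    have e1 := congrArg (M.res (inf_le_left : V i ⊓ V j ≤ V i)) (h2 i)
    have e2 := congrArg (M.res (inf_le_right : V i ⊓ V j ≤ V j)) (h1 j)
    rw [map_mul, M.res_res, map_one] at e1 e2
    exact left_inv_eq_right_inv e1 e2)
  refine isUnit_iff_exists.mpr ⟨t, ?_, ?_⟩
  · exact M.eq_of_locally_eq fun x _ => ⟨V x, hxV x, le_top, by
      rw [map_mul, ht x le_top, h1, map_one]⟩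
  · exact M.eq_of_locally_eq fun x _ => ⟨V x, hxV x, le_top, by
      rw [map_mul, ht x le_top, h2, map_one]⟩

/-! ### Exhaustion functions -/

/-- A nonnegative function that is at least one on a given compact set, supported near it. -/
theorem exists_bump_compact {K : Set X} (hK : IsCompact K) {U : Opens X} (hKU : K ⊆ U) :
    ∃ g : M.obj ⊤, (∀ y, 0 ≤ M.ev y g) ∧ (∀ y ∈ K, 1 ≤ M.ev y g) ∧
      ∀ V : Opens X, Disjoint (V : Set X) U → M.res (le_top : V ≤ ⊤) g = 0 := by
  have hb : ∀ x : K, ∃ ρ ∈ M.gr ⊤ 0, ∃ V W : Opens X, x.1 ∈ V ∧ V ≤ U ∧ ⊤ ≤ U ⊔ W ∧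
      M.res (le_top : V ≤ ⊤) ρ = 1 ∧ M.res (le_top : W ≤ ⊤) ρ = 0 :=
    fun x => M.exists_bump (hKU x.2)
  choose ρ _ V W hxV _ hUW h1 h0 using hb
  obtain ⟨t, ht⟩ := hK.elim_finite_subcover (fun x : K => (V x : Set X)) (fun x => (V x).isOpen)
    fun x hx => Set.mem_iUnion.mpr ⟨⟨x, hx⟩, hxV ⟨x, hx⟩⟩
  -- Squares make the sum nonnegative everywhere, and each point of `K` has a summand equal to 1.
  refine ⟨∑ x ∈ t, ρ x * ρ x, fun y => ?_, fun y hy => ?_, fun V' hV' => ?_⟩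
  · rw [map_sum]
    exact Finset.sum_nonneg fun x _ => by rw [map_mul]; exact mul_self_nonneg _
  · obtain ⟨x, hxt, hyx⟩ := Set.mem_iUnion₂.mp (ht hy)
    rw [map_sum]
    refine le_trans ?_ (Finset.single_le_sum (f := fun x => M.ev y (ρ x * ρ x))
      (fun x _ => by rw [map_mul]; exact mul_self_nonneg _) hxt)
    rw [map_mul, M.ev_eq_one hyx (h1 x), one_mul]
  · rw [map_sum]
    refine Finset.sum_eq_zero fun x _ => ?_
    have hle : V' ≤ W x := fun y hy => (hUW x (Opens.mem_top y)).resolve_left fun hyU =>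
      Set.disjoint_left.mp hV' hy hyU
    rw [map_mul, ← M.res_res le_top hle, h0, map_zero, zero_mul]

/-- A supermanifold has a global section with proper reduction. -/
theorem exists_exhaustion [SecondCountableTopology X] :
    ∃ h : M.obj ⊤, ∀ C : ℝ, ∃ K : Set X, IsCompact K ∧ ∀ y, M.ev y h ≤ C → y ∈ K := by
  have := M.locallyCompactSpace
  let K : CompactExhaustion X := default
  -- `g n` is at least 1 on the shell between `interior (K (n + 1))` and `K (n + 2)`, and vanishes
  -- on the interior of `K n`.
  have hA : ∀ n, ∃ g : M.obj ⊤, (∀ y, 0 ≤ M.ev y g) ∧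
      (∀ y ∈ K (n + 2) \ interior (K (n + 1)), 1 ≤ M.ev y g) ∧
      ∀ V : Opens X, Disjoint (V : Set X) (K n)ᶜ → M.res (le_top : V ≤ ⊤) g = 0 := fun n =>
    M.exists_bump_compact (U := ⟨(K n)ᶜ, (K.isCompact n).isClosed.isOpen_compl⟩)
      ((K.isCompact (n + 2)).diff isOpen_interior) fun y hy hyn =>
        hy.2 (K.subset_interior_succ n hyn)
  choose g hg0 hg1 hgV using hA
  let V : ULift.{u} ℕ → Opens X := fun n => ⟨interior (K n.down), isOpen_interior⟩
  have hgz : ∀ (n : ULift.{u} ℕ) (m : ℕ), n.down ≤ m → ∀ V' : Opens X, V' ≤ V n →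
      M.res (le_top : V' ≤ ⊤) (g m) = 0 := fun n m hnm V' hV' =>
    hgV m V' (Set.disjoint_left.mpr fun y hy hyn =>
      hyn (K.subset hnm (interior_subset (hV' hy))))
  -- Partial sums of `∑ m • g m`. On the interior of `K n` only the terms with `m < n` survive, so
  -- they glue to a global section.
  let S : ℕ → M.obj ⊤ := fun n => ∑ m ∈ Finset.range n, (m : ℝ) • g m
  have hS : ∀ (n : ULift.{u} ℕ) (m : ℕ), n.down ≤ m → ∀ V' : Opens X, V' ≤ V n →
      M.res (le_top : V' ≤ ⊤) (S m) = M.res le_top (S n.down) := by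
    intro n m hnm V' hV'
    induction m, hnm using Nat.le_induction with
    | base => rfl
    | succ m hm ih =>
      simp only [S] at ih ⊢
      rw [Finset.sum_range_succ, map_add, ih, map_smul, hgz n m hm V' hV', smul_zero, add_zero]
  have hcov : ∀ y, ∃ n, y ∈ interior (K n) := fun y => by
    obtain ⟨n, hn⟩ := K.exists_mem y
    exact ⟨n + 1, K.subset_interior_succ n hn⟩
  obtain ⟨h, hh⟩ := M.exists_glue V (T := ⊤)
    (fun y _ => by
      obtain ⟨n, hn⟩ := hcov y
      exact Opens.mem_iSup.mpr ⟨⟨n⟩, hn⟩)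
    (fun n => M.res le_top (S n.down)) (by
      intro i j
      rw [M.res_res, M.res_res]
      rcases le_total i.down j.down with hij | hij
      · exact (hS i j.down hij _ inf_le_left).symm
      · exact hS j i.down hij _ inf_le_right)
  have hev : ∀ n, ∀ y ∈ interior (K n), M.ev y h = ∑ m ∈ Finset.range n, (m : ℝ) * M.ev y (g m) :=
    fun n y hy => by
      rw [M.ev_congr (V := V ⟨n⟩) hy (hh ⟨n⟩ le_top)]
      simp only [S]
      rw [map_sum]
      exact Finset.sum_congr rfl fun m _ => by rw [map_smul, smul_eq_mul]
  refine ⟨h, fun C => ?_⟩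
  obtain ⟨n, hn⟩ := exists_nat_gt C
  refine ⟨K (n + 1), K.isCompact _, fun y hy => ?_⟩
  by_contra hyn
  classical
  have hex := K.exists_mem y
  let l := Nat.find hex
  have hl : y ∈ K l := Nat.find_spec hex
  have hnl : n + 1 < l := by
    by_contra hle
    exact hyn (K.subset (not_lt.mp hle) hl)
  -- The first member of the exhaustion containing `y` is `K (m + 2)`, so `y` lies on the shell of
  -- `g m` and `h` is at least `m ≥ n > C` there.
  obtain ⟨m, hm⟩ : ∃ m, l = m + 2 := ⟨l - 2, by omega⟩
  have hy1 : 1 ≤ M.ev y (g m) := hg1 m y ⟨hm ▸ hl, fun hy' =>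
    Nat.find_min hex (m := m + 1) (by omega) (interior_subset hy')⟩
  have hyl : y ∈ interior (K (m + 3)) := K.subset_interior_succ (m + 2) (hm ▸ hl)
  rw [hev _ y hyl] at hy
  have h2 : (m : ℝ) * M.ev y (g m) ≤ ∑ m ∈ Finset.range (m + 3), (m : ℝ) * M.ev y (g m) :=
    Finset.single_le_sum (f := fun m : ℕ => (m : ℝ) * M.ev y (g m))
      (fun m _ => mul_nonneg (Nat.cast_nonneg m) (hg0 m y)) (Finset.mem_range.mpr (by omega))
  have h3 : (n : ℝ) ≤ m := by exact_mod_cast (by omega : n ≤ m)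
  have h4 : (m : ℝ) ≤ m * M.ev y (g m) := le_mul_of_one_le_right (Nat.cast_nonneg m) hy1
  linarith

/-- Every character of the algebra of global sections is the evaluation at a point. -/
theorem exists_eq_ev [SecondCountableTopology X] (χ : M.obj ⊤ →ₐ[ℝ] ℝ) :
    ∃ x : X, ∀ s, χ s = M.ev x s := by
  by_contra! hne
  choose f hf using hne
  obtain ⟨h, hh⟩ := M.exists_exhaustion
  obtain ⟨K, hK, hKh⟩ := hh (χ h)
  have hopen : ∀ x, IsOpen {y | M.ev y (f x) ≠ χ (f x)} := fun x =>
    isOpen_ne_fun (M.continuous_ev _) continuous_const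
  obtain ⟨t, ht⟩ := hK.elim_finite_subcover _ hopen
    fun x _ => Set.mem_iUnion.mpr ⟨x, (hf x).symm⟩
  let c : M.obj ⊤ → M.obj ⊤ := fun s => s - algebraMap ℝ _ (χ s)
  have hχc : ∀ s, χ (c s) = 0 := fun s => by
    simp only [c]
    rw [map_sub, AlgHom.commutes]
    exact sub_self _
  have hevc : ∀ y s, M.ev y (c s) = M.ev y s - χ s := fun y s => by
    simp only [c]
    rw [map_sub, AlgHom.commutes]
    rfl
  -- Off `K` the first square is positive, since `h` exceeds `χ h` there; on `K` the finite subcover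
  -- makes some other square positive. The unit thus obtained is killed by `χ`, a contradiction.
  have hu : IsUnit (c h * c h + ∑ x ∈ t, c (f x) * c (f x)) := by
    refine M.isUnit_of_ev_ne_zero fun y => ne_of_gt ?_
    rw [map_add, map_sum, map_mul, hevc]
    simp only [map_mul, hevc]
    have hnn : ∀ x ∈ t, 0 ≤ (M.ev y (f x) - χ (f x)) * (M.ev y (f x) - χ (f x)) :=
      fun x _ => mul_self_nonneg _
    by_cases hy : y ∈ K
    · obtain ⟨x, hxt, hyx⟩ := Set.mem_iUnion₂.mp (ht hy)
      refine add_pos_of_nonneg_of_pos (mul_self_nonneg _) (Finset.sum_pos' hnn ⟨x, hxt, ?_⟩)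
      exact mul_self_pos.mpr (sub_ne_zero.mpr hyx)
    · refine add_pos_of_pos_of_nonneg (mul_self_pos.mpr (sub_ne_zero.mpr fun he => ?_))
        (Finset.sum_nonneg hnn)
      exact hy (hKh y he.le)
  have h0 := (hu.map χ).ne_zero
  rw [map_add, map_sum, map_mul, hχc, mul_zero, zero_add] at h0
  exact h0 (Finset.sum_eq_zero fun x _ => by rw [map_mul, hχc, mul_zero])

/-- Evaluations separate points. -/
theorem eq_of_ev_eq {x y : X} (h : ∀ s, M.ev x s = M.ev y s) : x = y := by
  by_contra hne
  obtain ⟨ρ, -, V, W, hxV, -, hUW, h1, h0⟩ := M.exists_bump (x := x)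
    (U := ⟨{y}ᶜ, isOpen_compl_singleton⟩) hne
  have hyW : y ∈ W := (hUW (Opens.mem_top y)).resolve_left fun h => h rfl
  have := h ρ
  rw [M.ev_eq_one hxV h1, M.ev_eq_zero hyW h0] at this
  exact one_ne_zero this

end Supermanifold

/-! ### Germs -/

namespace SuperSheaf

variable {X : Type u} [TopologicalSpace X] (M : SuperSheaf.{u, v} X) {x : X} {U V : Opens X}

theorem germ_res (hV : x ∈ V) (h : V ≤ U) (s : M.obj U) :
    M.germ V hV (M.res h s) = M.germ U (h hV) s :=
  (DirectLimit.eq_of_le (f := M.nhdRes x)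
    (⟨OrderDual.toDual ⟨U, h hV⟩, s⟩ : Σ i : Nhd x, M.obj i.ofDual.1)
    (OrderDual.toDual ⟨V, hV⟩) h).symm

theorem germ_smul (hx : x ∈ U) (c : ℝ) (s : M.obj U) :
    M.germ U hx (c • s) = c • M.germ U hx s :=
  (DirectLimit.smul_def (G := fun i : Nhd x => M.obj i.ofDual.1) (f := M.nhdRes x)
    (OrderDual.toDual ⟨U, hx⟩) s c).symm

theorem exists_res_eq_of_germ_eq {hx : x ∈ U} {hx' : x ∈ V} {s : M.obj U} {t : M.obj V}
    (h : M.germ U hx s = M.germ V hx' t) :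
    ∃ (W : Opens X) (_ : x ∈ W) (hU : W ≤ U) (hV : W ≤ V), M.res hU s = M.res hV t := by
  obtain ⟨i, hi, hj, h⟩ := Quotient.exact h
  exact ⟨i.ofDual.1, i.ofDual.2, hi, hj, h⟩

/-- The germ map as an algebra morphism. -/
def germHom (U : Opens X) (hx : x ∈ U) : M.obj U →ₐ[ℝ] M.Stalk x :=
  AlgHom.mk'
    { toFun := M.germ U hx
      map_one' := M.germ_one hx
      map_mul' := M.germ_mul hx
      map_zero' := M.germ_zero hx
      map_add' := M.germ_add hx } (M.germ_smul hx)

theorem germHom_apply (hx : x ∈ U) (s : M.obj U) : M.germHom U hx s = M.germ U hx s := rfl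

theorem exists_germ_eq (z : M.Stalk x) : ∃ (U : Opens X) (hx : x ∈ U) (s : M.obj U),
    z = M.germ U hx s := by
  obtain ⟨U, hx, s, -, -, -, h, -⟩ := M.exists_rep z z (0 : M.VectorGerm x) 0
  exact ⟨U, hx, s, h⟩

theorem exists_vectorGerm_eq (z : M.VectorGerm x) :
    ∃ (U : Opens X) (hx : x ∈ U) (D : M.VectorField U), z = M.vectorGerm U hx D := by
  obtain ⟨U, hx, -, -, D, -, -, -, h, -⟩ := M.exists_rep (0 : M.Stalk x) 0 z z
  exact ⟨U, hx, D, h⟩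

theorem vectorGerm_vfRes (hV : x ∈ V) (h : V ≤ U) (D : M.VectorField U) :
    M.vectorGerm V hV (M.vfRes x (OrderDual.toDual ⟨U, h hV⟩) (OrderDual.toDual ⟨V, hV⟩) h D) =
      M.vectorGerm U (h hV) D :=
  (DirectLimit.eq_of_le (f := M.vfRes x)
    (⟨OrderDual.toDual ⟨U, h hV⟩, D⟩ : Σ i : Nhd x, M.VectorField i.ofDual.1)
    (OrderDual.toDual ⟨V, hV⟩) h).symm

theorem vectorGerm_smul (hx : x ∈ U) (c : ℝ) (D : M.VectorField U) :
    M.vectorGerm U hx (c • D) = c • M.vectorGerm U hx D :=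
  (DirectLimit.smul_def (G := fun i : Nhd x => M.VectorField i.ofDual.1) (f := M.vfRes x)
    (OrderDual.toDual ⟨U, hx⟩) D c).symm

theorem vectorGerm_sum {κ : Type*} (t : Finset κ) (hx : x ∈ U) (D : κ → M.VectorField U) :
    M.vectorGerm U hx (∑ i ∈ t, D i) = ∑ i ∈ t, M.vectorGerm U hx (D i) :=
  map_sum ({ toFun := M.vectorGerm U hx
             map_zero' := M.vectorGerm_zero hx
             map_add' := M.vectorGerm_add hx } : M.VectorField U →+ M.VectorGerm x) D t

end SuperSheaf

/-! ### The tensor product along an algebra morphism -/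

namespace RhoTensor

variable {A B L N : Type*} [Ring A] [Algebra ℝ A] [Ring B] [Algebra ℝ B] [AddCommGroup L]
  [Module ℝ L] [Module B L] [AddCommGroup N] [Module A N]

/-- Linear maps out of `A ⊗_ρ L`. -/
def lift (ρ : B →ₐ[ℝ] A) (f : A ⊗[ℝ] L →ₗ[A] N)
    (h : ∀ (a : A) (b : B) (l : L), f (a ⊗ₜ (b • l)) = f ((a * ρ b) ⊗ₜ l)) :
    RhoTensor ρ L →ₗ[A] N :=
  Submodule.liftQ _ f <| Submodule.span_le.mpr <| by
    rintro _ ⟨a, b, l, rfl⟩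
    rw [SetLike.mem_coe, LinearMap.mem_ker, map_sub, h, sub_self]

theorem mk_smul (ρ : B →ₐ[ℝ] A) (a : A) (b : B) (l : L) : mk ρ a (b • l) = mk ρ (a * ρ b) l :=
  (Submodule.Quotient.eq _).mpr (Submodule.subset_span ⟨a, b, l, rfl⟩)

theorem smul_mk (ρ : B →ₐ[ℝ] A) (a b : A) (l : L) : a • mk ρ b l = mk ρ (a * b) l := rfl

end RhoTensor

/-! ### Coordinate vector fields -/

/-- A homogeneous vector field on a superdomain that kills the coordinates is zero. -/
theorem domain_derivation_eq_zero {p q : ℕ} {U : Opens (EuclideanSpace ℝ (Fin p))} {k : ZMod 2}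
    {Z : DomainFun q U →ₗ[ℝ] DomainFun q U}
    (hZ : IsHomogeneousDerivation (GradedAlgHom.id ℝ (domainGr q U)) k Z)
    (h0 : ∀ i, Z (domainCoord q U i) = 0) : Z = 0 := by
  ext s
  -- `𝒪(U)` itself offers no nilpotent ideal containing the even coordinates, so `Z` is tested after
  -- composition with each Grassmann point.
  refine eq_zero_of_grassmannEval fun y => ?_
  have hX : IsHomogeneousDerivation (grassmannEval q y) k
      ((grassmannEval q y).toAlgHom.toLinearMap ∘ₗ Z) :=
    hZ.comp_left (grassmannEval q y) (fun _ => rfl) (fun _ => rfl)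
  have h := (isCoordinateSystem_domain (grassmannEval q y) y
    (grassmannEval_centredCoord_mem y)).eq_zero_of_homogeneous isNilpotent_range_ι hX fun i => by
      obtain ⟨c, hc⟩ := centredCoord_eq (q := q) (U := U) y.1 i
      change grassmannEval q y (Z (centredCoord q U y.1 i)) = 0
      rw [hc, map_sub, h0, hZ.map_algebraMap, sub_zero, map_zero]
  exact LinearMap.congr_fun h s

namespace SuperChart

variable {X : Type u} [TopologicalSpace X] {M : SuperSheaf.{u, v} X} {p q : ℕ}
  (c : SuperChart M p q) {U V : Opens X}

/-- The derivation `∂/∂x_i` or `∂/∂θ_j` of the sections over an open subset of a chart. -/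
def coordDer (hV : V ≤ c.dom) (i : CoordIndex p q) : M.obj V →ₗ[ℝ] M.obj V :=
  (c.ofDomain hV).toAlgHom.toLinearMap ∘ₗ domainFrame q (c.image V) i ∘ₗ
    (c.toDomain hV).toAlgHom.toLinearMap

theorem coordDer_apply (hV : V ≤ c.dom) (i : CoordIndex p q) (s : M.obj V) :
    c.coordDer hV i s = (c.coordIso hV).symm (domainFrame q (c.image V) i (c.coordIso hV s)) := rfl

theorem coordDer_homogeneous (hV : V ≤ c.dom) (i : CoordIndex p q) :
    IsHomogeneousDerivation (M.res (le_refl V)) (coordParity i) (c.coordDer hV i) :=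
  ((domainFrame_homogeneous i).comp_left (c.ofDomain hV) (χ := c.ofDomain hV)
    (Y := (c.ofDomain hV).toAlgHom.toLinearMap ∘ₗ domainFrame q (c.image V) i)
    (fun _ => rfl) (fun _ => rfl)).comp_right (c.toDomain hV)
    (fun s => (M.res_self s).trans ((c.coordIso hV).symm_apply_apply s).symm) (fun _ => rfl)

theorem res_coordDer (hU : U ≤ c.dom) (h : V ≤ U) (i : CoordIndex p q) (s : M.obj U) :
    M.res h (c.coordDer hU i s) = c.coordDer (h.trans hU) i (M.res h s) := by
  rw [coordDer_apply, coordDer_apply, c.res_coordIso_symm hU, c.coordIso_res hU,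
    domainFrame_domainRes]

/-- The coordinates of a chart, as sections of the structure sheaf. -/
def coordSection (hV : V ≤ c.dom) (i : CoordIndex p q) : M.obj V :=
  (c.coordIso hV).symm (domainCoord q (c.image V) i)

theorem res_coordSection (hU : U ≤ c.dom) (h : V ≤ U) (i : CoordIndex p q) :
    M.res h (c.coordSection hU i) = c.coordSection (h.trans hU) i := by
  rw [coordSection, c.res_coordIso_symm hU, domainRes_domainCoord]
  rfl

theorem coordDer_coordSection (hV : V ≤ c.dom) (i j : CoordIndex p q) :
    c.coordDer hV i (c.coordSection hV j) = if i = j then 1 else 0 := by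
  rw [coordDer_apply, coordSection, AlgEquiv.apply_symm_apply, domainFrame_domainCoord,
    apply_ite (c.coordIso hV).symm, map_one, map_zero]

theorem coordSection_mem (hV : V ≤ c.dom) (i : CoordIndex p q) :
    c.coordSection hV i ∈ M.gr V (coordParity i) := by
  refine c.coordIso_symm_mem hV ?_
  cases i with
  | inl i => exact tmk_mem _ (SetLike.one_mem_graded (grassmannGr q))
  | inr j => exact tmk_mem _ (theta_mem j)

theorem isDualFrame_coordDer (hV : V ≤ c.dom) :
    IsDualFrame (M.res (le_refl V)) coordParity (c.coordSection hV) (c.coordDer hV) where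
  homogeneous := c.coordDer_homogeneous hV
  apply_coord := c.coordDer_coordSection hV

/-- Derivations of the sections over an open subset of a chart are combinations of the coordinate
derivations. -/
theorem der_eq_sum (hV : V ≤ c.dom) {Y : M.obj V →ₗ[ℝ] M.obj V}
    (hY : Y ∈ Der (M.res (le_refl V))) :
    Y = ∑ i, Y (c.coordSection hV i) • c.coordDer hV i := by
  have hF := c.isDualFrame_coordDer hV
  -- Conjugation by the chart isomorphism reduces this to the superdomain.
  have hker : ∀ {k : ZMod 2} {Z : M.obj V →ₗ[ℝ] M.obj V},
      IsHomogeneousDerivation (M.res (le_refl V)) k Z →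
      (∀ i, Z (c.coordSection hV i) = 0) → Z = 0 := by
    intro k Z hZ h0
    let Z' : DomainFun q (c.image V) →ₗ[ℝ] DomainFun q (c.image V) :=
      (c.toDomain hV).toAlgHom.toLinearMap ∘ₗ Z ∘ₗ (c.ofDomain hV).toAlgHom.toLinearMap
    have hZ' : IsHomogeneousDerivation (GradedAlgHom.id ℝ (domainGr q (c.image V))) k Z' :=
      (hZ.comp_left (c.toDomain hV) (χ := c.toDomain hV)
        (Y := (c.toDomain hV).toAlgHom.toLinearMap ∘ₗ Z)
        (fun s => (congrArg (c.toDomain hV) (M.res_self s)).symm) (fun _ => rfl)).comp_right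
        (c.ofDomain hV) (fun s => ((c.coordIso hV).apply_symm_apply s).symm) (fun _ => rfl)
    have h1 := domain_derivation_eq_zero hZ' fun i => by
      change c.coordIso hV (Z (c.coordSection hV i)) = 0
      rw [h0, map_zero]
    ext s
    have h2 : c.coordIso hV (Z ((c.coordIso hV).symm (c.coordIso hV s))) = 0 :=
      LinearMap.congr_fun h1 (c.coordIso hV s)
    rw [AlgEquiv.symm_apply_apply, EmbeddingLike.map_eq_zero_iff] at h2
    exact h2
  obtain ⟨Z₀, Z₁, h₀, h₁, hZ⟩ := Submodule.sub_mem _ hY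
    (hF.sum_smul_mem_der fun i => Y (c.coordSection hV i))
  have h : ∀ i, Z₀ (c.coordSection hV i) = 0 ∧ Z₁ (c.coordSection hV i) = 0 := fun i =>
    eq_zero_of_homogeneous_add (𝒜 := M.gr V) (by simp) (h₀.1 _ _ (c.coordSection_mem hV i))
      (h₁.1 _ _ (c.coordSection_mem hV i)) (by
        rw [← LinearMap.add_apply, ← hZ, LinearMap.sub_apply, hF.sum_smul_apply, sub_self])
  rw [hker h₀ fun i => (h i).1, hker h₁ fun i => (h i).2, add_zero] at hZ
  exact sub_eq_zero.mp hZ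

/-- The coordinate vector fields of a chart. -/
def coordField (i : CoordIndex p q) : M.VectorField c.dom :=
  ⟨fun V => c.coordDer V.2 i, fun V => (c.coordDer_homogeneous V.2 i).mem_der,
    fun V _ h s => c.res_coordDer V.2 h i s⟩

/-- Germs of vector fields are combinations of the coordinate vector fields. -/
theorem exists_vectorGerm_eq_sum {x : X} (hx : x ∈ c.dom) (L : M.VectorGerm x) :
    ∃ b : CoordIndex p q → M.Stalk x, L = ∑ i, b i • M.vectorGerm c.dom hx (c.coordField i) := by
  obtain ⟨U, hxU, D, rfl⟩ := M.exists_vectorGerm_eq L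
  let U' : Opens X := U ⊓ c.dom
  have hxU' : x ∈ U' := ⟨hxU, hx⟩
  have hU : U' ≤ U := inf_le_left
  have hd : U' ≤ c.dom := inf_le_right
  let D' : M.VectorField U' := M.vfRes x (OrderDual.toDual ⟨U, hxU⟩) (OrderDual.toDual ⟨U', hxU'⟩) hU D
  let G : CoordIndex p q → M.VectorField U' := fun i =>
    M.vfRes x (OrderDual.toDual ⟨c.dom, hx⟩) (OrderDual.toDual ⟨U', hxU'⟩) hd (c.coordField i)
  -- The coefficients are the values of `D` on the coordinates over `U'`. As `D` commutes with
  -- restriction, they restrict to the right coefficients on every smaller `V`.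
  let f : CoordIndex p q → M.obj U' := fun i => D'.1 ⟨U', le_rfl⟩ (c.coordSection hd i)
  refine ⟨fun i => M.germ U' hxU' (f i), ?_⟩
  have h1 : D' = ∑ i, SuperSheaf.VectorField.smul (f i) (G i) := by
    refine SuperSheaf.VectorField.ext M fun V => ?_
    have hV : V.1 ≤ c.dom := V.2.trans hd
    rw [c.der_eq_sum hV (D'.2.1 V), AddSubmonoidClass.coe_finsetSum, Finset.sum_apply]
    refine Finset.sum_congr rfl fun i _ => ?_
    have h2 : M.res V.2 (f i) = D'.1 V (c.coordSection hV i) := by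
      simp only [f]
      rw [D'.2.2 ⟨U', le_rfl⟩ V V.2, c.res_coordSection hd]
    rw [SuperSheaf.VectorField.smul_apply, h2]
    rfl
  rw [← M.vectorGerm_vfRes hxU' hU D]
  refine (congrArg (M.vectorGerm U' hxU') h1).trans ?_
  rw [M.vectorGerm_sum]
  refine Finset.sum_congr rfl fun i _ => ?_
  rw [← M.germ_smul_vectorGerm, ← M.vectorGerm_vfRes hxU' hd]

end SuperChart

/-! ### Points with values in a super Weil algebra -/

namespace Supermanifold

variable {X : Type u} [TopologicalSpace X] {p q : ℕ} {M : Supermanifold.{u, v} X p q}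
  {A : Type*} [Ring A] [Algebra ℝ A] {𝒜 : ZMod 2 → Submodule ℝ A} [GradedAlgebra 𝒜]
  [SuperWeilAlgebra 𝒜] {xA : M.Point 𝒜} {x : X}

theorem isBasePoint_iff : IsBasePoint xA x ↔ ∀ s, augmentation 𝒜 (xA s) = M.ev x s :=
  forall_congr' fun _ => augmentation_eq_iff.symm

theorem exists_isBasePoint [T2Space X] [SecondCountableTopology X] (xA : M.Point 𝒜) :
    ∃ x, IsBasePoint xA x := by
  obtain ⟨x, hx⟩ := M.exists_eq_ev ((augmentation 𝒜).comp xA.toAlgHom)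
  exact ⟨x, isBasePoint_iff.mpr hx⟩

theorem IsBasePoint.unique [T2Space X] {y : X} (hx : IsBasePoint xA x) (hy : IsBasePoint xA y) :
    y = x :=
  M.eq_of_ev_eq fun s => by rw [← isBasePoint_iff.mp hx, ← isBasePoint_iff.mp hy]

namespace IsBasePoint

theorem isUnit_of_res_eq_one (hx : IsBasePoint xA x) {V : Opens X} (hxV : x ∈ V) {ρ : M.Fun}
    (hρ : M.res (le_top : V ≤ ⊤) ρ = 1) : IsUnit (xA ρ) := by
  refine isUnit_of_augmentation_ne_zero (𝒜 := 𝒜) ?_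
  rw [isBasePoint_iff.mp hx, M.ev_eq_one hxV hρ]
  exact one_ne_zero

variable [T2Space X]

/-- A bump function at `x` annihilates `s`, and its image is a unit because it has value 1 at the
base point. -/
theorem map_eq_zero (hx : IsBasePoint xA x) {V : Opens X} (hxV : x ∈ V) {s : M.Fun}
    (hs : M.res (le_top : V ≤ ⊤) s = 0) : xA s = 0 := by
  obtain ⟨ρ, -, h0, V', hxV', h1⟩ := M.exists_bump_mul_eq_zero hxV hs
  have := congrArg xA h0
  rw [map_mul, map_zero] at this
  exact (hx.isUnit_of_res_eq_one hxV' h1).mul_right_eq_zero.mp this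

theorem map_eq_of_germ_eq (hx : IsBasePoint xA x) {s t : M.Fun}
    (h : M.germ ⊤ (Opens.mem_top x) s = M.germ ⊤ (Opens.mem_top x) t) : xA s = xA t := by
  obtain ⟨W, hxW, _, _, h⟩ := M.exists_res_eq_of_germ_eq h
  rw [← sub_eq_zero, ← map_sub]
  exact hx.map_eq_zero hxW (by rw [map_sub, sub_eq_zero]; exact h)

end IsBasePoint

/-- Cutting off by a bump function makes `𝒪(M)` surject onto the stalk, so a factorization through
the stalk is determined by `x_A`. -/
theorem exists_germ_top_eq [T2Space X] (M : Supermanifold.{u, v} X p q) (z : M.Stalk x) :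
    ∃ s : M.Fun, M.germ ⊤ (Opens.mem_top x) s = z := by
  obtain ⟨U, hxU, s, rfl⟩ := M.exists_germ_eq z
  obtain ⟨t, V, hxV, hV, h⟩ := M.exists_extension hxU s
  refine ⟨t, ?_⟩
  rw [← M.germ_res hxV le_top, h, M.germ_res]

/-! ### Extension of an `A`-point to germs of functions and vector fields -/

namespace IsBasePoint

variable [T2Space X]

/-- The factorization of an `A`-point through the stalk at its base point. -/
def stalkHom (hx : IsBasePoint xA x) : M.Stalk x →ₐ[ℝ] A :=
  have spec := fun z => (M.exists_germ_top_eq z).choose_spec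
  -- The value does not depend on the chosen global lift, so each algebraic law can be checked on a
  -- convenient one.
  have key : ∀ {z : M.Stalk x} {s : M.Fun}, M.germ ⊤ (Opens.mem_top x) s = z →
      xA (M.exists_germ_top_eq z).choose = xA s :=
    fun h => hx.map_eq_of_germ_eq ((spec _).trans h.symm)
  AlgHom.mk'
    { toFun := fun z => xA (M.exists_germ_top_eq z).choose
      map_one' := (key (M.germ_one _)).trans (map_one xA)
      map_mul' := fun z w =>
        (key (by rw [M.germ_mul, spec, spec])).trans (map_mul xA _ _)
      map_zero' := (key (M.germ_zero _)).trans (map_zero xA)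
      map_add' := fun z w =>
        (key (by rw [M.germ_add, spec, spec])).trans (map_add xA _ _) }
    fun c z => (key (by rw [M.germ_smul, spec])).trans (map_smul xA c _)

theorem stalkHom_germ_top (hx : IsBasePoint xA x) (s : M.Fun) :
    hx.stalkHom (M.germ ⊤ (Opens.mem_top x) s) = xA s :=
  hx.map_eq_of_germ_eq (M.exists_germ_top_eq (M.germ ⊤ (Opens.mem_top x) s)).choose_spec

theorem stalkHom_unique (hx : IsBasePoint xA x) (ψ : M.Stalk x →ₐ[ℝ] A)
    (h : ∀ s : M.Fun, ψ (M.germ ⊤ (Opens.mem_top x) s) = xA s) : ψ = hx.stalkHom := by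
  ext z
  obtain ⟨s, rfl⟩ := M.exists_germ_top_eq z
  rw [h, hx.stalkHom_germ_top]

/-- The morphism induced by an `A`-point on the sections near its base point. -/
def sectionHom (hx : IsBasePoint xA x) (U : Opens X) (hxU : x ∈ U) : M.gr U →ₐᵍ[ℝ] 𝒜 where
  __ := hx.stalkHom.comp (M.germHom U hxU)
  map_mem {k s} hs := by
    -- Parity is transferred by replacing `s` with a homogeneous global section having the same
    -- germ, since `x_A` is graded on global sections.
    obtain ⟨t, ht, V, hxV, hV, h⟩ := M.exists_homogeneous_extension hxU hs
    change hx.stalkHom (M.germ U hxU s) ∈ 𝒜 k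
    rw [← M.germ_res hxV hV, ← h, M.germ_res, hx.stalkHom_germ_top]
    exact Graded.map_mem xA ht

theorem sectionHom_apply (hx : IsBasePoint xA x) {U : Opens X} (hxU : x ∈ U) (s : M.obj U) :
    hx.sectionHom U hxU s = hx.stalkHom (M.germ U hxU s) := rfl

theorem sectionHom_res_top (hx : IsBasePoint xA x) {U : Opens X} (hxU : x ∈ U) (s : M.Fun) :
    hx.sectionHom U hxU (M.res le_top s) = xA s := by
  rw [sectionHom_apply, M.germ_res, hx.stalkHom_germ_top]

/-- The derivation `s ↦ x_A([D s]_x)` defined by a derivation `D` near the base point. -/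
def inducedDer (hx : IsBasePoint xA x) {U : Opens X} (hxU : x ∈ U) (D : M.obj U →ₗ[ℝ] M.obj U) :
    M.Fun →ₗ[ℝ] A :=
  (hx.sectionHom U hxU).toAlgHom.toLinearMap ∘ₗ D ∘ₗ (M.res le_top).toAlgHom.toLinearMap

theorem inducedDer_apply (hx : IsBasePoint xA x) {U : Opens X} (hxU : x ∈ U)
    (D : M.obj U →ₗ[ℝ] M.obj U) (s : M.Fun) :
    hx.inducedDer hxU D s = hx.stalkHom (M.germ U hxU (D (M.res le_top s))) := rfl

theorem inducedDer_homogeneous (hx : IsBasePoint xA x) {U : Opens X} (hxU : x ∈ U)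
    {D : M.obj U →ₗ[ℝ] M.obj U} {k : ZMod 2}
    (hD : IsHomogeneousDerivation (M.res (le_refl U)) k D) :
    IsHomogeneousDerivation xA k (hx.inducedDer hxU D) :=
  (hD.comp_left (hx.sectionHom U hxU) (χ := hx.sectionHom U hxU)
    (Y := (hx.sectionHom U hxU).toAlgHom.toLinearMap ∘ₗ D)
    (fun s => (congrArg (hx.sectionHom U hxU) (M.res_self s)).symm) (fun _ => rfl)).comp_right
    (M.res le_top) (fun s => (hx.sectionHom_res_top hxU s).symm) (fun _ => rfl)

theorem inducedDer_mem_der (hx : IsBasePoint xA x) {U : Opens X} (hxU : x ∈ U)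
    {D : M.obj U →ₗ[ℝ] M.obj U} (hD : D ∈ Der (M.res (le_refl U))) :
    hx.inducedDer hxU D ∈ Der xA := by
  obtain ⟨D₀, D₁, h₀, h₁, rfl⟩ := hD
  have h : hx.inducedDer hxU (D₀ + D₁) = hx.inducedDer hxU D₀ + hx.inducedDer hxU D₁ := by
    rw [inducedDer, LinearMap.add_comp, LinearMap.comp_add]
    rfl
  rw [h]
  exact Submodule.add_mem _ (hx.inducedDer_homogeneous hxU h₀).mem_der
    (hx.inducedDer_homogeneous hxU h₁).mem_der

/-- Compatibility with shrinking the neighbourhood lets the construction descend to germs of vector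
fields. -/
theorem inducedDer_vfRes (hx : IsBasePoint xA x) {U V : Opens X} (hxV : x ∈ V) (h : V ≤ U)
    (D : M.VectorField U) : hx.inducedDer hxV (D.1 ⟨V, h⟩) =
      hx.inducedDer (h hxV) (D.1 ⟨U, le_rfl⟩) := by
  ext s
  rw [inducedDer_apply, inducedDer_apply, ← M.germ_res hxV h,
    D.2.2 ⟨U, le_rfl⟩ ⟨V, h⟩ h, M.res_res]

theorem inducedDer_add (hx : IsBasePoint xA x) {U : Opens X} (hxU : x ∈ U)
    (D E : M.obj U →ₗ[ℝ] M.obj U) :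
    hx.inducedDer hxU (D + E) = hx.inducedDer hxU D + hx.inducedDer hxU E := by
  rw [inducedDer, LinearMap.add_comp, LinearMap.comp_add]
  rfl

theorem inducedDer_smul (hx : IsBasePoint xA x) {U : Opens X} (hxU : x ∈ U) (c : ℝ)
    (D : M.obj U →ₗ[ℝ] M.obj U) :
    hx.inducedDer hxU (c • D) = c • hx.inducedDer hxU D := by
  rw [inducedDer, LinearMap.smul_comp, LinearMap.comp_smul]
  rfl

/-- The derivation `s ↦ x_A([D s]_x)` defined by the germ of a vector field `D`. -/
def germDerFun (hx : IsBasePoint xA x) : M.VectorGerm x → M.Fun →ₗ[ℝ] A :=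
  DirectLimit.lift (M.vfRes x)
    (fun i (D : M.VectorField i.ofDual.1) => hx.inducedDer i.ofDual.2 (D.1 ⟨i.ofDual.1, le_rfl⟩))
    fun _ j h D => (hx.inducedDer_vfRes j.ofDual.2 h D).symm

theorem germDerFun_vectorGerm (hx : IsBasePoint xA x) {U : Opens X} (hxU : x ∈ U)
    (D : M.VectorField U) :
    hx.germDerFun (M.vectorGerm U hxU D) = hx.inducedDer hxU (D.1 ⟨U, le_rfl⟩) := rfl

theorem germDerFun_mem_der (hx : IsBasePoint xA x) (L : M.VectorGerm x) :
    hx.germDerFun L ∈ Der xA := by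
  obtain ⟨U, hxU, D, rfl⟩ := M.exists_vectorGerm_eq L
  exact hx.inducedDer_mem_der hxU (D.2.1 ⟨U, le_rfl⟩)

theorem germDerFun_add (hx : IsBasePoint xA x) (L L' : M.VectorGerm x) :
    hx.germDerFun (L + L') = hx.germDerFun L + hx.germDerFun L' := by
  obtain ⟨U, hxU, -, -, D, E, -, -, rfl, rfl⟩ := M.exists_rep (0 : M.Stalk x) 0 L L'
  rw [← M.vectorGerm_add, germDerFun_vectorGerm, germDerFun_vectorGerm, germDerFun_vectorGerm]
  exact hx.inducedDer_add hxU _ _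

theorem germDerFun_smul (hx : IsBasePoint xA x) (c : ℝ) (L : M.VectorGerm x) :
    hx.germDerFun (c • L) = c • hx.germDerFun L := by
  obtain ⟨U, hxU, D, rfl⟩ := M.exists_vectorGerm_eq L
  rw [← M.vectorGerm_smul, germDerFun_vectorGerm, germDerFun_vectorGerm]
  exact hx.inducedDer_smul hxU c _

/-- The map `[D] ↦ (s ↦ x_A([D s]_x))`. -/
def germDer (hx : IsBasePoint xA x) : M.VectorGerm x →ₗ[ℝ] Der xA where
  toFun L := ⟨hx.germDerFun L, hx.germDerFun_mem_der L⟩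
  map_add' L L' := Subtype.ext (hx.germDerFun_add L L')
  map_smul' c L := Subtype.ext (hx.germDerFun_smul c L)

/-- Multiplicativity of the stalk map; it supplies exactly the relation that the quotient `A ⊗_ρ 𝒯`
imposes. -/
theorem germDer_smul (hx : IsBasePoint xA x) (b : M.Stalk x) (L : M.VectorGerm x) :
    hx.germDer (b • L) = hx.stalkHom b • hx.germDer L := by
  obtain ⟨U, hxU, f, -, D, -, rfl, -, rfl, -⟩ := M.exists_rep b 0 L 0
  rw [M.germ_smul_vectorGerm]
  refine Subtype.ext (LinearMap.ext fun s => ?_)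
  change hx.stalkHom (M.germ U hxU (M.res le_rfl f * D.1 ⟨U, le_rfl⟩ (M.res le_top s))) =
    hx.stalkHom (M.germ U hxU f) * hx.stalkHom (M.germ U hxU (D.1 ⟨U, le_rfl⟩ (M.res le_top s)))
  rw [M.res_self, M.germ_mul, map_mul]

/-- The canonical map `A ⊗ 𝒯_{M,x} → Der`, before passing to the quotient. -/
def tensorDer (hx : IsBasePoint xA x) : A ⊗[ℝ] M.VectorGerm x →ₗ[A] Der xA :=
  TensorProduct.AlgebraTensorModule.lift
    (LinearMap.toSpanSingleton A (M.VectorGerm x →ₗ[ℝ] Der xA) hx.germDer)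

theorem tensorDer_tmul (hx : IsBasePoint xA x) (a : A) (L : M.VectorGerm x) :
    hx.tensorDer (a ⊗ₜ L) = a • hx.germDer L := rfl

/-- The canonical map `A ⊗_{x_A} 𝒯_{M,x} → Der`. -/
def rhoTensorDer (hx : IsBasePoint xA x) :
    RhoTensor hx.stalkHom (M.VectorGerm x) →ₗ[A] Der xA :=
  RhoTensor.lift (L := M.VectorGerm x) (N := Der xA) hx.stalkHom hx.tensorDer fun a b L => by
    rw [tensorDer_tmul, tensorDer_tmul, germDer_smul, mul_smul]

theorem rhoTensorDer_mk (hx : IsBasePoint xA x) (a : A) (L : M.VectorGerm x) :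
    hx.rhoTensorDer (RhoTensor.mk hx.stalkHom a L) = a • hx.germDer L := rfl

/-! ### Coordinates at the base point and bijectivity of the canonical map -/

section Chart

variable (c : SuperChart M.toSuperSheaf p q)

/-- The coordinates of a chart around the base point extend, up to germs, to a global coordinate
system with the coordinate derivations as dual frame. -/
theorem exists_coordinateSystem (hx : IsBasePoint xA x) (hc : x ∈ c.dom) :
    ∃ t : CoordIndex p q → M.Fun, IsCoordinateSystem xA (nilSubmodule 𝒜) coordParity t ∧
      IsDualFrame xA coordParity t fun i => hx.inducedDer hc (c.coordDer le_rfl i) := by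
  let a : c.image c.dom := ⟨c.toHomeo x, c.mem_image hc le_rfl⟩
  let τ : CoordIndex p q → M.obj c.dom :=
    fun i => (c.coordIso le_rfl).symm (centredCoord q (c.image c.dom) a.1 i)
  have hτ : ∀ i, ∃ t ∈ M.gr ⊤ (coordParity i), ∃ (V : Opens X) (_ : x ∈ V) (hV : V ≤ c.dom),
      M.res le_top t = M.res hV (τ i) := fun i =>
    M.exists_homogeneous_extension hc (c.coordIso_symm_mem le_rfl (centredCoord_mem a.1 i))
  choose t ht V hxV hV htV using hτ
  have hgerm : ∀ i, M.germ ⊤ (Opens.mem_top x) (t i) = M.germ c.dom hc (τ i) := fun i => by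
    rw [← M.germ_res (hxV i) le_top, htV, M.germ_res]
  refine ⟨t, ⟨ht, fun i => ?_, fun s => ?_⟩, fun i => ?_, fun i j => ?_⟩
  -- The base point property turns the reduction of `xA (t i)` into the value at `x` of a coordinate
  -- centred there, which is zero.
  · refine augmentation_eq_zero_iff.mp ?_
    rw [isBasePoint_iff.mp hx, M.ev_eq_value c (hV i) (hxV i), htV, c.value_res le_rfl,
      c.value_apply, AlgEquiv.apply_symm_apply]
    exact domainEval_centredCoord a i
  · obtain ⟨g, hg⟩ := exists_domain_expansion a (c.coordIso le_rfl (M.res le_top s))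
    set r : ℝ := domainEval a (c.coordIso le_rfl (M.res le_top s)) with hr
    have hG : ∀ i, ∃ G : M.Fun, M.germ ⊤ (Opens.mem_top x) G =
        M.germ c.dom hc ((c.coordIso le_rfl).symm (g i)) := fun i => M.exists_germ_top_eq _
    choose G hG using hG
    have h1 : M.res le_top s = algebraMap ℝ (M.obj c.dom) r +
        ∑ i, τ i * (c.coordIso le_rfl).symm (g i) := by
      rw [← AlgEquiv.symm_apply_apply (c.coordIso le_rfl) (M.res le_top s), hg, map_add, map_sum,
        AlgEquiv.commutes]
      simp only [map_mul]
      rfl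
    -- The chart expansion globalizes only up to germs at `x`; the error `z` has zero germ and is
    -- absorbed by a bump function.
    let z : M.Fun := s - (algebraMap ℝ M.Fun r + ∑ i, t i * G i)
    have hz : M.germ ⊤ (Opens.mem_top x) z = M.germ ⊤ (Opens.mem_top x) 0 := by
      have h2 : M.germ ⊤ (Opens.mem_top x) s = algebraMap ℝ (M.Stalk x) r +
          ∑ i, M.germ c.dom hc (τ i) * M.germ c.dom hc ((c.coordIso le_rfl).symm (g i)) := by
        rw [← M.germ_res hc le_top, h1, ← M.germHom_apply, map_add, map_sum, AlgHom.commutes]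
        simp only [map_mul]
        rfl
      rw [M.germ_zero, ← M.germHom_apply]
      simp only [z]
      rw [map_sub, map_add, map_sum, AlgHom.commutes]
      simp only [map_mul]
      simp only [M.germHom_apply, hgerm, hG]
      rw [h2, sub_self]
    obtain ⟨W, hxW, _, _, hW⟩ := M.exists_res_eq_of_germ_eq hz
    rw [map_zero] at hW
    obtain ⟨ρ, hρ, h0, V', hxV', h1'⟩ := M.exists_bump_mul_eq_zero hxW hW
    exact ⟨r, G, z, (add_sub_cancel _ _).symm, ρ, hρ, h0, hx.isUnit_of_res_eq_one hxV' h1'⟩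
  · exact hx.inducedDer_homogeneous hc (c.coordDer_homogeneous le_rfl i)
  · have h1 : c.coordDer le_rfl i (τ j) = if i = j then 1 else 0 := by
      rw [c.coordDer_apply, AlgEquiv.apply_symm_apply, domainFrame_centredCoord,
        apply_ite (c.coordIso le_rfl).symm, map_one, map_zero]
    -- `t j` is known to agree with the chart coordinate only on `V j`, so the derivation is
    -- computed there.
    have h2 := hx.inducedDer_vfRes (hxV j) (hV j) (c.coordField i)
    change hx.inducedDer hc ((c.coordField i).1 ⟨c.dom, le_rfl⟩) (t j) = _
    rw [← h2, inducedDer_apply, htV]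
    change hx.stalkHom (M.germ _ _ (c.coordDer (hV j) i (M.res (hV j) (τ j)))) = _
    rw [← c.res_coordDer le_rfl (hV j), h1, M.germ_res, ← M.germHom_apply,
      apply_ite (M.germHom _ _), apply_ite hx.stalkHom, map_one, map_one, map_zero, map_zero]

/-- The classes `1 ⊗ [∂_i]` span the source because stalk coefficients move into `A`. Their images
form the dual frame, a basis of the target: evaluation on the `t i` recovers the coefficients, and
every derivation is a combination of the frame. -/
theorem bijective_rhoTensorDer (hx : IsBasePoint xA x) :
    Function.Bijective hx.rhoTensorDer := by
  obtain ⟨c, hc⟩ := M.exists_chart x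
  obtain ⟨t, ht, hE⟩ := hx.exists_coordinateSystem c hc
  let L : CoordIndex p q → M.VectorGerm x := fun i => M.vectorGerm c.dom hc (c.coordField i)
  have hL : ∀ f : CoordIndex p q → A,
      (hx.rhoTensorDer (∑ i, f i • RhoTensor.mk hx.stalkHom 1 (L i))).1 =
        ∑ i, f i • hx.inducedDer hc (c.coordDer le_rfl i) := fun f => by
    rw [map_sum, AddSubmonoidClass.coe_finsetSum]
    refine Finset.sum_congr rfl fun i _ => ?_
    rw [map_smul, rhoTensorDer_mk, one_smul]
    rfl
  have hspan : ∀ z : RhoTensor hx.stalkHom (M.VectorGerm x), ∃ f : CoordIndex p q → A,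
      z = ∑ i, f i • RhoTensor.mk hx.stalkHom 1 (L i) := by
    intro z
    obtain ⟨w, rfl⟩ := Submodule.Quotient.mk_surjective _ z
    induction w using TensorProduct.induction_on with
    | zero => exact ⟨0, by simp⟩
    | add w w' hw hw' =>
      obtain ⟨f, hf⟩ := hw
      obtain ⟨f', hf'⟩ := hw'
      refine ⟨f + f', ?_⟩
      rw [Submodule.Quotient.mk_add, hf, hf', ← Finset.sum_add_distrib]
      exact Finset.sum_congr rfl fun i _ => by rw [Pi.add_apply, add_smul]
    | tmul a l =>
      obtain ⟨b, rfl⟩ := c.exists_vectorGerm_eq_sum hc l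
      refine ⟨fun i => a * hx.stalkHom (b i), ?_⟩
      rw [TensorProduct.tmul_sum, ← Submodule.mkQ_apply, map_sum]
      refine Finset.sum_congr rfl fun i _ => ?_
      refine (RhoTensor.mk_smul hx.stalkHom a (b i) (L i)).trans ?_
      rw [RhoTensor.smul_mk, mul_one]
  constructor
  · refine (injective_iff_map_eq_zero hx.rhoTensorDer).mpr fun z hz => ?_
    obtain ⟨f, rfl⟩ := hspan z
    have h1 : ∑ i, f i • hx.inducedDer hc (c.coordDer le_rfl i) = 0 := by
      rw [← hL, hz]
      rfl
    refine Finset.sum_eq_zero fun i _ => ?_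
    rw [← hE.sum_smul_apply f i, h1, LinearMap.zero_apply, zero_smul]
  · intro Y
    exact ⟨∑ i, Y.1 (t i) • RhoTensor.mk hx.stalkHom 1 (L i), Subtype.ext
      ((hL _).trans (hE.eq_sum_smul ht (nilSubmodule_isNilpotent 𝒜) Y.2).symm)⟩

end Chart

end IsBasePoint

end Supermanifold

end SuperGeom

end

theorem mainTheorem8 {A : Type*} [Ring A] [Algebra ℝ A] (𝒜 : ZMod 2 → Submodule ℝ A)
    [GradedAlgebra 𝒜] [SuperWeilAlgebra 𝒜] (p q : ℕ) :
    (∀ {X : Type*} [TopologicalSpace X] [T2Space X] [SecondCountableTopology X]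
      (M : Supermanifold X p q) (xA : M.Point 𝒜),
      ∃ x : X, Supermanifold.IsBasePoint xA x ∧
        (∀ y : X, Supermanifold.IsBasePoint xA y → y = x) ∧
        (∃ Φ : A ⊗[ℝ] M.TangentSpace x ≃ₗ[A] Der xA,
          (∀ (i j : ZMod 2), ∀ a ∈ 𝒜 i, ∀ v : M.TangentSpace x, M.IsHomogeneousTangent j v →
            IsHomogeneousDerivation xA (i + j) (Φ (a ⊗ₜ[ℝ] v)).1) ∧
          ∀ (a : A) (v : M.TangentSpace x) (s : M.Fun),
            (Φ (a ⊗ₜ[ℝ] v)).1 s - a * algebraMap ℝ A (v.1 s) ∈ SuperWeilAlgebra.nil 𝒜) ∧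
        ∃ xAx : M.Stalk x →ₐ[ℝ] A,
          (∀ s : M.Fun, xAx (M.germ ⊤ trivial s) = xA s) ∧
          (∀ ψ : M.Stalk x →ₐ[ℝ] A, (∀ s : M.Fun, ψ (M.germ ⊤ trivial s) = xA s) → ψ = xAx) ∧
          ∃ Ψ : RhoTensor xAx (M.VectorGerm x) ≃ₗ[A] Der xA,
            ∀ (a : A) (U : Opens X) (hx : x ∈ U) (D : M.VectorField U) (s : M.Fun),
              (Ψ (RhoTensor.mk xAx a (M.vectorGerm U hx D))).1 s =
                a * xAx (M.germ U hx (D.1 ⟨U, le_rfl⟩ (M.res le_top s)))) ∧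
    (∀ (U : Opens (EuclideanSpace ℝ (Fin p))) (xA : domainGr q U →ₐᵍ[ℝ] 𝒜),
      (∀ (f : Fin p → A) (F : Fin q → A), coordDerivation xA f F ∈ Der xA) ∧
      (∀ (f : Fin p → A) (F : Fin q → A) (k : ZMod 2),
        IsHomogeneousDerivation xA k (coordDerivation xA f F) ↔
          (∀ i, f i ∈ 𝒜 k) ∧ (∀ j, F j ∈ 𝒜 (k + 1))) ∧
      (∀ Y ∈ Der xA, ∃! fF : (Fin p → A) × (Fin q → A),
        ∀ s : DomainFun q U, Y s =
          ∑ i, fF.1 i * xA (dX i s) + ∑ j, fF.2 j * xA (dTheta j s))) := by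
  refine ⟨fun {X} _ _ _ M xA => ?_, fun U xA => superdomain_derivations xA⟩
  obtain ⟨x, hx⟩ := Supermanifold.exists_isBasePoint xA
  obtain ⟨c, hc⟩ := M.exists_chart x
  obtain ⟨t, ht, hE⟩ := hx.exists_coordinateSystem c hc
  have hev := Supermanifold.isBasePoint_iff.mp hx
  -- `M.TangentSpace x` is definitionally `pointDer (M.ev x)`, so the abstract equivalence applies
  -- as it stands. It is built from one chosen chart, while the second equivalence is the canonical
  -- map.
  refine ⟨x, hx, fun y hy => hx.unique hy, ⟨hE.tensorEquiv ht hev,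
    fun i j a ha v hv => hE.tensorEquiv_homogeneous ht hev ha hv,
    fun a v s => hE.tensorEquiv_tmul_sub_mem ht hev a v s⟩, hx.stalkHom, hx.stalkHom_germ_top,
    hx.stalkHom_unique, LinearEquiv.ofBijective hx.rhoTensorDer hx.bijective_rhoTensorDer,
    fun a U hxU D s => rfl⟩
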